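/- Let ${\bf FMn}$ be the category whose objects are pairs $(M,\mathcal D)$, with $M$ a smooth manifold (finite-dimensional, without boundary, Hausdorff, second countable) and $\mathcal D\subseteq TM$ an involutive smooth linear subbundle of constant rank, and whose morphisms $(M,\mathcal D)\to(M',\mathcal D')$ are the smooth maps $f\colon M\to M'$ such that $d_pf(\mathcal D_p)=\mathcal D'_{f(p)}$ for all $p\in M$. For a manifold $B$ let ${\bf FMn}_{(B,TB)}$ be the category of morphisms of ${\bf FMn}$ with target $(B,TB)$ and morphisms over $(B,TB)$. In a category, the kernel pair ${\rm KP}_\pi=M\times_BM\rightrightarrows M$ of a morphism $\pi\colon M\to B$ (when it exists) is a groupoid object over $M$, with source and target the first and second projection. An action $G\times M\to M$ of a group object $G$ gives the action groupoid $G\ltimes M\rightrightarrows M$, with source $(g,x)\mapsto x$, target $(g,x)\mapsto gx$ and composition $(h,gx)\circ(g,x)=(hg,x)$. We say that ${\rm KP}_\pi$ splits, with splitting group $G$, if it exists and there are an action of $G$ on $M$ (the product $G\times M$ being a categorical product) and an isomorphism of groupoid objects $G\ltimes M\cong{\rm KP}_\pi$ over $M$. In ${\bf FMn}$ the splitting group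 may be any group object. In ${\bf FMn}_{(B,TB)}$ the splitting groups are the group bundles with group connection, that is, the group objects $q\colon(G,\mathcal D_G)\to(B,TB)$ such that $q\colon G\to B$ is a (locally trivial) smooth fiber bundle. Let $B$ be a simply connected smooth manifold and let $\pi\colon(M,\mathcal L)\to(B,TB)$ be a morphism of ${\bf FMn}$ (it is then automatically a submersion) with ${\rm rank}\,\mathcal L=\dim B$. Then ${\rm KP}_\pi$ splits in ${\bf FMn}$ if and only if $\pi$, as a morphism of ${\bf FMn}_{(B,TB)}$ from $\pi\colon (M,\mathcal L)\to(B,TB)$ to the terminal object, has a kernel pair that splits in ${\bf FMn}_{(B,TB)}$. -/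

import Mathlib

open CategoryTheory CategoryTheory.Limits
open scoped Manifold ContDiff

universe u v w

/-! ## Group objects, actions, groupoid objects and splitting in a category

No global existence of products is assumed: each structure carries exactly the terminal object and
the binary products that it needs, as honest limits. Identities between morphisms are written on
generalized elements `Z ⟶ X`, which is the same as writing the usual diagrams. -/

section Categorical

variable {C : Type v} [Category.{w} C]

/-- A product of two objects: an object with two projections that is a limit cone. -/
structure BinProduct (X Y : C) where
  pt : C
  fst : pt ⟶ X
  snd : pt ⟶ Y
  isLimit : IsLimit (BinaryFan.mk fst snd)

namespace BinProduct

variable {X Y : C} (P : BinProduct X Y)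

/-- The morphism `(a, b)` into a product. -/
def lift {Z : C} (a : Z ⟶ X) (b : Z ⟶ Y) : Z ⟶ P.pt := P.isLimit.lift (BinaryFan.mk a b)

@[simp] theorem lift_fst {Z : C} (a : Z ⟶ X) (b : Z ⟶ Y) : P.lift a b ≫ P.fst = a :=
  P.isLimit.fac (BinaryFan.mk a b) ⟨WalkingPair.left⟩

@[simp] theorem lift_snd {Z : C} (a : Z ⟶ X) (b : Z ⟶ Y) : P.lift a b ≫ P.snd = b :=
  P.isLimit.fac (BinaryFan.mk a b) ⟨WalkingPair.right⟩

theorem ext_elem {Z : C} {a b : Z ⟶ P.pt} (h₁ : a ≫ P.fst = b ≫ P.fst)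
    (h₂ : a ≫ P.snd = b ≫ P.snd) : a = b :=
  BinaryFan.IsLimit.hom_ext P.isLimit h₁ h₂

theorem comp_lift {Z W : C} (h : W ⟶ Z) (a : Z ⟶ X) (b : Z ⟶ Y) :
    h ≫ P.lift a b = P.lift (h ≫ a) (h ≫ b) := by
  apply P.ext_elem <;> simp

theorem lift_eta {Z : C} (a : Z ⟶ P.pt) : P.lift (a ≫ P.fst) (a ≫ P.snd) = a := by
  apply P.ext_elem <;> simp

end BinProduct

/-- A group object in a category: an object `X`, a terminal object `⋆`, a product `X × X`, and
morphisms `⋆ ⟶ X`, `X × X ⟶ X`, `X ⟶ X` that satisfy the group laws. -/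
structure GroupObject (C : Type v) [Category.{w} C] where
  X : C
  pt : C
  isTerminal : IsTerminal pt
  square : BinProduct X X
  one : pt ⟶ X
  mul : square.pt ⟶ X
  inv : X ⟶ X
  mul_assoc : ∀ {Z : C} (a b c : Z ⟶ X),
    square.lift (square.lift a b ≫ mul) c ≫ mul = square.lift a (square.lift b c ≫ mul) ≫ mul
  one_mul : ∀ {Z : C} (a : Z ⟶ X), square.lift (isTerminal.from Z ≫ one) a ≫ mul = a
  mul_one : ∀ {Z : C} (a : Z ⟶ X), square.lift a (isTerminal.from Z ≫ one) ≫ mul = a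
  inv_mul : ∀ {Z : C} (a : Z ⟶ X), square.lift (a ≫ inv) a ≫ mul = isTerminal.from Z ≫ one
  mul_inv : ∀ {Z : C} (a : Z ⟶ X), square.lift a (a ≫ inv) ≫ mul = isTerminal.from Z ≫ one

namespace GroupObject

variable (G : GroupObject C)

/-- The product of two `Z`-elements of a group object. -/
def mulElem {Z : C} (a b : Z ⟶ G.X) : Z ⟶ G.X := G.square.lift a b ≫ G.mul

/-- The neutral `Z`-element of a group object. -/
def oneElem (Z : C) : Z ⟶ G.X := G.isTerminal.from Z ≫ G.one

theorem comp_mulElem {Z W : C} (h : W ⟶ Z) (a b : Z ⟶ G.X) :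
    h ≫ G.mulElem a b = G.mulElem (h ≫ a) (h ≫ b) := by
  unfold mulElem
  rw [← Category.assoc, G.square.comp_lift]

theorem comp_oneElem {Z W : C} (h : W ⟶ Z) : h ≫ G.oneElem Z = G.oneElem W := by
  unfold oneElem
  rw [← Category.assoc]
  congr 1
  exact G.isTerminal.hom_ext _ _

end GroupObject

/-- An action `G × M ⟶ M` of a group object `G` on an object `M`. -/
structure GroupObject.Action (G : GroupObject C) (M : C) where
  prod : BinProduct G.X M
  act : prod.pt ⟶ M
  act_mul : ∀ {Z : C} (g h : Z ⟶ G.X) (x : Z ⟶ M),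
    prod.lift (G.mulElem g h) x ≫ act = prod.lift g (prod.lift h x ≫ act) ≫ act
  act_one : ∀ {Z : C} (x : Z ⟶ M), prod.lift (G.oneElem Z) x ≫ act = x

/-- A groupoid object with object of objects `M`: an object of arrows with source and target
morphisms, such that for each `Z` the `Z`-elements of the object of arrows form, naturally in `Z`,
the arrows of a groupoid with objects the `Z`-elements of `M`. The element `comp f g` is
`g ∘ f`, that is, first `f` and then `g`. When the object of composable pairs exists, a
natural operation `comp` is the same as a morphism from it. -/
structure GroupoidObject (M : C) where
  arr : C
  s : arr ⟶ M
  t : arr ⟶ M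
  comp : ∀ {Z : C} (f g : Z ⟶ arr), f ≫ t = g ≫ s → (Z ⟶ arr)
  comp_s : ∀ {Z : C} (f g : Z ⟶ arr) (h : f ≫ t = g ≫ s), comp f g h ≫ s = f ≫ s
  comp_t : ∀ {Z : C} (f g : Z ⟶ arr) (h : f ≫ t = g ≫ s), comp f g h ≫ t = g ≫ t
  comp_natural : ∀ {Z W : C} (k : W ⟶ Z) (f g : Z ⟶ arr) (h : f ≫ t = g ≫ s)
    (h' : (k ≫ f) ≫ t = (k ≫ g) ≫ s), k ≫ comp f g h = comp (k ≫ f) (k ≫ g) h'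
  comp_assoc : ∀ {Z : C} (f g k : Z ⟶ arr) (h₁ : f ≫ t = g ≫ s) (h₂ : g ≫ t = k ≫ s)
    (h₃ : comp f g h₁ ≫ t = k ≫ s) (h₄ : f ≫ t = comp g k h₂ ≫ s),
    comp (comp f g h₁) k h₃ = comp f (comp g k h₂) h₄
  unit : M ⟶ arr
  unit_s : unit ≫ s = 𝟙 M
  unit_t : unit ≫ t = 𝟙 M
  unit_comp : ∀ {Z : C} (f : Z ⟶ arr) (h : (f ≫ s ≫ unit) ≫ t = f ≫ s),
    comp (f ≫ s ≫ unit) f h = f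
  comp_unit : ∀ {Z : C} (f : Z ⟶ arr) (h : f ≫ t = (f ≫ t ≫ unit) ≫ s),
    comp f (f ≫ t ≫ unit) h = f
  inv : arr ⟶ arr
  inv_s : inv ≫ s = t
  inv_t : inv ≫ t = s
  comp_inv : ∀ {Z : C} (f : Z ⟶ arr) (h : f ≫ t = (f ≫ inv) ≫ s),
    comp f (f ≫ inv) h = f ≫ s ≫ unit
  inv_comp : ∀ {Z : C} (f : Z ⟶ arr) (h : (f ≫ inv) ≫ t = f ≫ s),
    comp (f ≫ inv) f h = f ≫ t ≫ unit

/-- An isomorphism of groupoid objects over `M`: an isomorphism between the objects of arrows that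
is compatible with sources, targets and composition. -/
structure GroupoidObject.Iso {M : C} (𝒢 ℋ : GroupoidObject M) where
  iso : 𝒢.arr ≅ ℋ.arr
  hom_s : iso.hom ≫ ℋ.s = 𝒢.s
  hom_t : iso.hom ≫ ℋ.t = 𝒢.t
  hom_comp : ∀ {Z : C} (f g : Z ⟶ 𝒢.arr) (h : f ≫ 𝒢.t = g ≫ 𝒢.s)
    (h' : (f ≫ iso.hom) ≫ ℋ.t = (g ≫ iso.hom) ≫ ℋ.s),
    𝒢.comp f g h ≫ iso.hom = ℋ.comp (f ≫ iso.hom) (g ≫ iso.hom) h'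

/-- The action groupoid `G ⋉ M`: arrows `G × M`, source `(g, x) ↦ x`, target `(g, x) ↦ g • x`,
composition `(h, g • x) ∘ (g, x) = (h * g, x)`. -/
def GroupObject.Action.groupoid {G : GroupObject C} {M : C} (A : G.Action M) :
    GroupoidObject M where
  arr := A.prod.pt
  s := A.prod.snd
  t := A.act
  comp f g _ := A.prod.lift (G.mulElem (g ≫ A.prod.fst) (f ≫ A.prod.fst)) (f ≫ A.prod.snd)
  comp_s f g h := by simp
  comp_t f g h := by
    rw [A.act_mul, A.prod.lift_eta, h, A.prod.lift_eta]
  comp_natural k f g h h' := by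
    rw [A.prod.comp_lift, G.comp_mulElem]
    simp only [Category.assoc]
  comp_assoc f g k h₁ h₂ h₃ h₄ := by
    simp only [A.prod.lift_fst, A.prod.lift_snd]
    congr 1
    exact (G.mul_assoc _ _ _).symm
  unit := A.prod.lift (G.oneElem M) (𝟙 M)
  unit_s := by simp
  unit_t := A.act_one (𝟙 M)
  unit_comp f h := by
    apply A.prod.ext_elem
    · simp only [Category.assoc, A.prod.lift_fst, G.comp_oneElem]
      exact G.mul_one _
    · simp
  comp_unit f h := by
    apply A.prod.ext_elem
    · simp only [Category.assoc, A.prod.lift_fst, G.comp_oneElem]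
      exact G.one_mul _
    · simp
  inv := A.prod.lift (A.prod.fst ≫ G.inv) A.act
  inv_s := by simp
  inv_t := by
    have h : A.act = A.prod.lift A.prod.fst A.prod.snd ≫ A.act := by
      have := A.prod.lift_eta (𝟙 _)
      simp only [Category.id_comp] at this
      rw [this, Category.id_comp]
    have h' : G.mulElem (A.prod.fst ≫ G.inv) A.prod.fst = G.oneElem _ := G.inv_mul _
    have h'' := A.act_mul (A.prod.fst ≫ G.inv) A.prod.fst A.prod.snd
    rw [h', A.act_one, ← h] at h''
    exact h''.symm
  comp_inv f h := by
    apply A.prod.ext_elem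
    · simp only [Category.assoc, A.prod.lift_fst, G.comp_oneElem]
      have := G.inv_mul (f ≫ A.prod.fst)
      rwa [Category.assoc] at this
    · simp
  inv_comp f h := by
    apply A.prod.ext_elem
    · simp only [Category.assoc, A.prod.lift_fst, G.comp_oneElem]
      have := G.mul_inv (f ≫ A.prod.fst)
      rwa [Category.assoc] at this
    · simp

/-- The kernel pair `KP_π = M ×_B M ⇉ M` of `π : M ⟶ B`, as a groupoid object: the source and the
target are the two projections, and composition is `(y, z) ∘ (x, y) = (x, z)`. -/
noncomputable def kernelPairGroupoid {M B K : C} {π : M ⟶ B} {p q : K ⟶ M}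
    (h : IsKernelPair π p q) : GroupoidObject M where
  arr := K
  s := p
  t := q
  comp f g e := h.lift (f ≫ p) (g ≫ q) (by
    rw [Category.assoc, h.w, ← Category.assoc, e, Category.assoc, h.w, Category.assoc])
  comp_s _ _ _ := by simp
  comp_t _ _ _ := by simp
  comp_natural _ _ _ _ _ := by apply h.hom_ext <;> simp
  comp_assoc _ _ _ _ _ _ _ := by apply h.hom_ext <;> simp
  unit := h.lift (𝟙 M) (𝟙 M) rfl
  unit_s := by simp
  unit_t := by simp
  unit_comp _ _ := by apply h.hom_ext <;> simp
  comp_unit _ _ := by apply h.hom_ext <;> simp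
  inv := h.lift q p h.w.symm
  inv_s := by simp
  inv_t := by simp
  comp_inv _ _ := by apply h.hom_ext <;> simp
  inv_comp _ _ := by apply h.hom_ext <;> simp

/-- `G` is a splitting group for the groupoid object `𝒢` over `M`: there are an action of `G` on
`M` and an isomorphism of groupoid objects `G ⋉ M ≅ 𝒢`. -/
def GroupoidObject.SplitsBy {M : C} (𝒢 : GroupoidObject M) (G : GroupObject C) : Prop :=
  ∃ A : G.Action M, Nonempty (A.groupoid.Iso 𝒢)

/-- The kernel pair of `π` exists and `G` is a splitting group for it. -/
def KernelPairSplitsBy {M B : C} (π : M ⟶ B) (G : GroupObject C) : Prop :=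
  ∃ (K : C) (p q : K ⟶ M) (h : IsKernelPair π p q), (kernelPairGroupoid h).SplitsBy G

end Categorical

/-! ## Smooth manifolds and regular foliations -/

/-- A smooth manifold: finite-dimensional, without boundary, Hausdorff, second countable. -/
structure SmoothMfd : Type (u + 1) where
  carrier : Type u
  E : Type u
  H : Type u
  [normedAddCommGroup : NormedAddCommGroup E]
  [normedSpace : NormedSpace ℝ E]
  [finiteDimensional : FiniteDimensional ℝ E]
  [topologicalSpaceModel : TopologicalSpace H]
  I : ModelWithCorners ℝ E H
  [boundaryless : I.Boundaryless]
  [topologicalSpace : TopologicalSpace carrier]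
  [chartedSpace : ChartedSpace H carrier]
  [isManifold : IsManifold I ∞ carrier]
  [t2Space : T2Space carrier]
  [secondCountable : SecondCountableTopology carrier]

namespace SmoothMfd

instance : CoeSort SmoothMfd.{u} (Type u) := ⟨SmoothMfd.carrier⟩

attribute [instance] normedAddCommGroup normedSpace finiteDimensional topologicalSpaceModel
  boundaryless topologicalSpace chartedSpace isManifold t2Space secondCountable

/-- The dimension of a smooth manifold. -/
noncomputable def dim (M : SmoothMfd.{u}) : ℕ := Module.finrank ℝ M.E

instance (M : SmoothMfd.{u}) : IsManifold M.I 1 M :=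
  IsManifold.of_le (n := ∞) (by simp)

/-- The vector field `X` on `M` is smooth on `U`. -/
def SmoothFieldOn (M : SmoothMfd.{u}) (X : ∀ p : M, TangentSpace M.I p) (U : Set M) : Prop :=
  ContMDiffOn M.I M.I.tangent ∞ (fun p => (⟨p, X p⟩ : TangentBundle M.I M)) U

end SmoothMfd

/-- A regular foliation of rank `r` of a smooth manifold, as an involutive smooth linear subbundle
of rank `r` of the tangent bundle: `fiber p` is an `r`-dimensional subspace of `T_p M`, locally
spanned by `r` smooth vector fields, and the Lie bracket of two smooth vector fields on an open set
that are tangent to the subbundle is tangent to the subbundle. -/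
structure Foliation (M : SmoothMfd.{u}) where
  rank : ℕ
  fiber : ∀ p : M, Submodule ℝ (TangentSpace M.I p)
  finrank_fiber : ∀ p, Module.finrank ℝ (fiber p) = rank
  smooth : ∀ p : M, ∃ U : Set M, IsOpen U ∧ p ∈ U ∧
    ∃ X : Fin rank → ∀ q : M, TangentSpace M.I q,
      (∀ i, M.SmoothFieldOn (X i) U) ∧
        ∀ q ∈ U, fiber q = Submodule.span ℝ (Set.range fun i => X i q)
  involutive : ∀ (U : Set M) (X Y : ∀ q : M, TangentSpace M.I q), IsOpen U →
    M.SmoothFieldOn X U → M.SmoothFieldOn Y U →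
    (∀ q ∈ U, X q ∈ fiber q) → (∀ q ∈ U, Y q ∈ fiber q) →
    ∀ q ∈ U, VectorField.mlieBracket M.I X Y q ∈ fiber q

/-- The foliation `TM` of `M`, whose fibers are the whole tangent spaces. -/
noncomputable def Foliation.full (M : SmoothMfd.{u}) : Foliation M where
  rank := M.dim
  fiber _ := ⊤
  finrank_fiber p := by
    rw [finrank_top]
    rfl
  smooth p := by
    let e := trivializationAt M.E (TangentSpace M.I : M → Type u) p
    let b := Module.finBasis ℝ M.E
    have hl := e.isLocalFrameOn_localFrame_baseSet M.I ∞ b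
    refine ⟨e.baseSet, e.open_baseSet, mem_baseSet_trivializationAt _ _ p, e.localFrame b,
      fun i => hl.contMDiffOn i, fun q hq => ?_⟩
    exact (top_unique (hl.generating hq)).symm
  involutive _ _ _ _ _ _ _ _ _ _ := trivial

/-- Objects of the category of foliated manifolds: pairs `(M, 𝓕)`. -/
structure FMn : Type (u + 1) where
  mfd : SmoothMfd.{u}
  fol : Foliation mfd

namespace FMn

instance : CoeSort FMn.{u} (Type u) := ⟨fun M => M.mfd.carrier⟩

/-- Morphisms of foliated manifolds: smooth maps whose differential at each point `p` maps `𝓕_p`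
onto `𝓕'_{f p}`. -/
@[ext] structure Hom (M N : FMn.{u}) where
  toFun : M → N
  smooth : ContMDiff M.mfd.I N.mfd.I ∞ toFun
  map_fiber : ∀ p : M, (M.fol.fiber p).map
    (mfderiv M.mfd.I N.mfd.I toFun p : TangentSpace M.mfd.I p →ₗ[ℝ] TangentSpace N.mfd.I (toFun p))
      = N.fol.fiber (toFun p)

/-- The category of foliated manifolds. -/
instance : Category FMn.{u} where
  Hom := Hom
  id M :=
    { toFun := id
      smooth := contMDiff_id
      map_fiber := fun p => by
        rw [mfderiv_id]
        exact Submodule.map_id _ }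
  comp {M N P} f g :=
    { toFun := g.toFun ∘ f.toFun
      smooth := g.smooth.comp f.smooth
      map_fiber := fun p => by
        have h := mfderiv_comp p (g.smooth.mdifferentiable (by simp) (f.toFun p))
          (f.smooth.mdifferentiable (by simp) p)
        rw [h]
        refine (Submodule.map_comp _ _ _).trans ?_
        refine (congrArg _ (f.map_fiber p)).trans ?_
        exact g.map_fiber (f.toFun p) }

/-- The foliated manifold `(B, TB)`. -/
noncomputable def full (B : SmoothMfd.{u}) : FMn.{u} := ⟨B, Foliation.full B⟩

/-- The relative category over `(B, TB)`. -/
abbrev OverFull (B : SmoothMfd.{u}) := Over (full B)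

/-- `M ⟶ (B, TB)`, seen as a morphism over `(B, TB)` from `M` to the terminal object. -/
noncomputable def relative {M : FMn.{u}} {B : SmoothMfd.{u}} (π : M ⟶ full B) :
    (Over.mk π : OverFull B) ⟶ Over.mk (𝟙 (full B)) :=
  Over.homMk π

/-- A group object `q : (G, 𝓓) ⟶ (B, TB)` of the relative category is a group bundle with group
connection if `q` is a smooth fiber bundle: each point of `B` has an open neighborhood `U`
with a diffeomorphism `q⁻¹ U ≅ U × F` over `U`, for some smooth manifold `F`. -/
def IsGroupBundle {B : SmoothMfd.{u}} (G : GroupObject (OverFull B)) : Prop :=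
  ∀ b : B, ∃ (F : SmoothMfd.{u})
    (e : Bundle.Trivialization (Z := G.X.left.mfd.carrier) (B := B.carrier) F.carrier
      G.X.hom.toFun),
    b ∈ e.baseSet ∧
      ContMDiffOn G.X.left.mfd.I (B.I.prod F.I) ∞ e.toOpenPartialHomeomorph e.source ∧
      ContMDiffOn (B.I.prod F.I) G.X.left.mfd.I ∞ e.toOpenPartialHomeomorph.symm e.target

end FMn

/-! From `FMn` to the relative category. The unit of a group object of `FMn` is a morphism from the
terminal object, a point with zero distribution. Morphisms map distribution onto distribution, so
the distribution of the group is zero at the unit and, the rank being constant, everywhere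
(`rank_eq_zero_of_groupObject`). For such a `G` the product with any foliated manifold exists, with
distribution `0 × 𝓓` (`binProduct`). In particular `G × B → B` is a trivial bundle with connection
`0 × TB`, a group object over `(B, TB)`. As `(G × B) ×_B M = G × M`, the action and the isomorphism
with the kernel pair carry over (`KernelPairSplitsBy.over`).

The converse needs geometry. For a group bundle `G → B` with connection, `𝓓_G` is involutive and
complementary to the fibers: it is a flat connection. Over a simply connected `B` it is shown to be
a product `F × B`, with `F` a Lie group (`exists_flat_trivialization`, `splits_of_groupBundle`);
then a splitting by `G` over `B` is a splitting by `F` (`KernelPairSplitsBy.of_over`).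

Locally this is the Frobenius theorem: horizontal sections solve `∂_b f = A f`, where `A` is the
horizontal lift in a chart, and involutivity of `𝓓_G` is the integrability of this equation. It is
solved along rays, smoothly in the initial data (`exists_local_transport`, `exists_localTransport`).

The global problem is completeness: a flat connection on a bundle with noncompact fiber need not
have parallel transport along all paths. Here the group structure helps. Near the unit section all
horizontal sections live over one open set `U` (`exists_unit_nhd`). If `s₁` extends over `U` and
`s₁⁻¹ s₂` is close to the unit, then `s₂ = s₁ (s₁⁻¹ s₂)` extends over `U` as well
(`OnSection.transfer`). So extendability over `U` is locally constant on the total space over `U`,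
and local triviality of the bundle spreads it over a component of the typical fiber
(`exists_section_component`). With such uniform domains the horizontal sections form a covering
space, and monodromy gives a global section through each point (`exists_global_section`).

Parallel transport to a base point `b₀` then identifies `G` with `F × B`. Products of horizontal
sections are horizontal, so the multiplication of the fiber over `b₀` determines that of `G`. -/

section CategoricalLemmas

/-! ### Splittings in a category and in its slices. -/

variable {C : Type v} [Category.{w} C]

/-- A product from its universal property. -/
@[reducible] def BinProduct.mk' {X Y : C} (pt : C) (fst : pt ⟶ X) (snd : pt ⟶ Y)
    (lift : ∀ {Z : C}, (Z ⟶ X) → (Z ⟶ Y) → (Z ⟶ pt))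
    (lift_fst : ∀ {Z : C} (a : Z ⟶ X) (b : Z ⟶ Y), lift a b ≫ fst = a)
    (lift_snd : ∀ {Z : C} (a : Z ⟶ X) (b : Z ⟶ Y), lift a b ≫ snd = b)
    (ext : ∀ {Z : C} (a b : Z ⟶ pt), a ≫ fst = b ≫ fst → a ≫ snd = b ≫ snd → a = b) :
    BinProduct X Y where
  pt := pt
  fst := fst
  snd := snd
  isLimit := BinaryFan.IsLimit.mk _ lift lift_fst lift_snd fun a b _ h₁ h₂ =>
    ext _ _ (h₁.trans (lift_fst a b).symm) (h₂.trans (lift_snd a b).symm)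

/-- An idempotent element of a group object is neutral. -/
theorem GroupObject.eq_oneElem_of_mulElem_self (G : GroupObject C) {Z : C} (a : Z ⟶ G.X)
    (h : G.mulElem a a = a) : a = G.oneElem Z := by
  have h₁ := G.mul_assoc (a ≫ G.inv) a a
  have h₂ : G.square.lift a a ≫ G.mul = a := h
  rw [G.inv_mul, h₂, G.inv_mul, G.one_mul] at h₁
  exact h₁

/-- To split a kernel pair is to give an isomorphism of the objects of arrows that is
compatible with source and target. -/
theorem kernelPairSplitsBy_iff {M B : C} {π : M ⟶ B} {G : GroupObject C} :
    KernelPairSplitsBy π G ↔ ∃ (K : C) (p q : K ⟶ M) (_ : IsKernelPair π p q) (A : G.Action M)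
      (i : A.prod.pt ≅ K), i.hom ≫ p = A.prod.snd ∧ i.hom ≫ q = A.act := by
  constructor
  · rintro ⟨K, p, q, h, A, ⟨⟨i, hp, hq, -⟩⟩⟩
    exact ⟨K, p, q, h, A, i, hp, hq⟩
  · rintro ⟨K, p, q, h, A, i, hp, hq⟩
    refine ⟨K, p, q, h, A, ⟨⟨i, hp, hq, ?_⟩⟩⟩
    intro Z f g e e'
    change Z ⟶ A.prod.pt at f g
    change f ≫ A.act = g ≫ A.prod.snd at e
    change (f ≫ i.hom) ≫ q = (g ≫ i.hom) ≫ p at e'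
    change A.prod.lift (G.mulElem (g ≫ A.prod.fst) (f ≫ A.prod.fst)) (f ≫ A.prod.snd) ≫ i.hom =
      h.lift ((f ≫ i.hom) ≫ p) ((g ≫ i.hom) ≫ q) _
    -- Compatibility with composition is automatic: an arrow of the kernel pair is determined by its
    -- source and target.
    apply h.hom_ext
    · simp [hp]
    · have := A.groupoid.comp_t f g e
      change A.prod.lift (G.mulElem (g ≫ A.prod.fst) (f ≫ A.prod.fst)) (f ≫ A.prod.snd) ≫ A.act =
        g ≫ A.act at this
      simp [hq, this]

theorem GroupObject.Action.act_comp_of_splits {M B K : C} {π : M ⟶ B} {p q : K ⟶ M}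
    (h : IsKernelPair π p q) {G : GroupObject C} (A : G.Action M) (i : A.prod.pt ≅ K)
    (hp : i.hom ≫ p = A.prod.snd) (hq : i.hom ≫ q = A.act) :
    A.act ≫ π = A.prod.snd ≫ π := by
  rw [← hp, ← hq, Category.assoc, Category.assoc, h.w]

section Over

variable {T : C}

/-- The slice does not change kernel pairs: a pair of maps into `M` that agree after `π` already has
a well-defined structure map to `T`. This direction lifts a kernel pair to the slice, the next one
brings it back. -/
theorem isKernelPair_over {M K : C} {π : M ⟶ T} {p q : K ⟶ M} (h : IsKernelPair π p q) :
    IsKernelPair (Over.homMk π : Over.mk π ⟶ Over.mk (𝟙 T))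
      (Over.homMk p : Over.mk (p ≫ π) ⟶ Over.mk π) (Over.homMk q h.w.symm) := by
  refine ⟨⟨by ext; exact h.w⟩, ⟨PullbackCone.IsLimit.mk _
    (fun s => Over.homMk (h.lift s.fst.left s.snd.left (congrArg Over.Hom.left s.condition))
      ?_) ?_ ?_ ?_⟩⟩
  · change h.lift _ _ _ ≫ p ≫ π = _
    rw [← Category.assoc]
    exact (congrArg (· ≫ π) (h.lift_fst _ _ _)).trans (Over.w s.fst)
  · intro s; ext; exact h.lift_fst _ _ _
  · intro s; ext; exact h.lift_snd _ _ _
  · intro s m h₁ h₂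
    ext
    apply h.hom_ext
    · exact (congrArg Over.Hom.left h₁).trans (h.lift_fst _ _ _).symm
    · exact (congrArg Over.Hom.left h₂).trans (h.lift_snd _ _ _).symm

/-- A test object `Z` with `a, b : Z ⟶ M` and `a ≫ π = b ≫ π` becomes an object over `T` through
this common composite, and the universal property in the slice applies to it. -/
theorem isKernelPair_of_over {M : C} {K : Over T} {π : M ⟶ T} {p q : K ⟶ Over.mk π}
    (h : IsKernelPair (Over.homMk π : Over.mk π ⟶ Over.mk (𝟙 T)) p q) :
    IsKernelPair π p.left q.left := by
  have key : ∀ {Z : C} (a b : Z ⟶ M), a ≫ π = b ≫ π →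
      ∃ l : Z ⟶ K.left, l ≫ p.left = a ∧ l ≫ q.left = b := by
    intro Z a b e
    let a' : Over.mk (a ≫ π) ⟶ Over.mk π := Over.homMk a
    let b' : Over.mk (a ≫ π) ⟶ Over.mk π := Over.homMk b e.symm
    have e' : a' ≫ (Over.homMk π : Over.mk π ⟶ Over.mk (𝟙 T)) =
        b' ≫ (Over.homMk π : Over.mk π ⟶ Over.mk (𝟙 T)) := by
      ext; exact e
    exact ⟨(h.lift a' b' e').left, congrArg Over.Hom.left (h.lift_fst a' b' e'),
      congrArg Over.Hom.left (h.lift_snd a' b' e')⟩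
  choose l hl₁ hl₂ using @key
  refine ⟨⟨congrArg Over.Hom.left h.w⟩, ⟨PullbackCone.IsLimit.mk _
    (fun s => l s.fst s.snd s.condition) (fun s => hl₁ _ _ _) (fun s => hl₂ _ _ _) ?_⟩⟩
  intro s m h₁ h₂
  have w : ∀ k : s.pt ⟶ K.left, k ≫ K.hom = (k ≫ p.left) ≫ π := by
    intro k
    rw [Category.assoc]
    congr 1
    exact (Over.w p).symm
  let m₁ : Over.mk (s.fst ≫ π) ⟶ K := Over.homMk m (by rw [w, h₁]; rfl)
  let m₂ : Over.mk (s.fst ≫ π) ⟶ K := Over.homMk (l s.fst s.snd s.condition)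
    (by rw [w, hl₁]; rfl)
  have : m₁ = m₂ := by
    apply h.hom_ext
    · ext; exact h₁.trans (hl₁ _ _ _).symm
    · ext; exact h₂.trans (hl₂ _ _ _).symm
  exact congrArg Over.Hom.left this

/-- The square of `X × T`, as an object over `T`, is `X × (X × T)`. -/
@[reducible] def BinProduct.overSquare {X : C} (P : BinProduct X T) (Q : BinProduct X P.pt) :
    BinProduct (Over.mk P.snd) (Over.mk P.snd) :=
  BinProduct.mk' (Over.mk (Q.snd ≫ P.snd)) (Over.homMk (P.lift Q.fst (Q.snd ≫ P.snd)))
    (Over.homMk Q.snd)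
    (fun {Z} a b => Over.homMk (Q.lift (a.left ≫ P.fst) b.left) (by
      have := Over.w b
      simpa [← Category.assoc] using this))
    (fun {Z} a b => by
      ext
      apply P.ext_elem
      · simp
      · have ha := Over.w a
        have hb := Over.w b
        simp only [Over.mk_hom] at ha hb
        simp only [Over.comp_left, Over.homMk_left, Category.assoc, P.lift_snd]
        rw [← Category.assoc, Q.lift_snd, ha, hb])
    (fun {Z} a b => by ext; simp)
    (fun {Z} a b h₁ h₂ => by
      ext
      have h₁' := congrArg (fun f => Over.Hom.left f ≫ P.fst) h₁
      have h₂' := congrArg Over.Hom.left h₂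
      apply Q.ext_elem
      · simpa using h₁'
      · simpa using h₂')

section

variable {X : C} (P : BinProduct X T) (Q : BinProduct X P.pt)

theorem BinProduct.overSquare_lift_fst {Z : Over T} (a b : Z ⟶ Over.mk P.snd) :
    ((P.overSquare Q).lift a b).left ≫ Q.fst = a.left ≫ P.fst := by
  have := congrArg (fun f => Over.Hom.left f ≫ P.fst) ((P.overSquare Q).lift_fst a b)
  simpa [BinProduct.overSquare, BinProduct.mk'] using this

theorem BinProduct.overSquare_lift_snd {Z : Over T} (a b : Z ⟶ Over.mk P.snd) :
    ((P.overSquare Q).lift a b).left ≫ Q.snd = b.left := by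
  have := congrArg Over.Hom.left ((P.overSquare Q).lift_snd a b)
  simpa [BinProduct.overSquare, BinProduct.mk'] using this

end

/-- The element of `X × T` over `T` given by an element of `X`. -/
def BinProduct.overElem {X : C} (P : BinProduct X T) {Z : Over T} (a : Z.left ⟶ X) :
    Z ⟶ Over.mk P.snd :=
  Over.homMk (P.lift a Z.hom)

theorem BinProduct.overElem_left {X : C} (P : BinProduct X T) {Z : Over T} (a : Z.left ⟶ X) :
    (P.overElem a).left = P.lift a Z.hom := rfl

theorem BinProduct.overElem_eta {X : C} (P : BinProduct X T) {Z : Over T}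
    (a : Z ⟶ Over.mk P.snd) : P.overElem (a.left ≫ P.fst) = a := by
  ext
  apply P.ext_elem
  · simp [overElem_left]
  · have := Over.w a
    simp only [Over.mk_hom] at this
    simp [overElem_left, this]

theorem BinProduct.comp_overElem {X : C} (P : BinProduct X T) {Z W : Over T} (k : W ⟶ Z)
    (a : Z.left ⟶ X) : k ≫ P.overElem a = P.overElem (k.left ≫ a) := by
  ext
  rw [Over.comp_left, P.overElem_left, P.comp_lift, Over.w, P.overElem_left]

/-- The multiplication of the group object `G × T` over `T`. -/
def GroupObject.overMul (G : GroupObject C) (P : BinProduct G.X T) (Q : BinProduct G.X P.pt) :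
    (P.overSquare Q).pt ⟶ Over.mk P.snd :=
  Over.homMk (U := Over.mk (Q.snd ≫ P.snd))
    (P.lift (G.mulElem Q.fst (Q.snd ≫ P.fst)) (Q.snd ≫ P.snd))

/-- Elements of `G × T` over `T` are the same as elements of `G`, and the multiplication matches;
each group law of `G.over` is thus reduced to the law of `G`. -/
theorem GroupObject.lift_overMul (G : GroupObject C) (P : BinProduct G.X T)
    (Q : BinProduct G.X P.pt) {Z : Over T} (a b : Z.left ⟶ G.X) :
    (P.overSquare Q).lift (P.overElem a) (P.overElem b) ≫ G.overMul P Q =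
      P.overElem (G.mulElem a b) := by
  ext
  rw [Over.comp_left]
  change _ ≫ P.lift _ _ = _
  rw [P.comp_lift, G.comp_mulElem]
  have h₁ := P.overSquare_lift_fst Q (P.overElem a) (P.overElem b)
  have h₂ := P.overSquare_lift_snd Q (P.overElem a) (P.overElem b)
  rw [P.overElem_left, P.lift_fst] at h₁
  rw [P.overElem_left] at h₂
  rw [h₁, ← Category.assoc, ← Category.assoc, h₂, P.lift_fst, P.lift_snd, P.overElem_left]

theorem GroupObject.comp_overElem_oneElem (G : GroupObject C) (P : BinProduct G.X T) {Z : Over T}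
    (k : Z ⟶ Over.mk (𝟙 T)) :
    k ≫ P.overElem (Z := Over.mk (𝟙 T)) (G.oneElem T) = P.overElem (G.oneElem Z.left) := by
  rw [P.comp_overElem]
  congr 1
  exact G.comp_oneElem k.left

/-- The group object `G × T` over `T`. -/
@[reducible] noncomputable def GroupObject.over (G : GroupObject C) (P : BinProduct G.X T)
    (Q : BinProduct G.X P.pt) : GroupObject (Over T) where
  X := Over.mk P.snd
  pt := Over.mk (𝟙 T)
  isTerminal := Over.mkIdTerminal
  square := P.overSquare Q
  one := P.overElem (Z := Over.mk (𝟙 T)) (G.oneElem T)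
  mul := G.overMul P Q
  inv := P.overElem (Z := Over.mk P.snd) (P.fst ≫ G.inv)
  mul_assoc a b c := by
    rw [← P.overElem_eta a, ← P.overElem_eta b, ← P.overElem_eta c]
    simp only [G.lift_overMul]
    exact congrArg _ (G.mul_assoc _ _ _)
  one_mul a := by
    rw [G.comp_overElem_oneElem, ← P.overElem_eta a, G.lift_overMul]
    exact congrArg _ (G.one_mul _)
  mul_one a := by
    rw [G.comp_overElem_oneElem, ← P.overElem_eta a, G.lift_overMul]
    exact congrArg _ (G.mul_one _)
  inv_mul a := by
    rw [G.comp_overElem_oneElem, P.comp_overElem, ← Category.assoc]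
    conv_lhs => rw [← P.overElem_eta a]
    rw [G.lift_overMul, P.overElem_eta]
    exact congrArg _ (G.inv_mul _)
  mul_inv a := by
    rw [G.comp_overElem_oneElem, P.comp_overElem, ← Category.assoc]
    conv_lhs => rw [← P.overElem_eta a]
    rw [G.lift_overMul, P.overElem_eta]
    exact congrArg _ (G.mul_inv _)

/-- The product of `X × T` and `M`, as objects over `T`, is `X × M`. -/
@[reducible] def BinProduct.overProd {X M : C} (P : BinProduct X T) (π : M ⟶ T)
    (Q : BinProduct X M) :
    BinProduct (Over.mk P.snd) (Over.mk π) :=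
  BinProduct.mk' (Over.mk (Q.snd ≫ π)) (P.overElem (Z := Over.mk (Q.snd ≫ π)) Q.fst)
    (Over.homMk Q.snd)
    (fun {Z} a b => Over.homMk (Q.lift (a.left ≫ P.fst) b.left) (by
      have := Over.w b
      simpa [← Category.assoc] using this))
    (fun {Z} a b => by
      rw [P.comp_overElem]
      refine Eq.trans ?_ (P.overElem_eta a)
      congr 1
      simp)
    (fun {Z} a b => by ext; simp)
    (fun {Z} a b h₁ h₂ => by
      ext
      rw [P.comp_overElem, P.comp_overElem] at h₁
      have h₁' := congrArg (fun f => Over.Hom.left f ≫ P.fst) h₁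
      have h₂' := congrArg Over.Hom.left h₂
      apply Q.ext_elem
      · simpa [P.overElem_left] using h₁'
      · simpa using h₂')

theorem BinProduct.overProd_lift {X M : C} (P : BinProduct X T) (π : M ⟶ T) (Q : BinProduct X M)
    {Z : Over T} (a : Z.left ⟶ X) (b : Z ⟶ Over.mk π) :
    ((P.overProd π Q).lift (P.overElem a) b).left = Q.lift a b.left := by
  have h₁ := (P.overProd π Q).lift_fst (P.overElem a) b
  have h₂ := (P.overProd π Q).lift_snd (P.overElem a) b
  have h₁' := congrArg (fun f => Over.Hom.left f ≫ P.fst) h₁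
  have h₂' := congrArg Over.Hom.left h₂
  apply Q.ext_elem
  · simpa [P.overElem_left, overProd, mk'] using h₁'
  · simpa [overProd, mk'] using h₂'

/-- A splitting of the kernel pair of `π : M ⟶ T` by `G` gives a splitting over `T` by `G × T`. -/
theorem KernelPairSplitsBy.over {M : C} {π : M ⟶ T} {G : GroupObject C}
    (h : KernelPairSplitsBy π G) (P : BinProduct G.X T) (Q : BinProduct G.X P.pt) :
    KernelPairSplitsBy (Over.homMk π : Over.mk π ⟶ Over.mk (𝟙 T)) (G.over P Q) := by
  obtain ⟨K, p, q, hK, A, i, hp, hq⟩ := kernelPairSplitsBy_iff.1 h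
  have hπ := A.act_comp_of_splits hK i hp hq
  let A' : (G.over P Q).Action (Over.mk π) :=
    { prod := P.overProd π A.prod
      act := Over.homMk (U := Over.mk (A.prod.snd ≫ π)) A.act hπ
      act_mul := by
        intro Z g h x
        change Z ⟶ Over.mk P.snd at g h
        rw [← P.overElem_eta g, ← P.overElem_eta h]
        unfold GroupObject.mulElem
        change (P.overProd π A.prod).lift ((P.overSquare Q).lift _ _ ≫ G.overMul P Q) _ ≫ _ = _
        rw [G.lift_overMul]
        ext
        rw [Over.comp_left, P.overProd_lift, Over.comp_left, P.overProd_lift, Over.comp_left,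
          P.overProd_lift]
        exact A.act_mul _ _ _
      act_one := by
        intro Z x
        change (P.overProd π A.prod).lift (_ ≫ P.overElem (Z := Over.mk (𝟙 T)) _) _ ≫ _ = _
        rw [G.comp_overElem_oneElem]
        ext
        rw [Over.comp_left, P.overProd_lift]
        exact A.act_one _ }
  refine kernelPairSplitsBy_iff.2 ⟨_, _, _, isKernelPair_over hK, A',
    (Over.isoMk (f := Over.mk (A.prod.snd ≫ π)) (g := Over.mk (p ≫ π)) i ?_), ?_, ?_⟩
  · change i.hom ≫ p ≫ π = A.prod.snd ≫ π
    rw [← Category.assoc, hp]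
  · ext; exact hp
  · ext; exact hq

/-- If a group object `G` over `T` is a product `F × T` as a group object, then a splitting by `G`
over `T` gives a splitting by `F`. -/
theorem KernelPairSplitsBy.of_over {M : C} {π : M ⟶ T} {G : GroupObject (Over T)}
    (h : KernelPairSplitsBy (Over.homMk π : Over.mk π ⟶ Over.mk (𝟙 T)) G) (F : GroupObject C)
    (P : BinProduct F.X T) (φ : Over.mk P.snd ≅ G.X)
    (hφ : ∀ {Z : Over T} (a b : Z.left ⟶ F.X), P.overElem (F.mulElem a b) ≫ φ.hom =
      G.mulElem (P.overElem a ≫ φ.hom) (P.overElem b ≫ φ.hom))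
    (Q : BinProduct F.X M) : KernelPairSplitsBy π F := by
  obtain ⟨K, p, q, hK, A, i, hp, hq⟩ := kernelPairSplitsBy_iff.1 h
  let l : Over.mk (Q.snd ≫ π) ⟶ A.prod.pt :=
    A.prod.lift (P.overElem (Z := Over.mk (Q.snd ≫ π)) Q.fst ≫ φ.hom) (Over.homMk Q.snd)
  have key : ∀ {Z : Over T} (g : Z.left ⟶ F.X) (x : Z ⟶ Over.mk π),
      Q.lift g x.left ≫ (l ≫ A.act).left =
        (A.prod.lift (P.overElem g ≫ φ.hom) x ≫ A.act).left := by
    intro Z g x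
    let k : Z ⟶ Over.mk (Q.snd ≫ π) := Over.homMk (Q.lift g x.left) (by
      have := Over.w x
      simpa [← Category.assoc] using this)
    change (k ≫ l ≫ A.act).left = _
    rw [← Category.assoc, A.prod.comp_lift, ← Category.assoc, P.comp_overElem]
    congr 4
    · exact congrArg (P.overElem (Z := Z)) (Q.lift_fst _ _)
    · ext; exact Q.lift_snd _ _
  let A' : F.Action M :=
    { prod := Q
      act := (l ≫ A.act).left
      act_mul := by
        intro Z g h x
        have h₁ := key (Z := Over.mk (x ≫ π)) (F.mulElem g h) (Over.homMk x)
        have h₂ := key (Z := Over.mk (x ≫ π)) h (Over.homMk x)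
        have h₃ := key (Z := Over.mk (x ≫ π)) g
          (A.prod.lift (P.overElem (Z := Over.mk (x ≫ π)) h ≫ φ.hom) (Over.homMk x) ≫ A.act)
        rw [← h₂] at h₃
        refine h₁.trans (Eq.trans ?_ h₃.symm)
        rw [hφ (Z := Over.mk (x ≫ π)) g h, A.act_mul]
      act_one := by
        intro Z x
        have h₁ := key (Z := Over.mk (x ≫ π)) (F.oneElem Z) (Over.homMk x)
        refine h₁.trans ?_
        -- The isomorphism is only assumed to preserve products. The unit is recovered as an
        -- idempotent.
        have h₂ := G.eq_oneElem_of_mulElem_self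
          (P.overElem (Z := Over.mk (x ≫ π)) (F.oneElem Z) ≫ φ.hom) (by
            rw [← hφ]
            congr 2
            exact F.one_mul _)
        rw [h₂, A.act_one]
        rfl }
  let l' : A.prod.pt.left ⟶ Q.pt := Q.lift ((A.prod.fst ≫ φ.inv).left ≫ P.fst) A.prod.snd.left
  have hl₁ : l.left ≫ l' = 𝟙 _ := by
    apply Q.ext_elem
    · rw [Category.assoc, Q.lift_fst, ← Category.assoc, ← Over.comp_left, ← Category.assoc,
        A.prod.lift_fst, Category.assoc, φ.hom_inv_id, Category.comp_id, P.overElem_left,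
        P.lift_fst, Category.id_comp]
    · rw [Category.assoc, Q.lift_snd, ← Over.comp_left, A.prod.lift_snd, Category.id_comp]
      rfl
  have hl₂ : l' ≫ l.left = 𝟙 _ := by
    let k : A.prod.pt ⟶ Over.mk (Q.snd ≫ π) := Over.homMk l' (by
      have := Over.w A.prod.snd
      simp only [Over.mk_hom] at this
      simp [l', ← Category.assoc, this])
    have : k ≫ l = 𝟙 _ := by
      apply A.prod.ext_elem
      · rw [Category.assoc, A.prod.lift_fst, ← Category.assoc, P.comp_overElem, Category.id_comp]
        have : k.left ≫ Q.fst = (A.prod.fst ≫ φ.inv).left ≫ P.fst := Q.lift_fst _ _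
        rw [this, P.overElem_eta, Category.assoc, φ.inv_hom_id, Category.comp_id]
      · rw [Category.assoc, A.prod.lift_snd, Category.id_comp]
        ext
        exact Q.lift_snd _ _
    exact congrArg Over.Hom.left this
  have hp' := congrArg Over.Hom.left hp
  have hq' := congrArg Over.Hom.left hq
  rw [Over.comp_left] at hp' hq'
  refine kernelPairSplitsBy_iff.2 ⟨_, _, _, isKernelPair_of_over hK, A',
    ((⟨l.left, l', hl₁, hl₂⟩ : Q.pt ≅ A.prod.pt.left) ≪≫ (Over.forget T).mapIso i), ?_, ?_⟩
  · change (l.left ≫ i.hom.left) ≫ p.left = Q.snd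
    rw [Category.assoc, hp', ← Over.comp_left, A.prod.lift_snd]
    rfl
  · change (l.left ≫ i.hom.left) ≫ q.left = (l ≫ A.act).left
    rw [Category.assoc, hq', ← Over.comp_left]

end Over

end CategoricalLemmas

/-! ### Brackets of related vector fields. -/

section RelatedFields

open scoped Topology
open VectorField Filter

/-- Differentiating `df(V) = V' ∘ f` along `W`, and symmetrically, gives the second derivative of
`f` on both sides; its symmetry makes it drop out of the difference. -/
theorem lieBracket_of_related {E F : Type*} [NormedAddCommGroup E] [NormedSpace ℝ E]
    [NormedAddCommGroup F] [NormedSpace ℝ F] {f : E → F} {V W : E → E} {V' W' : F → F} {x : E}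
    (hf : ContDiffAt ℝ 2 f x) (hV : DifferentiableAt ℝ V x) (hW : DifferentiableAt ℝ W x)
    (hV' : DifferentiableAt ℝ V' (f x)) (hW' : DifferentiableAt ℝ W' (f x))
    (h₁ : ∀ᶠ y in 𝓝 x, fderiv ℝ f y (V y) = V' (f y))
    (h₂ : ∀ᶠ y in 𝓝 x, fderiv ℝ f y (W y) = W' (f y)) :
    fderiv ℝ f x (lieBracket ℝ V W x) = lieBracket ℝ V' W' (f x) := by
  have hd : DifferentiableAt ℝ f x := hf.differentiableAt (by simp)
  rw [fderiv_apply_lieBracket hf (by simp) hW hV, Filter.EventuallyEq.fderiv_eq h₁,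
    Filter.EventuallyEq.fderiv_eq h₂]
  have e₁ := fderiv_comp x hV' hd
  have e₂ := fderiv_comp x hW' hd
  simp only [Function.comp_def] at e₁ e₂
  rw [e₁, e₂, lieBracket_eq]
  simp [h₁.self_of_nhds, h₂.self_of_nhds]

variable {E H M E' H' M' : Type*} [NormedAddCommGroup E] [NormedSpace ℝ E] [CompleteSpace E]
  [TopologicalSpace H] {I : ModelWithCorners ℝ E H} [I.Boundaryless] [TopologicalSpace M]
  [ChartedSpace H M] [IsManifold I ∞ M]
  [NormedAddCommGroup E'] [NormedSpace ℝ E'] [CompleteSpace E']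
  [TopologicalSpace H'] {I' : ModelWithCorners ℝ E' H'} [I'.Boundaryless] [TopologicalSpace M']
  [ChartedSpace H' M'] [IsManifold I' ∞ M']


/-- A vector field read in the extended chart at `x₀`. -/
noncomputable def chartField (I : ModelWithCorners ℝ E H) (V : ∀ x : M, TangentSpace I x) (x₀ : M)
    (u : E) : E :=
  mfderiv I 𝓘(ℝ, E) (extChartAt I x₀) ((extChartAt I x₀).symm u) (V ((extChartAt I x₀).symm u))

omit [CompleteSpace E] [I.Boundaryless] in
theorem mpullbackWithin_extChartAt_symm_eq_chartField (V : ∀ x : M, TangentSpace I x) (x₀ : M)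
    {u : E} (hu : u ∈ (extChartAt I x₀).target) :
    mpullbackWithin 𝓘(ℝ, E) I (extChartAt I x₀).symm V (Set.range I) u = chartField I V x₀ u := by
  have : IsManifold I 1 M := IsManifold.of_le (n := ∞) (by simp)
  rw [mpullbackWithin_apply]
  have := ContinuousLinearMap.inverse_eq
    (mfderivWithin_extChartAt_symm_comp_mfderiv_extChartAt (I := I) hu)
    (mfderiv_extChartAt_comp_mfderivWithin_extChartAt_symm (I := I) hu)
  exact congrArg (fun L => L (V ((extChartAt I x₀).symm u))) this

omit [CompleteSpace E] in
theorem chartField_eventuallyEq (V : ∀ x : M, TangentSpace I x) (x₀ : M) :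
    (mpullbackWithin 𝓘(ℝ, E) I (extChartAt I x₀).symm V (Set.range I) : E → E)
      =ᶠ[𝓝 (extChartAt I x₀ x₀)] chartField I V x₀ := by
  filter_upwards [extChartAt_target_mem_nhds (I := I) x₀] with u hu
  exact mpullbackWithin_extChartAt_symm_eq_chartField V x₀ hu

theorem differentiableAt_chartField {V : ∀ x : M, TangentSpace I x} {x₀ : M}
    (hV : MDifferentiableAt I I.tangent (fun x => (⟨x, V x⟩ : TangentBundle I M)) x₀) :
    DifferentiableAt ℝ (chartField I V x₀) (extChartAt I x₀ x₀) := by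
  have : IsManifold I 2 M := IsManifold.of_le (n := ∞) (by norm_cast)
  have h := (mdifferentiableWithinAt_univ.2 hV).differentiableWithinAt_mpullbackWithin_vectorField
  have aux : ∀ (g : E → E) (s : Set E) (u : E), s = Set.univ → DifferentiableWithinAt ℝ g s u →
      DifferentiableAt ℝ g u := by
    rintro g s u rfl hg
    exact differentiableWithinAt_univ.1 hg
  exact (chartField_eventuallyEq V x₀).differentiableAt_iff.1
    (aux _ _ _ (by simp [I.range_eq_univ]) h)

-- The manifold bracket at `x₀` is the pullback of the bracket in the chart at `x₀`, so the
-- differential of that chart recovers the bracket of the two `chartField`s.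
omit [CompleteSpace E] in
theorem mfderiv_extChartAt_mlieBracket (V W : ∀ x : M, TangentSpace I x) (x₀ : M) :
    mfderiv I 𝓘(ℝ, E) (extChartAt I x₀) x₀ (mlieBracket I V W x₀) =
      lieBracket ℝ (chartField I V x₀) (chartField I W x₀) (extChartAt I x₀ x₀) := by
  have : IsManifold I 1 M := IsManifold.of_le (n := ∞) (by simp)
  rw [← (chartField_eventuallyEq V x₀).lieBracket_vectorField_eq (chartField_eventuallyEq W x₀)]
  have aux : ∀ (g k : E → E) (s : Set E) (u : E), s = Set.univ →
      lieBracketWithin ℝ g k s u = lieBracket ℝ g k u := by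
    rintro g k s u rfl
    rw [lieBracketWithin_univ]
  refine Eq.trans ?_ (aux _ _ ((extChartAt I x₀).symm ⁻¹' Set.univ ∩ Set.range I) _
    (by simp [I.range_eq_univ]))
  exact (isInvertible_mfderiv_extChartAt (mem_extChartAt_source (I := I) x₀)).self_apply_inverse _

/-- Relatedness is read in the charts at `x₀` and `f x₀`, where the vector space case applies; the
chart differential at `f x₀` is injective, which brings the identity back. Only relatedness near
`x₀` enters, and `f` need not be a diffeomorphism, so slices and charts are both covered. -/
theorem mlieBracket_of_related {f : M → M'} {V W : ∀ x : M, TangentSpace I x}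
    {V' W' : ∀ x : M', TangentSpace I' x} {x₀ : M} (hf : ContMDiffAt I I' 2 f x₀)
    (hV : MDifferentiableAt I I.tangent (fun x => (⟨x, V x⟩ : TangentBundle I M)) x₀)
    (hW : MDifferentiableAt I I.tangent (fun x => (⟨x, W x⟩ : TangentBundle I M)) x₀)
    (hV' : MDifferentiableAt I' I'.tangent (fun x => (⟨x, V' x⟩ : TangentBundle I' M')) (f x₀))
    (hW' : MDifferentiableAt I' I'.tangent (fun x => (⟨x, W' x⟩ : TangentBundle I' M')) (f x₀))
    (h₁ : ∀ᶠ x in 𝓝 x₀, mfderiv I I' f x (V x) = V' (f x))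
    (h₂ : ∀ᶠ x in 𝓝 x₀, mfderiv I I' f x (W x) = W' (f x)) :
    mfderiv I I' f x₀ (mlieBracket I V W x₀) = mlieBracket I' V' W' (f x₀) := by
  have : IsManifold I 1 M := IsManifold.of_le (n := ∞) (by simp)
  have : IsManifold I' 1 M' := IsManifold.of_le (n := ∞) (by simp)
  have : IsManifold I 2 M := IsManifold.of_le (n := ∞) (by norm_cast)
  have : IsManifold I' 2 M' := IsManifold.of_le (n := ∞) (by norm_cast)
  set φ := extChartAt I x₀ with hφ
  set φ' := extChartAt I' (f x₀) with hφ'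
  set F : E → E' := φ' ∘ f ∘ φ.symm with hF
  have hFc : ContDiffAt ℝ 2 F (φ x₀) := by
    have := (contMDiffAt_iff.1 hf).2
    rwa [I.range_eq_univ, contDiffWithinAt_univ] at this
  have hsrc : ∀ᶠ x in 𝓝 x₀, x ∈ φ.source ∧ f x ∈ φ'.source ∧ ContMDiffAt I I' 2 f x ∧
      DifferentiableAt ℝ F (φ x) := by
    have hFd : ∀ᶠ u in 𝓝 (φ x₀), DifferentiableAt ℝ F u := by
      filter_upwards [hFc.eventually (by simp)] with u hu using hu.differentiableAt (by simp)
    filter_upwards [extChartAt_source_mem_nhds (I := I) x₀,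
      hf.continuousAt.preimage_mem_nhds (extChartAt_source_mem_nhds (I := I') (f x₀)),
      (contMDiffAt_iff_contMDiffAt_nhds (by simp)).1 hf,
      (continuousAt_extChartAt (I := I) x₀).eventually hFd] with x a b c d
    exact ⟨a, b, c, d⟩
  have key : ∀ᶠ x in 𝓝 x₀, ∀ v : TangentSpace I x,
      fderiv ℝ F (φ x) (mfderiv I 𝓘(ℝ, E) φ x v) =
        mfderiv I' 𝓘(ℝ, E') φ' (f x) (mfderiv I I' f x v) := by
    filter_upwards [hsrc.eventually_nhds] with x hx v
    obtain ⟨hx₁, hx₂, hx₃, hx₄⟩ := hx.self_of_nhds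
    have e : (F ∘ φ : M → E') =ᶠ[𝓝 x] φ' ∘ f := by
      filter_upwards [hx] with y hy
      simp [hF, φ.left_inv hy.1]
    have d₁ : MDifferentiableAt I 𝓘(ℝ, E) φ x :=
      mdifferentiableAt_extChartAt (by simpa [hφ] using hx₁)
    have d₂ : MDifferentiableAt I' 𝓘(ℝ, E') φ' (f x) :=
      mdifferentiableAt_extChartAt (by simpa [hφ'] using hx₂)
    have e₁ := mfderiv_comp_apply x hx₄.mdifferentiableAt d₁ v
    have e₂ := mfderiv_comp_apply x d₂ (hx₃.mdifferentiableAt (by simp)) v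
    have e₃ := congrArg (fun L : E →L[ℝ] E' => L v) (e.mfderiv_eq (I := I) (I' := 𝓘(ℝ, E')))
    rw [mfderiv_eq_fderiv] at e₁
    exact e₁.symm.trans (e₃.trans e₂)
  have inj : Function.Injective (mfderiv I' 𝓘(ℝ, E') φ' (f x₀)) :=
    (isInvertible_mfderiv_extChartAt (mem_extChartAt_source (I := I') (f x₀))).injective
  apply inj
  rw [← key.self_of_nhds, hφ, mfderiv_extChartAt_mlieBracket, ← hφ, hφ',
    mfderiv_extChartAt_mlieBracket]
  have hFx : F (φ x₀) = φ' (f x₀) := by simp [hF, hφ]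
  have tr : ∀ {Z : ∀ x : M, TangentSpace I x} {Z' : ∀ x : M', TangentSpace I' x},
      (∀ᶠ x in 𝓝 x₀, mfderiv I I' f x (Z x) = Z' (f x)) →
      ∀ᶠ u in 𝓝 (φ x₀), fderiv ℝ F u (chartField I Z x₀ u) = chartField I' Z' (f x₀) (F u) := by
    intro Z Z' h
    have hc : ContinuousAt φ.symm (φ x₀) := continuousAt_extChartAt_symm (I := I) x₀
    have h0 : φ.symm (φ x₀) = x₀ := extChartAt_to_inv (I := I) x₀
    have := hc.tendsto
    rw [h0] at this
    filter_upwards [this.eventually (key.and (h.and hsrc)), extChartAt_target_mem_nhds (I := I) x₀]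
      with u ⟨k₁, k₂, _, k₄, _⟩ hu
    have k₅ := k₁ (Z (φ.symm u))
    rw [φ.right_inv hu, k₂] at k₅
    refine Eq.trans k₅ ?_
    unfold chartField
    have : φ'.symm (F u) = f (φ.symm u) := φ'.left_inv k₄
    rw [this]
  rw [← hφ', ← hFx]
  have hV₁ := differentiableAt_chartField hV'
  have hW₁ := differentiableAt_chartField hW'
  rw [← hφ', ← hFx] at hV₁ hW₁
  exact lieBracket_of_related (E := E) (F := E') hFc (differentiableAt_chartField hV)
    (differentiableAt_chartField hW) hV₁ hW₁ (tr h₁) (tr h₂)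

end RelatedFields

/-! ### Products with a manifold foliated by points. -/

section Products

open scoped Topology
open Filter

theorem SmoothMfd.SmoothFieldOn.mdifferentiableAt {M : SmoothMfd.{u}}
    {X : ∀ p : M, TangentSpace M.I p} {U : Set M} (h : M.SmoothFieldOn X U) (hU : IsOpen U) {p : M}
    (hp : p ∈ U) :
    MDifferentiableAt M.I M.I.tangent (fun p => (⟨p, X p⟩ : TangentBundle M.I M)) p :=
  (h.contMDiffAt (hU.mem_nhds hp)).mdifferentiableAt (by simp)

/-- The one-point manifold. -/
@[reducible] noncomputable def SmoothMfd.point : SmoothMfd.{u} where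
  carrier := PUnit
  E := PUnit
  H := PUnit
  I := 𝓘(ℝ, PUnit.{u + 1})

/-- The product of two smooth manifolds. -/
@[reducible] noncomputable def SmoothMfd.prod (M N : SmoothMfd.{u}) : SmoothMfd.{u} where
  carrier := M × N
  E := M.E × N.E
  H := ModelProd M.H N.H
  I := M.I.prod N.I

/-- An open submanifold. -/
@[reducible] noncomputable def SmoothMfd.opens (M : SmoothMfd.{u})
    (U : TopologicalSpace.Opens M) : SmoothMfd.{u} where
  carrier := U
  E := M.E
  H := M.H
  I := M.I

/-- The fiber of a foliation, as a subspace of the model space. -/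
def Foliation.fiberE {M : SmoothMfd.{u}} (F : Foliation M) (p : M) : Submodule ℝ M.E := F.fiber p

theorem Foliation.finrank_fiberE {M : SmoothMfd.{u}} (F : Foliation M) (p : M) :
    Module.finrank ℝ (F.fiberE p) = F.rank := F.finrank_fiber p

/-- The foliation of a manifold by its points. -/
noncomputable def Foliation.zero (M : SmoothMfd.{u}) : Foliation M where
  rank := 0
  fiber _ := ⊥
  finrank_fiber _ := finrank_bot _ _
  smooth p := by
    refine ⟨Set.univ, isOpen_univ, trivial, fun i => i.elim0, fun i => i.elim0, fun q _ => ?_⟩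
    simp
  involutive U X Y hU _ _ hX hY q hq := by
    rw [← VectorField.mlieBracketWithin_univ]
    rw [Submodule.mem_bot]
    exact VectorField.mlieBracketWithin_eq_zero_of_eq_zero ((Submodule.mem_bot _).1 (hX q hq))
      ((Submodule.mem_bot _).1 (hY q hq))

section ProdFoliation

variable (M N : SmoothMfd.{u})

/-- The slice `{x} × N` of a product. -/
theorem contMDiff_slice {n : ℕ∞ω} (x : M) :
    ContMDiff N.I (M.prod N).I n (fun y : N => ((x, y) : M.prod N)) :=
  contMDiff_const.prodMk contMDiff_id

theorem mfderiv_slice (x : M) (y : N) (w : TangentSpace N.I y) :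
    mfderiv N.I (M.prod N).I (fun y : N => ((x, y) : M.prod N)) y w = ((0 : M.E), (w : N.E)) := by
  have := mfderiv_prod_right (I := M.I) (I' := N.I) (x₀ := x) (y₀ := y)
  exact congrArg (fun L : N.E →L[ℝ] M.E × N.E => L w) this

variable {M N}

/-- A vector field on `M × N` along `N`, at the slice over `x`. -/
def sliceField (V : ∀ p : M.prod N, TangentSpace (M.prod N).I p) (x : M) (y : N) :
    TangentSpace N.I y := (show M.E × N.E from V (x, y)).2

theorem smoothFieldOn_sliceField {V : ∀ p : M.prod N, TangentSpace (M.prod N).I p}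
    {U : Set (M.prod N)} (hV : (M.prod N).SmoothFieldOn V U) (x : M) :
    N.SmoothFieldOn (sliceField V x) {y | ((x, y) : M.prod N) ∈ U} := by
  have h₁ : ContMDiffOn N.I (M.prod N).I.tangent ∞
      (fun y : N => (⟨(x, y), V (x, y)⟩ : TangentBundle (M.prod N).I (M.prod N)))
      {y | ((x, y) : M.prod N) ∈ U} :=
    hV.comp (contMDiff_slice M N x).contMDiffOn (fun y hy => hy)
  have h₂ := (contMDiff_equivTangentBundleProd (I := M.I) (M := M) (I' := N.I) (M' := N)
    (n := ∞)).comp_contMDiffOn h₁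
  exact contMDiff_snd.comp_contMDiffOn h₂

end ProdFoliation

/-- The foliation `0 × 𝓓` of a product `M × N`. -/
noncomputable def Foliation.prodZero (M : SmoothMfd.{u}) {N : SmoothMfd.{u}} (F : Foliation N) :
    Foliation (M.prod N) where
  rank := F.rank
  fiber p := (F.fiberE p.2).map (LinearMap.inr ℝ M.E N.E)
  finrank_fiber p := by
    refine (LinearEquiv.finrank_eq (Submodule.equivMapOfInjective (LinearMap.inr ℝ M.E N.E)
      LinearMap.inr_injective (F.fiberE p.2)).symm).trans (F.finrank_fiberE p.2)
  smooth p := by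
    obtain ⟨U, hU, hp, X, hX, hs⟩ := F.smooth p.2
    refine ⟨Prod.snd ⁻¹' U, hU.preimage continuous_snd, hp,
      fun i q => ((0 : M.E), (X i q.2 : N.E)), fun i => ?_, fun q hq => ?_⟩
    · have h₁ : ContMDiffOn (M.prod N).I N.I.tangent ∞
          (fun q : M.prod N => (⟨q.2, X i q.2⟩ : TangentBundle N.I N)) (Prod.snd ⁻¹' U) :=
        (hX i).comp contMDiff_snd.contMDiffOn (fun q hq => hq)
      have h₀ : ContMDiffOn (M.prod N).I M.I.tangent ∞
          (fun q : M.prod N => (⟨q.1, 0⟩ : TangentBundle M.I M)) (Prod.snd ⁻¹' U) :=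
        ((Bundle.contMDiff_zeroSection ℝ (TangentSpace M.I : M → Type u)).comp
          contMDiff_fst).contMDiffOn
      exact (contMDiff_equivTangentBundleProd_symm (I := M.I) (M := M) (I' := N.I) (M' := N)
        (n := ∞)).comp_contMDiffOn (h₀.prodMk h₁)
    · refine (congrArg (Submodule.map (LinearMap.inr ℝ M.E N.E)) (hs q.2 hq)).trans ?_
      refine (Submodule.map_span _ _).trans ?_
      exact congrArg _ (Set.range_comp _ _).symm
  involutive U V W hU hV hW hV' hW' q hq := by
    obtain ⟨x, y⟩ := q
    let U' : Set N := {y | ((x, y) : M.prod N) ∈ U}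
    have hU' : IsOpen U' := hU.preimage (contMDiff_slice M N (n := 0) x).continuous
    have hsV := smoothFieldOn_sliceField hV x
    have hsW := smoothFieldOn_sliceField hW x
    -- A field tangent to `0 × 𝓓` is related, by the inclusion of the slice `{x} × N`, to a field on
    -- `N` tangent to `𝓓`. The bracket can therefore be computed on the slice, where `𝓓` is
    -- involutive.
    have hz : ∀ {Z : ∀ p : M.prod N, TangentSpace (M.prod N).I p}, (∀ q ∈ U, Z q ∈
        (F.fiberE q.2).map (LinearMap.inr ℝ M.E N.E)) → (∀ y ∈ U', sliceField Z x y ∈ F.fiber y) ∧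
        ∀ y ∈ U', mfderiv N.I (M.prod N).I (fun y : N => ((x, y) : M.prod N)) y (sliceField Z x y)
          = Z (x, y) := by
      intro Z hZ
      have : ∀ y ∈ U', ∃ w ∈ F.fiber y, Z (x, y) = ((0 : M.E), (w : N.E)) := by
        intro y hy
        obtain ⟨w, hw, e⟩ := hZ (x, y) hy
        exact ⟨w, hw, e.symm⟩
      refine ⟨fun y hy => ?_, fun y hy => ?_⟩
      · obtain ⟨w, hw, e⟩ := this y hy
        unfold sliceField
        rw [e]
        exact hw
      · obtain ⟨w, hw, e⟩ := this y hy
        rw [mfderiv_slice]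
        unfold sliceField
        rw [e]
    have h := mlieBracket_of_related (I := N.I) (I' := (M.prod N).I)
      (contMDiff_slice M N x (n := 2)).contMDiffAt (hsV.mdifferentiableAt hU' hq)
      (hsW.mdifferentiableAt hU' hq) (hV.mdifferentiableAt hU hq) (hW.mdifferentiableAt hU hq)
      (Filter.mem_of_superset (hU'.mem_nhds hq) (hz hV').2)
      (Filter.mem_of_superset (hU'.mem_nhds hq) (hz hW').2)
    rw [← h, mfderiv_slice]
    exact ⟨_, F.involutive U' _ _ hU' hsV hsW (hz hV').1 (hz hW').1 y hq, rfl⟩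

namespace FMn

/-- A manifold, foliated by its points. -/
@[reducible] noncomputable def zero (M : SmoothMfd.{u}) : FMn.{u} := ⟨M, Foliation.zero M⟩

/-- The product of a manifold, foliated by its points, and a foliated manifold. -/
@[reducible] noncomputable def prodZero (M : SmoothMfd.{u}) (N : FMn.{u}) : FMn.{u} :=
  ⟨M.prod N.mfd, N.fol.prodZero M⟩

theorem hom_ext {M N : FMn.{u}} {f g : M ⟶ N} (h : ∀ x, f.toFun x = g.toFun x) : f = g :=
  Hom.ext (funext h)

theorem fiber_eq_bot {M : FMn.{u}} (h : M.fol.rank = 0) (x : M) : M.fol.fiber x = ⊥ :=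
  Submodule.finrank_eq_zero (S := M.fol.fiberE x) |>.1 ((M.fol.finrank_fiber x).trans h)

theorem mdifferentiableAt {M N : FMn.{u}} (f : M ⟶ N) (x : M) :
    MDifferentiableAt M.mfd.I N.mfd.I f.toFun x :=
  f.smooth.mdifferentiable (by simp) x

theorem mfderiv_mem {M N : FMn.{u}} (f : M ⟶ N) (x : M) {v : TangentSpace M.mfd.I x}
    (hv : v ∈ M.fol.fiber x) : mfderiv M.mfd.I N.mfd.I f.toFun x v ∈ N.fol.fiber (f.toFun x) :=
  (f.map_fiber x).le (Submodule.mem_map_of_mem hv)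

/-- A foliated manifold of rank `0` is foliated by its points. -/
theorem mfderiv_eq_zero {M N : FMn.{u}} (hN : N.fol.rank = 0) (f : M ⟶ N) (x : M)
    {v : TangentSpace M.mfd.I x} (hv : v ∈ M.fol.fiber x) :
    mfderiv M.mfd.I N.mfd.I f.toFun x v = 0 := by
  have := mfderiv_mem f x hv
  rwa [fiber_eq_bot hN, Submodule.mem_bot] at this

/-- The product of a foliated manifold of rank `0` with any foliated manifold. -/
noncomputable def binProduct (X N : FMn.{u}) (hX : X.fol.rank = 0) : BinProduct X N :=
  BinProduct.mk' (prodZero X.mfd N)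
    { toFun := fun p => p.1
      smooth := contMDiff_fst
      map_fiber := fun p => by
        rw [fiber_eq_bot hX, eq_bot_iff]
        rintro _ ⟨_, ⟨w, _, rfl⟩, rfl⟩
        have := congrArg (fun L : X.mfd.E × N.mfd.E →L[ℝ] X.mfd.E => L (0, w))
          (mfderiv_fst (I := X.mfd.I) (I' := N.mfd.I) (x := p))
        exact this }
    { toFun := fun p => p.2
      smooth := contMDiff_snd
      map_fiber := fun p => by
        have key : ∀ w : N.mfd.E, mfderiv (X.mfd.prod N.mfd).I N.mfd.I
            (fun p : X.mfd.prod N.mfd => p.2) p ((0 : X.mfd.E), w) = w := fun w =>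
          congrArg (fun L : X.mfd.E × N.mfd.E →L[ℝ] N.mfd.E => L (0, w))
            (mfderiv_snd (I := X.mfd.I) (I' := N.mfd.I) (x := p))
        apply le_antisymm
        · rintro _ ⟨_, ⟨w, hw, rfl⟩, rfl⟩
          exact (congrArg (· ∈ N.fol.fiber p.2) (key w)).mpr hw
        · intro w hw
          exact ⟨((0 : X.mfd.E), (w : N.mfd.E)), ⟨w, hw, rfl⟩, key w⟩ }
    (fun {Z} a b =>
      { toFun := fun z => (a.toFun z, b.toFun z)
        smooth := a.smooth.prodMk b.smooth
        map_fiber := fun z => by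
          -- Since `X` has rank `0`, the differential of `a` vanishes on the distribution of `Z`, so
          -- the differential of the pair is `(0, db)` there and maps onto `0 × 𝓓`.
          have key : ∀ v ∈ Z.fol.fiber z, mfderiv Z.mfd.I (X.mfd.prod N.mfd).I
              (fun z => ((a.toFun z, b.toFun z) : X.mfd.prod N.mfd)) z v =
              ((0 : X.mfd.E), (mfderiv Z.mfd.I N.mfd.I b.toFun z v : N.mfd.E)) := by
            intro v hv
            have := congrArg (fun L : Z.mfd.E →L[ℝ] X.mfd.E × N.mfd.E => L v)
              (mfderiv_prodMk (mdifferentiableAt a z) (mdifferentiableAt b z))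
            refine this.trans ?_
            exact Prod.ext (mfderiv_eq_zero hX a z hv) rfl
          apply le_antisymm
          · rintro _ ⟨v, hv, rfl⟩
            exact ⟨_, mfderiv_mem b z hv, (key v hv).symm⟩
          · rintro _ ⟨w, hw, rfl⟩
            obtain ⟨v, hv, rfl⟩ := (b.map_fiber z).ge hw
            exact ⟨v, hv, key v hv⟩ })
    (fun a b => rfl) (fun a b => rfl)
    (fun a b h₁ h₂ => hom_ext fun z => Prod.ext (congrArg (fun f => Hom.toFun f z) h₁)
      (congrArg (fun f => Hom.toFun f z) h₂))

/-- The terminal foliated manifold. -/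
@[reducible] noncomputable def point : FMn.{u} := zero SmoothMfd.point

/-- The morphism to the point. -/
noncomputable def toPoint (M : FMn.{u}) : M ⟶ point where
  toFun _ := PUnit.unit
  smooth := contMDiff_const
  map_fiber _ := Submodule.ext fun v => by
    have hv : v = 0 := Subsingleton.elim (α := PUnit.{u + 1}) _ _
    rw [hv]
    exact iff_of_true (Submodule.zero_mem _) (Submodule.zero_mem _)

/-- The point is terminal. -/
noncomputable def isTerminalPoint : IsTerminal point.{u} :=
  IsTerminal.ofUniqueHom toPoint fun _ _ => hom_ext fun _ => rfl

/-- A morphism from the point maps the zero distribution onto the distribution at its value. The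
unit provides such a morphism, and the rank is constant. -/
theorem rank_eq_zero_of_groupObject (G : GroupObject FMn.{u}) : G.X.fol.rank = 0 := by
  let f : point ⟶ G.X := G.isTerminal.from point ≫ G.one
  have h := f.map_fiber PUnit.unit
  have : point.{u}.fol.fiber PUnit.unit = ⊥ := rfl
  rw [this, Submodule.map_bot] at h
  rw [← G.X.fol.finrank_fiber (f.toFun PUnit.unit), ← h]
  exact finrank_bot _ _

end FMn

end Products

/-! ### From a splitting in `FMn` to a splitting over the base. -/

section Forward

/-- The projection `F × B ⟶ B` is a trivial bundle. -/
def trivializationSnd (F B : Type*) [TopologicalSpace F] [TopologicalSpace B] :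
    Bundle.Trivialization F (Prod.snd : F × B → B) where
  toOpenPartialHomeomorph := (Homeomorph.prodComm F B).toOpenPartialHomeomorph
  baseSet := Set.univ
  open_baseSet := isOpen_univ
  source_eq := by simp
  target_eq := by simp
  proj_toFun _ _ := rfl

namespace FMn

theorem exists_groupBundle_of_splits {B : SmoothMfd.{u}} {M : FMn.{u}} (π : M ⟶ full B)
    (h : ∃ G : GroupObject FMn.{u}, KernelPairSplitsBy π G) :
    ∃ G : GroupObject (OverFull B), IsGroupBundle G ∧ KernelPairSplitsBy (relative π) G := by
  obtain ⟨G, hG⟩ := h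
  have hr := rank_eq_zero_of_groupObject G
  refine ⟨G.over (binProduct G.X (full B) hr) (binProduct G.X _ hr), ?_, hG.over _ _⟩
  intro b
  refine ⟨G.X.mfd, trivializationSnd G.X.mfd B, trivial, ?_, ?_⟩
  · exact (contMDiff_snd.prodMk contMDiff_fst).contMDiffOn
  · exact (contMDiff_snd.prodMk contMDiff_fst).contMDiffOn

end FMn

end Forward

/-! ### Calculus on the space of continuous paths. -/

section Superposition

open scoped Topology unitInterval

variable {K : Type*} [TopologicalSpace K] [CompactSpace K]
variable {E G : Type u} [NormedAddCommGroup E] [NormedSpace ℝ E] [NormedAddCommGroup G]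
  [NormedSpace ℝ G]

/-- Pointwise application of a continuous family of linear maps, as a bounded bilinear map. -/
noncomputable def ContinuousMap.pointwiseApply (K : Type*) [TopologicalSpace K] [CompactSpace K]
    (E G : Type u) [NormedAddCommGroup E] [NormedSpace ℝ E] [NormedAddCommGroup G]
    [NormedSpace ℝ G] : C(K, E →L[ℝ] G) →L[ℝ] C(K, E) →L[ℝ] C(K, G) :=
  LinearMap.mkContinuous₂
    (LinearMap.mk₂ ℝ (fun (a : C(K, E →L[ℝ] G)) (h : C(K, E)) =>
        (⟨fun t => a t (h t), a.continuous.clm_apply h.continuous⟩ : C(K, G)))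
      (fun _ _ _ => by ext; simp) (fun _ _ _ => by ext; simp) (fun _ _ _ => by ext; simp)
      (fun _ _ _ => by ext; simp)) 1 (fun a h => by
        rw [one_mul]
        refine (ContinuousMap.norm_le _ (by positivity)).2 fun t => ?_
        exact ((a t).le_opNorm _).trans
          (mul_le_mul (a.norm_coe_le_norm t) (h.norm_coe_le_norm t) (norm_nonneg _)
            (norm_nonneg a)))

/-- The remainder at each `t` is bounded by the mean value inequality on the segment from `γ t` to
`γ t + h t`. The bound is uniform in `t` because `γ ↦ g' ∘ γ` is continuous for the sup norm. -/
theorem ContinuousMap.hasFDerivAt_comp {g : C(E, G)} {g' : C(E, E →L[ℝ] G)}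
    (hg : ∀ x, HasFDerivAt g (g' x) x) (γ : C(K, E)) :
    HasFDerivAt (fun γ : C(K, E) => g.comp γ)
      (ContinuousMap.pointwiseApply K E G (g'.comp γ)) γ := by
  rw [hasFDerivAt_iff_isLittleO_nhds_zero, Asymptotics.isLittleO_iff]
  intro ε hε
  have hc : ContinuousAt (fun γ : C(K, E) => g'.comp γ) γ :=
    (ContinuousMap.continuous_postcomp g').continuousAt
  obtain ⟨δ, hδ, hδ'⟩ := Metric.mem_nhds_iff (α := C(K, E)) |>.1
    (hc.tendsto (Metric.ball_mem_nhds (α := C(K, E →L[ℝ] G)) _ hε))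
  filter_upwards [Metric.ball_mem_nhds (0 : C(K, E)) hδ] with h hh
  rw [mem_ball_zero_iff] at hh
  refine (ContinuousMap.norm_le _ (by positivity)).2 fun t => ?_
  change ‖g (γ t + h t) - g (γ t) - g' (γ t) (h t)‖ ≤ _
  have hb : ∀ x ∈ segment ℝ (γ t) (γ t + h t), ‖g' x - g' (γ t)‖ ≤ ε := by
    intro x hx
    rw [segment_eq_image'] at hx
    obtain ⟨s, hs, rfl⟩ := hx
    have h₁ : dist (γ + s • h) γ < δ := by
      rw [dist_eq_norm, add_sub_cancel_left, norm_smul, Real.norm_of_nonneg hs.1]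
      exact (mul_le_of_le_one_left (norm_nonneg _) hs.2).trans_lt hh
    have h₂ := (ContinuousMap.dist_apply_le_dist (f := g'.comp (γ + s • h)) (g := g'.comp γ)
      t).trans (Metric.mem_ball.1 (hδ' (Metric.mem_ball.2 h₁))).le
    simpa [dist_eq_norm] using h₂
  have := (convex_segment (𝕜 := ℝ) (γ t) (γ t + h t)).norm_image_sub_le_of_norm_hasFDerivWithin_le'
    (fun x _ => (hg x).hasFDerivWithinAt) hb (left_mem_segment ℝ _ _) (right_mem_segment ℝ _ _)
  rw [add_sub_cancel_left] at this
  exact this.trans (by gcongr; exact h.norm_coe_le_norm t)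

/-- Composition with a smooth map is a smooth map of spaces of continuous functions. -/
theorem ContinuousMap.contDiff_comp {g : C(E, G)} (hg : ContDiff ℝ ∞ g) :
    ContDiff ℝ ∞ (fun γ : C(K, E) => g.comp γ) := by
  rw [contDiff_infty]
  intro n
  -- The derivative is again a composition operator, with `fderiv ℝ g` in place of `g`; its target
  -- is another space, so the induction runs over all targets.
  induction n generalizing G with
  | zero => exact contDiff_zero.2 (ContinuousMap.continuous_postcomp g)
  | succ n ih =>
    have h' : ContDiff ℝ ∞ (fderiv ℝ g) := hg.fderiv_right (by simp)
    refine contDiff_succ_iff_hasFDerivAt.2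
      ⟨fun γ => ContinuousMap.pointwiseApply K E G ((⟨fderiv ℝ g, h'.continuous⟩ :
        C(E, E →L[ℝ] G)).comp γ), ?_, fun γ => ?_⟩
    · exact (ContinuousMap.pointwiseApply K E G).contDiff.comp (ih (g := ⟨fderiv ℝ g, _⟩) h')
    · exact ContinuousMap.hasFDerivAt_comp (g' := ⟨fderiv ℝ g, h'.continuous⟩)
        (fun x => (hg.differentiable (by simp) x).hasFDerivAt) γ

/-- The primitive of a continuous function on the unit interval. -/
noncomputable def unitInterval.primitive (G : Type u) [NormedAddCommGroup G] [NormedSpace ℝ G]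
    [CompleteSpace G] : C(I, G) →L[ℝ] C(I, G) :=
  have hc : ∀ γ : C(I, G), Continuous fun s : ℝ => γ (Set.projIcc 0 1 zero_le_one s) := fun γ =>
    γ.continuous.comp continuous_projIcc
  LinearMap.mkContinuous
    { toFun := fun γ => ⟨fun t => ∫ s in (0 : ℝ)..t, γ (Set.projIcc 0 1 zero_le_one s),
        (intervalIntegral.continuous_primitive (fun a b => (hc γ).intervalIntegrable a b) 0).comp
          continuous_subtype_val⟩
      map_add' := fun γ η => by
        ext t
        exact intervalIntegral.integral_add ((hc γ).intervalIntegrable _ _)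
          ((hc η).intervalIntegrable _ _)
      map_smul' := fun c γ => by
        ext t
        exact intervalIntegral.integral_smul c _ } 1 (fun γ => by
    rw [one_mul]
    refine (ContinuousMap.norm_le _ (by positivity)).2 fun t => ?_
    refine (intervalIntegral.norm_integral_le_of_norm_le_const (C := ‖γ‖)
      (fun s _ => γ.norm_coe_le_norm _)).trans ?_
    refine mul_le_of_le_one_right (norm_nonneg _) ?_
    rw [sub_zero, abs_of_nonneg t.2.1]
    exact t.2.2)

theorem unitInterval.primitive_apply [CompleteSpace G] (γ : C(I, G)) (t : I) :
    unitInterval.primitive G γ t = ∫ s in (0 : ℝ)..t, γ (Set.projIcc 0 1 zero_le_one s) := rfl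

/-- Gronwall's inequality, in the form in which it gives uniqueness for differential equations on
the unit interval. -/
theorem eq_zero_of_deriv_bound {u u' : ℝ → G} {C : ℝ} (hu : ∀ t ∈ I, HasDerivAt u (u' t) t)
    (h0 : u 0 = 0) (hb : ∀ t ∈ I, ‖u' t‖ ≤ C * ‖u t‖) {t : ℝ} (ht : t ∈ I) : u t = 0 :=
  eq_zero_of_abs_deriv_le_mul_abs_self_of_eq_zero_right (a := 0) (b := 1)
    (fun s hs => (hu s hs).continuousAt.continuousWithinAt)
    (fun s hs => (hu s ⟨hs.1, hs.2.le⟩).hasDerivWithinAt) h0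
    (fun s hs => hb s ⟨hs.1, hs.2.le⟩) t ht

end Superposition

/-! ### The equation of parallel transport along rays. -/

section LocalTransport

open scoped Topology unitInterval
open Filter

/-- A function that is smooth near a point agrees there with a globally smooth function. -/
theorem exists_contDiff_eventuallyEq {E G : Type*} [NormedAddCommGroup E] [NormedSpace ℝ E]
    [FiniteDimensional ℝ E] [NormedAddCommGroup G] [NormedSpace ℝ G] {A : E → G} {x : E}
    (h : ∀ᶠ z in 𝓝 x, ContDiffAt ℝ ∞ A z) : ∃ A' : E → G, ContDiff ℝ ∞ A' ∧ A' =ᶠ[𝓝 x] A := by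
  obtain ⟨ε, hε, h⟩ := Metric.eventually_nhds_iff_ball.1 h
  -- The support of the bump function lies in the closed ball of radius `ε / 2`, inside the ball of
  -- radius `ε` on which `A` is smooth.
  let c : ContDiffBump x := ⟨ε / 4, ε / 2, by positivity, by linarith⟩
  refine ⟨fun z => c z • A z, contDiff_iff_contDiffAt.2 fun z => ?_, ?_⟩
  · by_cases hz : z ∈ tsupport fun z => c z • A z
    swap
    · exact contDiffAt_const.congr_of_eventuallyEq (notMem_tsupport_iff_eventuallyEq.1 hz)
    refine c.contDiff.contDiffAt.smul (h z ?_)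
    have := closure_mono (Function.support_smul_subset_left (c : E → ℝ) A) hz
    have h₁ : z ∈ tsupport c := this
    rw [c.tsupport_eq] at h₁
    exact Metric.closedBall_subset_ball (half_lt_self hε) h₁
  · filter_upwards [c.eventuallyEq_one] with z hz
    rw [hz]
    exact one_smul ℝ (A z)

variable {V F : Type u} [NormedAddCommGroup V] [NormedSpace ℝ V] [NormedAddCommGroup F]
  [NormedSpace ℝ F]

/-- The right-hand side of the ordinary differential equation for parallel transport along the
segment from `a` to `a + v`. -/
noncomputable def transportField (A : V × F → V →L[ℝ] F) (m : ℝ × (((V × F) × V) × F)) : F :=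
  A (m.2.1.1.1 + m.1 • m.2.1.2, m.2.2) m.2.1.2

theorem contDiff_transportField {A : V × F → V →L[ℝ] F} (hA : ContDiff ℝ ∞ A) :
    ContDiff ℝ ∞ (transportField A) := by
  unfold transportField
  fun_prop

/-- The linearized equation when the velocity `v` varies in the direction `w` and the path in the
direction `e`, with time and starting data fixed. -/
theorem fderiv_transportField {A : V × F → V →L[ℝ] F} (hA : ContDiff ℝ ∞ A)
    (m : ℝ × (((V × F) × V) × F)) (w : V) (e : F) :
    fderiv ℝ (transportField A) m (0, ((0, w), e)) =
      fderiv ℝ A (m.2.1.1.1 + m.1 • m.2.1.2, m.2.2) (m.1 • w, e) m.2.1.2 +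
        A (m.2.1.1.1 + m.1 • m.2.1.2, m.2.2) w := by
  obtain ⟨s, ⟨⟨a, y⟩, v⟩, x⟩ := m
  have hl : HasDerivAt (fun r : ℝ => transportField A (s, ((a, y), v + r • w), x + r • e))
      (fderiv ℝ (transportField A) (s, ((a, y), v), x) (0, ((0, w), e))) 0 := by
    have h₁ : HasDerivAt (fun r : ℝ => (((s, ((a, y), v), x) : ℝ × (((V × F) × V) × F)) +
        r • ((0, ((0, w), e)) : ℝ × (((V × F) × V) × F)))) (0, ((0, w), e)) 0 := by
      simpa using ((hasDerivAt_id (0 : ℝ)).smul_const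
        ((0, ((0, w), e)) : ℝ × (((V × F) × V) × F))).const_add (s, ((a, y), v), x)
    have h₂ := ((contDiff_transportField hA).differentiable (by simp)
      (((s, ((a, y), v), x) : ℝ × (((V × F) × V) × F)) + (0 : ℝ) •
        ((0, ((0, w), e)) : ℝ × (((V × F) × V) × F)))).hasFDerivAt.comp_hasDerivAt 0 h₁
    simpa [Function.comp_def] using h₂
  have hr : HasDerivAt (fun r : ℝ => transportField A (s, ((a, y), v + r • w), x + r • e))
      (fderiv ℝ A (a + s • v, x) (s • w, e) v + A (a + s • v, x) w) 0 := by
    have h₀ : HasDerivAt (fun r : ℝ => v + r • w) w 0 := by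
      simpa using ((hasDerivAt_id (0 : ℝ)).smul_const w).const_add v
    have h₁ : HasDerivAt (fun r : ℝ => ((a + s • (v + r • w), x + r • e) : V × F))
        (s • w, e) 0 := by
      refine ((h₀.const_smul s).const_add a).prodMk ?_
      simpa using ((hasDerivAt_id (0 : ℝ)).smul_const e).const_add x
    have h₂ := (hA.differentiable (by simp) (a + s • (v + (0 : ℝ) • w),
      x + (0 : ℝ) • e)).hasFDerivAt.comp_hasDerivAt 0 h₁
    simpa [transportField] using h₂.clm_apply h₀
  exact hl.unique hr

/-- The path `t ↦ (0, p, γ t)`. -/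
noncomputable def pathInsert (P F : Type u) [NormedAddCommGroup P] [NormedSpace ℝ P]
    [NormedAddCommGroup F] [NormedSpace ℝ F] : P × C(I, F) →L[ℝ] C(I, ℝ × (P × F)) :=
  LinearMap.mkContinuous
    { toFun := fun x => ⟨fun t => (0, x.1, x.2 t), by fun_prop⟩
      map_add' := fun x y => by ext <;> simp
      map_smul' := fun c x => by ext <;> simp } 1 fun x => by
    rw [one_mul]
    refine (ContinuousMap.norm_le _ (norm_nonneg _)).2 fun t => ?_
    refine norm_prod_le_iff.2 ⟨by simp, norm_prod_le_iff.2 ⟨norm_fst_le x, ?_⟩⟩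
    exact (x.2.norm_coe_le_norm t).trans (norm_snd_le x)

/-- The path `t ↦ (t, p, γ t)`. -/
noncomputable def timePath {P F : Type u} [NormedAddCommGroup P] [NormedSpace ℝ P]
    [NormedAddCommGroup F] [NormedSpace ℝ F] (x : P × C(I, F)) : C(I, ℝ × (P × F)) :=
  (⟨fun t => ((t : ℝ), 0), by fun_prop⟩ : C(I, ℝ × (P × F))) + pathInsert P F x

theorem timePath_apply {P F : Type u} [NormedAddCommGroup P] [NormedSpace ℝ P]
    [NormedAddCommGroup F] [NormedSpace ℝ F] (x : P × C(I, F)) (t : I) :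
    timePath x t = ((t : ℝ), x.1, x.2 t) := by
  change ((t : ℝ), (0 : P × F)) + (0, x.1, x.2 t) = _
  simp

/-- Constant paths. -/
noncomputable def constPath (F : Type u) [NormedAddCommGroup F] [NormedSpace ℝ F] :
    F →L[ℝ] C(I, F) :=
  LinearMap.mkContinuous
    { toFun := fun y => ContinuousMap.const I y
      map_add' := fun _ _ => rfl
      map_smul' := fun _ _ => rfl } 1 fun y => by
    rw [one_mul]
    exact (ContinuousMap.norm_le _ (norm_nonneg _)).2 fun t => le_rfl

variable [CompleteSpace F]

/-- The map whose zeros are the solutions of the transport equation. -/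
noncomputable def transportEq {A : V × F → V →L[ℝ] F} (hA : ContDiff ℝ ∞ A)
    (x : ((V × F) × V) × C(I, F)) : C(I, F) :=
  x.2 - constPath F x.1.1.2 - unitInterval.primitive F
    ((⟨transportField A, (contDiff_transportField hA).continuous⟩ :
      C(ℝ × (((V × F) × V) × F), F)).comp (timePath x))

theorem hasFDerivAt_timePath {P F : Type u} [NormedAddCommGroup P] [NormedSpace ℝ P]
    [NormedAddCommGroup F] [NormedSpace ℝ F] (x : P × C(I, F)) :
    HasFDerivAt timePath (pathInsert P F) x :=
  HasFDerivAt.const_add _ (pathInsert P F).hasFDerivAt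

theorem contDiff_timePath (P F : Type u) [NormedAddCommGroup P] [NormedSpace ℝ P]
    [NormedAddCommGroup F] [NormedSpace ℝ F] {n : ℕ∞ω} :
    ContDiff ℝ n (timePath : P × C(I, F) → _) :=
  ContDiff.add contDiff_const (ContinuousLinearMap.contDiff (𝕜 := ℝ) (pathInsert P F))

theorem contDiff_transportEq {A : V × F → V →L[ℝ] F} (hA : ContDiff ℝ ∞ A) :
    ContDiff ℝ ∞ (transportEq hA) := by
  have h' := (ContinuousMap.contDiff_comp (K := I) (g := ⟨transportField A,
    (contDiff_transportField hA).continuous⟩) (contDiff_transportField hA)).comp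
      (contDiff_timePath ((V × F) × V) F)
  exact (contDiff_snd.sub ((constPath F).contDiff.comp
    (contDiff_snd.comp (contDiff_fst.comp contDiff_fst)))).sub
      ((unitInterval.primitive F).contDiff.comp h')

theorem fderiv_transportEq {A : V × F → V →L[ℝ] F} (hA : ContDiff ℝ ∞ A)
    (x : ((V × F) × V) × C(I, F)) (w : V) (η : C(I, F)) :
    fderiv ℝ (transportEq hA) x ((0, w), η) = η - unitInterval.primitive F
      (ContinuousMap.pointwiseApply I _ F ((⟨fderiv ℝ (transportField A),
        ((contDiff_transportField hA).continuous_fderiv (by simp))⟩ : C(_, _)).comp (timePath x))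
        (pathInsert _ _ ((0, w), η))) := by
  have h := ContinuousMap.hasFDerivAt_comp (K := I) (g := ⟨transportField A,
    (contDiff_transportField hA).continuous⟩) (g' := ⟨fderiv ℝ (transportField A),
      (contDiff_transportField hA).continuous_fderiv (by simp)⟩)
    (fun m => ((contDiff_transportField hA).differentiable (by simp) m).hasFDerivAt)
    (timePath x)
  have h' := (unitInterval.primitive F).hasFDerivAt.comp x (h.comp x (hasFDerivAt_timePath x))
  have h₁ : HasFDerivAt (fun x : ((V × F) × V) × C(I, F) => x.2 - constPath F x.1.1.2)
      (ContinuousLinearMap.snd ℝ _ _ - (constPath F).comp ((ContinuousLinearMap.snd ℝ V F).comp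
        ((ContinuousLinearMap.fst ℝ (V × F) V).comp (ContinuousLinearMap.fst ℝ _ _)))) x :=
    (ContinuousLinearMap.snd ℝ _ _ - (constPath F).comp ((ContinuousLinearMap.snd ℝ V F).comp
        ((ContinuousLinearMap.fst ℝ (V × F) V).comp
          (ContinuousLinearMap.fst ℝ _ _)))).hasFDerivAt
  have h₂ : HasFDerivAt (transportEq hA) _ x := h₁.sub h'
  rw [h₂.fderiv]
  change η - constPath F 0 - _ = _
  rw [map_zero, sub_zero]
  rfl

/-- For velocity zero the transport equation says that the path is constant. Its derivative in the
path is then the identity, so the implicit function theorem can start there. -/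
theorem transportEq_zero {A : V × F → V →L[ℝ] F} (hA : ContDiff ℝ ∞ A) (z : V × F)
    (γ : C(I, F)) : transportEq hA ((z, 0), γ) = γ - constPath F z.2 := by
  ext t
  have : ∀ s, ((⟨transportField A, (contDiff_transportField hA).continuous⟩ :
      C(ℝ × (((V × F) × V) × F), F)).comp (timePath ((z, 0), γ))) s = 0 := fun s => by
    rw [ContinuousMap.comp_apply, timePath_apply]
    simp [transportField]
  simp only [transportEq, ContinuousMap.sub_apply, unitInterval.primitive_apply, this]
  simp

theorem unitInterval.hasDerivAt_primitive (γ : C(I, F)) (t : ℝ) :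
    HasDerivAt (fun t : ℝ => ∫ s in (0 : ℝ)..t, γ (Set.projIcc 0 1 zero_le_one s))
      (γ (Set.projIcc 0 1 zero_le_one t)) t := by
  have hc : Continuous fun s : ℝ => γ (Set.projIcc 0 1 zero_le_one s) :=
    γ.continuous.comp continuous_projIcc
  exact intervalIntegral.integral_hasDerivAt_right (hc.intervalIntegrable _ _)
    (hc.stronglyMeasurableAtFilter _ _) hc.continuousAt

/-- Integrability of the partial differential equation `∂_b f = A (b, f)` at a point. -/
def IntegrableAt (A : V × F → V →L[ℝ] F) (z : V × F) : Prop :=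
  ∀ v w, fderiv ℝ A z (v, A z v) w = fderiv ℝ A z (w, A z w) v

/-- Solutions along rays solve the full partial differential equation. The variation `η` of the
solution in the direction `w` obeys the linearized equation with `η 0 = 0`. By integrability, so
does `t ↦ t • A (ζ t) w` along the solution curve `ζ`. By uniqueness they agree, and `t = 1` gives
the claim. -/
theorem fderiv_transport {A : V × F → V →L[ℝ] F} (hA : ContDiff ℝ ∞ A)
    {Γ : (V × F) × V → C(I, F)} {Γ' : (V × F) × V →L[ℝ] C(I, F)} {p : (V × F) × V}
    (hΓ : HasFDerivAt Γ Γ' p) (h0 : ∀ᶠ p' in 𝓝 p, transportEq hA (p', Γ p') = 0)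
    (hint : ∀ t : I, IntegrableAt A (p.1.1 + (t : ℝ) • p.2, Γ p t)) (w : V) :
    Γ' (0, w) 1 = A (p.1.1 + p.2, Γ p 1) w := by
  obtain ⟨⟨a, y⟩, v⟩ := p
  set p : (V × F) × V := ((a, y), v)
  set γ := Γ p
  set η := Γ' (0, w)
  have hηe : fderiv ℝ (transportEq hA) (p, γ) ((0, w), η) = 0 := by
    have h := ((contDiff_transportEq hA).differentiable (by simp) (p, γ)).hasFDerivAt
    have h₁ : HasFDerivAt (fun p' => transportEq hA (p', Γ p')) _ p :=
      HasFDerivAt.comp (f := fun p' => (p', Γ p')) p h ((hasFDerivAt_id p).prodMk hΓ)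
    have h₂ : HasFDerivAt (𝕜 := ℝ) (fun p' => transportEq hA (p', Γ p')) 0 p :=
      (hasFDerivAt_const (0 : C(I, F)) p).congr_of_eventuallyEq h0
    exact congrArg (fun L : (V × F) × V →L[ℝ] C(I, F) => L (0, w))
      (HasFDerivAt.unique (𝕜 := ℝ) h₁ h₂)
  rw [fderiv_transportEq, sub_eq_zero] at hηe
  set G := (⟨transportField A, (contDiff_transportField hA).continuous⟩ :
    C(ℝ × (((V × F) × V) × F), F)).comp (timePath (p, γ))
  have hγe : γ = constPath F y + unitInterval.primitive F G := by
    have := h0.self_of_nhds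
    rw [transportEq, sub_sub, sub_eq_zero] at this
    exact this
  set N := ContinuousMap.pointwiseApply I _ F ((⟨fderiv ℝ (transportField A),
    ((contDiff_transportField hA).continuous_fderiv (by simp))⟩ : C(_, _)).comp
      (timePath (p, γ))) (pathInsert _ _ ((0, w), η))
  -- The paths are extended to the real line through their primitives, so that two-sided derivatives
  -- exist also at the end points of the interval.
  let pr : ℝ → I := Set.projIcc 0 1 zero_le_one
  let γ₁ : ℝ → F := fun t => y + ∫ s in (0 : ℝ)..t, G (pr s)
  let η₁ : ℝ → F := fun t => ∫ s in (0 : ℝ)..t, N (pr s)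
  have hγ₁ : ∀ t : I, γ₁ t = γ t := fun t => (congrArg (fun c : C(I, F) => c t) hγe).symm
  have hη₁ : ∀ t : I, η₁ t = η t := fun t => (congrArg (fun c : C(I, F) => c t) hηe).symm
  have hG : ∀ t : I, HasDerivAt γ₁ (A (a + (t : ℝ) • v, γ₁ t) v) t := fun t => by
    have := (unitInterval.hasDerivAt_primitive G t).const_add y
    convert! this using 1
    rw [hγ₁, Set.projIcc_val]
    change _ = transportField A (timePath (p, γ) t)
    rw [timePath_apply]
    rfl
  have hN : ∀ t : I, HasDerivAt η₁ (fderiv ℝ A (a + (t : ℝ) • v, γ₁ t) ((t : ℝ) • w, η₁ t) v +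
      A (a + (t : ℝ) • v, γ₁ t) w) t := fun t => by
    have := unitInterval.hasDerivAt_primitive N t
    convert! this using 1
    rw [hγ₁, hη₁, Set.projIcc_val]
    change _ = fderiv ℝ (transportField A) (timePath (p, γ) t) (0, ((0, w), η t))
    rw [timePath_apply, fderiv_transportField hA]
  let ζ : ℝ → V × F := fun t => (a + t • v, γ₁ t)
  have hζ : ∀ t : I, HasDerivAt ζ (v, A (ζ t) v) t := fun t => by
    refine HasDerivAt.prodMk ?_ (hG t)
    simpa using ((hasDerivAt_id (t : ℝ)).smul_const v).const_add a
  have hAζ : ∀ t : I, HasDerivAt (fun t => A (ζ t)) (fderiv ℝ A (ζ t) (v, A (ζ t) v)) t :=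
    fun t => (hA.differentiable (by simp) (ζ t)).hasFDerivAt.comp_hasDerivAt _ (hζ t)
  -- The defect `u` satisfies a homogeneous linear equation: integrability cancels all the terms
  -- without `u`.
  let u : ℝ → F := fun t => η₁ t - t • A (ζ t) w
  have hu : ∀ t ∈ I, HasDerivAt u (fderiv ℝ A (ζ t) (0, u t) v) t := fun t ht => by
    have h₁ := (hN ⟨t, ht⟩).sub ((hasDerivAt_id t).smul
      ((hAζ ⟨t, ht⟩).clm_apply (hasDerivAt_const t w)))
    convert! h₁ using 1
    have hi := hint ⟨t, ht⟩ v w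
    rw [← hγ₁ ⟨t, ht⟩] at hi
    change fderiv ℝ A (ζ t) (v, A (ζ t) v) w = fderiv ℝ A (ζ t) (w, A (ζ t) w) v at hi
    have e : ((0, u t) : V × F) = (t • w, η₁ t) - t • (w, A (ζ t) w) := by
      ext <;> simp [u]
    rw [e, map_sub, map_smul]
    change fderiv ℝ A (ζ t) (t • w, η₁ t) v - t • fderiv ℝ A (ζ t) (w, A (ζ t) w) v =
      (fderiv ℝ A (ζ t) (t • w, η₁ t) v + A (ζ t) w) - (t • (fderiv ℝ A (ζ t) (v, A (ζ t) v) w +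
        A (ζ t) 0) + (1 : ℝ) • A (ζ t) w)
    rw [hi, map_zero, add_zero, one_smul]
    abel
  have hcζ : ContinuousOn (fun t => fderiv ℝ A (ζ t)) I := fun t ht =>
    ((hA.continuous_fderiv (by simp)).continuousAt.comp
      (hζ ⟨t, ht⟩).continuousAt).continuousWithinAt
  obtain ⟨C, hC⟩ := isCompact_Icc.exists_bound_of_continuousOn
    (E := V × F →L[ℝ] V →L[ℝ] F) hcζ
  have h1 := eq_zero_of_deriv_bound (C := C * ‖v‖) hu (by simp [u, η₁]) (fun t ht => by
    refine ((fderiv ℝ A (ζ t) (0, u t)).le_opNorm v).trans ?_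
    have h₁ := (fderiv ℝ A (ζ t)).le_opNorm (0, u t)
    have h₂ : ‖((0, u t) : V × F)‖ = ‖u t‖ := by simp [Prod.norm_def]
    rw [h₂] at h₁
    have h₃ := h₁.trans (mul_le_mul_of_nonneg_right (hC t ht) (norm_nonneg _))
    nlinarith [mul_le_mul_of_nonneg_right h₃ (norm_nonneg v)])
    (Set.right_mem_Icc.2 zero_le_one)
  have h2 : η₁ 1 = A (a + (1 : ℝ) • v, γ₁ 1) w := by
    have : η₁ 1 - (1 : ℝ) • A (a + (1 : ℝ) • v, γ₁ 1) w = 0 := h1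
    rwa [one_smul, sub_eq_zero] at this
  have e₁ := hη₁ 1
  have e₂ := hγ₁ 1
  rw [one_smul] at h2
  change η₁ 1 = _ at e₁
  change γ₁ 1 = _ at e₂
  rw [← e₁, h2, e₂]

end LocalTransport

/-! ### Existence and uniqueness for the transport equation. -/

section LocalTransportExists

open scoped Topology unitInterval
open Filter

/-- The implicit function is smooth near the base point, not only at it. -/
theorem ContDiffAt.eventually_contDiffAt_implicitFunction {E₁ E₂ G : Type*}
    [NormedAddCommGroup E₁] [NormedSpace ℝ E₁] [CompleteSpace E₁] [NormedAddCommGroup E₂]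
    [NormedSpace ℝ E₂] [CompleteSpace E₂] [NormedAddCommGroup G] [NormedSpace ℝ G]
    [CompleteSpace G] {Φ : E₁ × E₂ → G} (hΦ : ContDiff ℝ ∞ Φ) {u : E₁ × E₂}
    (cdf : ContDiffAt ℝ ∞ Φ u)
    (h : (fderiv ℝ Φ u ∘L .inr ℝ E₁ E₂).IsInvertible) :
    ∀ᶠ x in 𝓝 u.1, ContDiffAt ℝ ∞ (cdf.implicitFunction (by simp) h) x := by
  have hn : (∞ : ℕ∞ω) ≠ 0 := by simp
  set ψ := cdf.implicitFunction hn h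
  have hψ : ContDiffAt ℝ ∞ ψ u.1 := cdf.contDiffAt_implicitFunction hn h
  have hself : ψ u.1 = u.2 := cdf.implicitFunction_apply_self hn h
  -- Smoothness of order `∞` at a point is not an open condition, as the neighborhood may depend on
  -- the order; finite order is. So the implicit function theorem is applied anew at each nearby
  -- point of the graph, and uniqueness identifies its solution with `ψ` there.
  have hψ1 : ∀ᶠ x in 𝓝 u.1, ContDiffAt ℝ 1 ψ x := (hψ.of_le (by simp)).eventually (by simp)
  have hgraph : ContinuousAt (fun x => (x, ψ x)) u.1 := continuousAt_id.prodMk hψ.continuousAt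
  have hinv : ∀ᶠ x in 𝓝 u.1, (fderiv ℝ Φ (x, ψ x) ∘L .inr ℝ E₁ E₂).IsInvertible := by
    have hc : Continuous fun v => fderiv ℝ Φ v ∘L .inr ℝ E₁ E₂ :=
      (hΦ.continuous_fderiv hn).clm_comp continuous_const
    obtain ⟨e, he⟩ := h
    have h₁ : Set.range ((↑) : (E₂ ≃L[ℝ] G) → E₂ →L[ℝ] G) ∈
        𝓝 (fderiv ℝ Φ (u.1, ψ u.1) ∘L .inr ℝ E₁ E₂) := by
      rw [hself, ← he]
      exact e.nhds
    exact (hc.continuousAt.comp hgraph).tendsto h₁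
  have hval := cdf.eventually_apply_implicitFunction hn h
  filter_upwards [hψ1, hinv, hval, hval.eventually_nhds] with x hx hix hvx hvx'
  have hc : ContinuousAt (fun x => (x, ψ x)) x := continuousAt_id.prodMk hx.continuousAt
  have h₂ := hΦ.contDiffAt (x := (x, ψ x)) |>.eventually_apply_eq_iff_implicitFunction hn hix
  refine (hΦ.contDiffAt.contDiffAt_implicitFunction hn hix).congr_of_eventuallyEq ?_
  filter_upwards [hc.tendsto.eventually h₂, hvx'] with x' h₃ h₄
  exact (h₃.1 (h₄.trans hvx.symm)).symm

variable {V F : Type u} [NormedAddCommGroup V] [NormedSpace ℝ V] [FiniteDimensional ℝ V]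
  [NormedAddCommGroup F] [NormedSpace ℝ F] [FiniteDimensional ℝ F]

/-- The ray with start `a`, initial value `y` and velocity `v` is solved by the implicit function
theorem in `C(I, F)`, which makes the path smooth in `(a, y, v)` jointly. Its value at time `1` is
the solution at `a + v`, by `fderiv_transport`. -/
theorem exists_local_transport_of_contDiff {A : V × F → V →L[ℝ] F} (hA : ContDiff ℝ ∞ A)
    {z₀ : V × F} (hi : ∀ᶠ z in 𝓝 z₀, IntegrableAt A z) :
    ∃ f : (V × F) × V → F, (∀ᶠ p in 𝓝 (z₀, 0), ContDiffAt ℝ ∞ f p) ∧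
      (∀ᶠ p in 𝓝 (z₀, 0), HasFDerivAt (fun v => f (p.1, v)) (A (p.1.1 + p.2, f p)) p.2) ∧
      ∀ᶠ z in 𝓝 z₀, f (z, 0) = z.2 := by
  have : CompleteSpace V := FiniteDimensional.complete ℝ V
  have : CompleteSpace F := FiniteDimensional.complete ℝ F
  have hn : (∞ : ℕ∞ω) ≠ 0 := by simp
  have hΦ := contDiff_transportEq hA
  set u : ((V × F) × V) × C(I, F) := ((z₀, 0), constPath F z₀.2)
  have hu : transportEq hA u = 0 := by
    rw [transportEq_zero, sub_self]
  have hinv : (fderiv ℝ (transportEq hA) u ∘L .inr ℝ _ _).IsInvertible := by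
    refine ⟨ContinuousLinearEquiv.refl ℝ _, ?_⟩
    have h₁ : HasFDerivAt (fun γ => transportEq hA ((z₀, 0), γ))
        (fderiv ℝ (transportEq hA) u ∘L .inr ℝ _ _) u.2 :=
      HasFDerivAt.comp (f := fun γ => (u.1, γ)) u.2 (hΦ.differentiable hn u).hasFDerivAt
        (hasFDerivAt_prodMk_right u.1 u.2)
    have h₂ : HasFDerivAt (fun γ => transportEq hA ((z₀, 0), γ))
        (ContinuousLinearMap.id ℝ C(I, F)) u.2 := by
      simp only [transportEq_zero]
      exact (hasFDerivAt_id u.2).sub_const _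
    exact h₂.unique h₁
  have cdf : ContDiffAt ℝ ∞ (transportEq hA) u := hΦ.contDiffAt
  let Γ := cdf.implicitFunction hn hinv
  have hΓs : ∀ᶠ p in 𝓝 (z₀, 0), ContDiffAt ℝ ∞ Γ p :=
    ContDiffAt.eventually_contDiffAt_implicitFunction hΦ cdf hinv
  have hΓe : ∀ᶠ p in 𝓝 (z₀, 0), transportEq hA (p, Γ p) = 0 := by
    have := cdf.eventually_apply_implicitFunction hn hinv
    rwa [hu] at this
  have hΓ0 : Γ (z₀, 0) = constPath F z₀.2 := cdf.implicitFunction_apply_self hn hinv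
  let ev : C(I, F) →L[ℝ] F := ContinuousMap.evalCLM ℝ 1
  refine ⟨fun p => ev (Γ p), ?_, ?_, ?_⟩
  · filter_upwards [hΓs] with p hp
    exact ev.contDiff.contDiffAt.comp p hp
  · obtain ⟨ε, hε, hi⟩ := Metric.eventually_nhds_iff_ball.1 hi
    have h₁ : ∀ᶠ p : (V × F) × V in 𝓝 (z₀, 0), ‖p.1.1 - z₀.1‖ + ‖p.2‖ < ε := by
      have : ContinuousAt (fun p : (V × F) × V => ‖p.1.1 - z₀.1‖ + ‖p.2‖) (z₀, 0) := by fun_prop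
      refine this.eventually_lt continuousAt_const ?_
      simpa using hε
    have h₂ : ∀ᶠ p in 𝓝 (z₀, 0), dist (Γ p) (constPath F z₀.2) < ε := by
      have := hΓs.self_of_nhds.continuousAt
      have h := this.tendsto.eventually (Metric.ball_mem_nhds (Γ (z₀, 0)) hε)
      rwa [hΓ0] at h
    filter_upwards [hΓs, hΓe.eventually_nhds, h₁, h₂] with p hp he hp₁ hp₂
    have hd : HasFDerivAt Γ (fderiv ℝ Γ p) p := (hp.differentiableAt hn).hasFDerivAt
    have key := fderiv_transport hA hd he (fun t => hi _ ?_)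
    · have h₃ : HasFDerivAt (fun v => ev (Γ (p.1, v)))
          (ev ∘L (fderiv ℝ Γ p ∘L .inr ℝ _ _)) p.2 :=
        ev.hasFDerivAt.comp p.2 (HasFDerivAt.comp (f := fun v => (p.1, v)) p.2 hd
          (hasFDerivAt_prodMk_right p.1 p.2))
      convert! h₃ using 1
      ext w
      exact (key w).symm
    · rw [Metric.mem_ball, Prod.dist_eq, max_lt_iff]
      constructor
      · rw [dist_eq_norm, add_sub_right_comm]
        refine (norm_add_le _ _).trans_lt (lt_of_le_of_lt ?_ hp₁)
        rw [norm_smul, Real.norm_of_nonneg t.2.1]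
        exact add_le_add_right (mul_le_of_le_one_left (norm_nonneg _) t.2.2) _
      · exact (ContinuousMap.dist_apply_le_dist (f := Γ p) (g := constPath F z₀.2) t).trans_lt hp₂
  · have hc : ContinuousAt (fun z : V × F => (z, (0 : V))) z₀ := by fun_prop
    filter_upwards [hc.tendsto.eventually hΓe] with z hz
    rw [transportEq_zero, sub_eq_zero] at hz
    exact congrArg (fun γ : C(I, F) => γ 1) hz

/-- Local solutions of an integrable partial differential equation `∂_b f = A (b, f)`, smooth
in the initial conditions. -/
theorem exists_local_transport {A : V × F → V →L[ℝ] F} {z₀ : V × F}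
    (hA : ∀ᶠ z in 𝓝 z₀, ContDiffAt ℝ ∞ A z) (hi : ∀ᶠ z in 𝓝 z₀, IntegrableAt A z) :
    ∃ f : (V × F) × V → F, (∀ᶠ p in 𝓝 (z₀, z₀.1), ContDiffAt ℝ ∞ f p) ∧
      (∀ᶠ p in 𝓝 (z₀, z₀.1), HasFDerivAt (fun b => f (p.1, b)) (A (p.2, f p)) p.2) ∧
      ∀ᶠ z in 𝓝 z₀, f (z, z.1) = z.2 := by
  obtain ⟨A', hA', hAA'⟩ := exists_contDiff_eventuallyEq hA
  have hi' : ∀ᶠ z in 𝓝 z₀, IntegrableAt A' z := by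
    filter_upwards [hi, hAA'.eventually_nhds] with z hz hz' v w
    have := hz v w
    have hz'' : A' =ᶠ[𝓝 z] A := hz'
    rwa [← hz''.fderiv_eq, ← hz''.self_of_nhds] at this
  obtain ⟨f, hf₁, hf₂, hf₃⟩ := exists_local_transport_of_contDiff hA' hi'
  -- The velocity of the ray from the starting point `p.1.1` to the end point `p.2`.
  have hc : ContinuousAt (fun p : (V × F) × V => (p.1, p.2 - p.1.1)) (z₀, z₀.1) := by fun_prop
  have hc' : Tendsto (fun p : (V × F) × V => (p.1, p.2 - p.1.1)) (𝓝 (z₀, z₀.1))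
      (𝓝 (z₀, 0)) := by simpa [ContinuousAt] using hc
  have hs : ∀ᶠ p in 𝓝 (z₀, z₀.1), ContDiffAt ℝ ∞ (fun p : (V × F) × V =>
      f (p.1, p.2 - p.1.1)) p := by
    filter_upwards [hc'.eventually hf₁] with p hp
    exact ContDiffAt.comp (f := fun p : (V × F) × V => (p.1, p.2 - p.1.1)) p hp
      (by fun_prop)
  refine ⟨fun p => f (p.1, p.2 - p.1.1), hs, ?_, ?_⟩
  · have h₁ : Tendsto (fun p : (V × F) × V => (p.2, f (p.1, p.2 - p.1.1))) (𝓝 (z₀, z₀.1))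
        (𝓝 z₀) := by
      have := (continuousAt_snd.prodMk hs.self_of_nhds.continuousAt).tendsto
      simpa [hf₃.self_of_nhds] using this
    filter_upwards [hc'.eventually hf₂, h₁.eventually hAA'] with p hp hp'
    rw [← hp']
    have h₂ := HasFDerivAt.comp (f := fun b => b - p.1.1) p.2 hp
      ((hasFDerivAt_id p.2).sub_const p.1.1)
    simpa [Function.comp_def] using h₂
  · filter_upwards [hf₃] with z hz
    simpa using hz

omit [FiniteDimensional ℝ V] [FiniteDimensional ℝ F] in
/-- Local uniqueness of the solutions of the partial differential equation `∂_b f = A (b, f)`. -/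
theorem eventually_eq_of_transport {A : V × F → V →L[ℝ] F} {a₀ : V} {g₁ g₂ : V → F}
    (hA : ContDiffAt ℝ 1 A (a₀, g₁ a₀))
    (h₁ : ∀ᶠ b in 𝓝 a₀, HasFDerivAt g₁ (A (b, g₁ b)) b)
    (h₂ : ∀ᶠ b in 𝓝 a₀, HasFDerivAt g₂ (A (b, g₂ b)) b) (h : g₁ a₀ = g₂ a₀) :
    g₁ =ᶠ[𝓝 a₀] g₂ := by
  obtain ⟨K, s, hs, hK⟩ := hA.exists_lipschitzOnWith
  have hc₁ : ContinuousAt (fun b => (b, g₁ b)) a₀ :=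
    continuousAt_id.prodMk h₁.self_of_nhds.continuousAt
  have hc₂ : ContinuousAt (fun b => (b, g₂ b)) a₀ :=
    continuousAt_id.prodMk h₂.self_of_nhds.continuousAt
  have hs₁ := hc₁.tendsto.eventually hs
  have hs₂ := hc₂.tendsto.eventually (h ▸ hs)
  obtain ⟨ε, hε, H⟩ := Metric.eventually_nhds_iff_ball.1 (h₁.and (h₂.and (hs₁.and hs₂)))
  filter_upwards [Metric.ball_mem_nhds a₀ hε] with b hb
  let ζ : ℝ → V := fun t => a₀ + t • (b - a₀)
  have hζ : ∀ t, HasDerivAt ζ (b - a₀) t := fun t => by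
    simpa [ζ] using ((hasDerivAt_id t).smul_const (b - a₀)).const_add a₀
  have hmem : ∀ t ∈ I, ζ t ∈ Metric.ball a₀ ε := fun t ht => by
    rw [Metric.mem_ball, dist_eq_norm, add_sub_cancel_left, norm_smul, Real.norm_of_nonneg ht.1]
    rw [Metric.mem_ball, dist_eq_norm] at hb
    exact (mul_le_of_le_one_left (norm_nonneg _) ht.2).trans_lt hb
  have hu := eq_zero_of_deriv_bound (u := fun t => g₁ (ζ t) - g₂ (ζ t)) (C := K * ‖b - a₀‖)
    (fun t ht => ((H _ (hmem t ht)).1.comp_hasDerivAt t (hζ t)).sub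
      ((H _ (hmem t ht)).2.1.comp_hasDerivAt t (hζ t))) (by simp [ζ, h]) (fun t ht => by
    rw [← sub_apply]
    refine (ContinuousLinearMap.le_opNorm _ _).trans ?_
    have h₃ := hK.norm_sub_le (H _ (hmem t ht)).2.2.1 (H _ (hmem t ht)).2.2.2
    have h₄ : ‖(ζ t, g₁ (ζ t)) - (ζ t, g₂ (ζ t))‖ = ‖g₁ (ζ t) - g₂ (ζ t)‖ := by
      simp [Prod.norm_def]
    rw [h₄] at h₃
    nlinarith [mul_le_mul_of_nonneg_right h₃ (norm_nonneg (b - a₀))])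
    (Set.right_mem_Icc.2 zero_le_one)
  simpa [ζ, sub_eq_zero] using hu

end LocalTransportExists

/-! ### Vector fields in charts. -/

section ChartFields

open scoped Topology
open VectorField Filter

variable {E H M : Type*} [NormedAddCommGroup E] [NormedSpace ℝ E] [CompleteSpace E]
  [TopologicalSpace H] {I : ModelWithCorners ℝ E H} [I.Boundaryless] [TopologicalSpace M]
  [ChartedSpace H M] [IsManifold I ∞ M]

theorem mlieBracket_eq_lieBracket {E : Type*} [NormedAddCommGroup E] [NormedSpace ℝ E]
    (V W : ∀ x : E, TangentSpace 𝓘(ℝ, E) x) (x : E) :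
    mlieBracket 𝓘(ℝ, E) V W x = lieBracket ℝ V W x := by
  rw [← mlieBracketWithin_univ, mlieBracketWithin_eq_lieBracketWithin]
  exact congrFun lieBracketWithin_univ x

/-- The differential of an extended chart, as an endomorphism of the model space. -/
noncomputable def chartDeriv (I : ModelWithCorners ℝ E H) (x₀ p : M) : E →L[ℝ] E :=
  mfderiv I 𝓘(ℝ, E) (extChartAt I x₀) p

/-- The differential of the inverse of an extended chart, as an endomorphism of the model space. -/
noncomputable def chartSymmDeriv (I : ModelWithCorners ℝ E H) (x₀ : M) (u : E) : E →L[ℝ] E :=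
  mfderiv 𝓘(ℝ, E) I (extChartAt I x₀).symm u

omit [CompleteSpace E] in
theorem contMDiffAt_extChartAt_symm {x₀ : M} {u : E} (hu : u ∈ (extChartAt I x₀).target) :
    ContMDiffAt 𝓘(ℝ, E) I ∞ (extChartAt I x₀).symm u :=
  (contMDiffOn_extChartAt_symm x₀).contMDiffAt ((isOpen_extChartAt_target x₀).mem_nhds hu)

omit [CompleteSpace E] in
theorem chartDeriv_symm {x₀ : M} {u : E} (hu : u ∈ (extChartAt I x₀).target) (e : E) :
    chartDeriv I x₀ ((extChartAt I x₀).symm u) (chartSymmDeriv I x₀ u e) = e := by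
  have h₁ := (contMDiffAt_extChartAt_symm (I := I) hu).mdifferentiableAt (by simp)
  have : IsManifold I 1 M := IsManifold.of_le (n := ∞) (by simp)
  have h₂ : MDifferentiableAt I 𝓘(ℝ, E) (extChartAt I x₀) ((extChartAt I x₀).symm u) :=
    mdifferentiableAt_extChartAt (by simpa using (extChartAt I x₀).map_target hu)
  have h₃ := mfderiv_comp_apply u h₂ h₁ e
  have h₄ : (extChartAt I x₀ ∘ (extChartAt I x₀).symm : E → E) =ᶠ[𝓝 u] id := by
    filter_upwards [(isOpen_extChartAt_target x₀).mem_nhds hu] with v hv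
    exact (extChartAt I x₀).right_inv hv
  have h₅ := congrArg (fun L : E →L[ℝ] E => L e) (h₄.mfderiv_eq (I := 𝓘(ℝ, E)) (I' := 𝓘(ℝ, E)))
  refine h₃.symm.trans (h₅.trans ?_)
  rw [mfderiv_eq_fderiv, fderiv_id]
  rfl

omit [CompleteSpace E] in
theorem chartSymmDeriv_chart {x₀ p : M} (hp : p ∈ (extChartAt I x₀).source) (e : E) :
    chartSymmDeriv I x₀ (extChartAt I x₀ p) (chartDeriv I x₀ p e) = e := by
  have hu := (extChartAt I x₀).map_source hp
  have h₁ := (contMDiffAt_extChartAt_symm (I := I) hu).mdifferentiableAt (by simp)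
  have : IsManifold I 1 M := IsManifold.of_le (n := ∞) (by simp)
  have h₂ : MDifferentiableAt I 𝓘(ℝ, E) (extChartAt I x₀) p :=
    mdifferentiableAt_extChartAt (by simpa using hp)
  have h₃ := mfderiv_comp_apply p h₁ h₂ e
  have h₄ : ((extChartAt I x₀).symm ∘ extChartAt I x₀ : M → M) =ᶠ[𝓝 p] id := by
    filter_upwards [(isOpen_extChartAt_source x₀).mem_nhds hp] with v hv
    exact (extChartAt I x₀).left_inv hv
  have h₅ := congrArg (fun L : E →L[ℝ] E => L e) (h₄.mfderiv_eq (I := I) (I' := I))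
  refine h₃.symm.trans (h₅.trans ?_)
  exact congrArg (fun L : E →L[ℝ] E => L e) (mfderiv_id (I := I) (x := p))

omit [CompleteSpace E] in
theorem chartDeriv_injective {x₀ p : M} (hp : p ∈ (extChartAt I x₀).source) :
    Function.Injective (chartDeriv I x₀ p) :=
  Function.LeftInverse.injective (chartSymmDeriv_chart hp)

omit [CompleteSpace E] in
theorem contDiffAt_chartField {V : ∀ x : M, TangentSpace I x} {x₀ p : M}
    (hp : p ∈ (extChartAt I x₀).source)
    (hV : ContMDiffAt I I.tangent ∞ (fun x => (⟨x, V x⟩ : TangentBundle I M)) p) :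
    ContDiffAt ℝ ∞ (chartField I V x₀) (extChartAt I x₀ p) := by
  have : IsManifold I 1 M := IsManifold.of_le (n := ∞) (by simp)
  set φ := extChartAt I x₀
  have hφ : ContMDiffOn I 𝓘(ℝ, E) ∞ φ φ.source := by
    simpa [φ] using contMDiffOn_extChartAt (I := I) (x := x₀) (n := ∞)
  have ho : IsOpen φ.source := isOpen_extChartAt_source x₀
  have hT := hφ.contMDiffOn_tangentMapWithin (m := ∞) (by simp) ho.uniqueMDiffOn
  have hT' := hT.contMDiffAt (x := ⟨p, V p⟩)
    ((ho.preimage (FiberBundle.continuous_proj E (TangentSpace I : M → Type _))).mem_nhds hp)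
  have hs := contMDiffAt_extChartAt_symm (I := I) (φ.map_source hp)
  have hpp : φ.symm (φ p) = p := φ.left_inv hp
  have h₁ := ContMDiffAt.comp_of_eq (f := φ.symm) hV hs hpp
  have h₂ := ContMDiffAt.comp_of_eq (x := φ p) hT' h₁
    (congrArg (fun q => (⟨q, V q⟩ : TangentBundle I M)) hpp)
  have h₃ := (contMDiff_snd_tangentBundle_modelSpace E 𝓘(ℝ, E) (n := ∞)).contMDiffAt.comp _ h₂
  refine (contMDiffAt_iff_contDiffAt.1 h₃).congr_of_eventuallyEq ?_
  filter_upwards [(isOpen_extChartAt_target x₀).mem_nhds (φ.map_source hp)] with u hu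
  have h := mfderivWithin_of_isOpen (I := I) (I' := 𝓘(ℝ, E)) (f := φ) ho (φ.map_target hu)
  exact (congrArg (fun L : E →L[ℝ] E => L (V (φ.symm u))) h).symm

/-- The vector field on a manifold that is given in a chart. -/
noncomputable def fieldOfChart (I : ModelWithCorners ℝ E H) (x₀ : M) (W : E → E) (p : M) :
    TangentSpace I p := chartSymmDeriv I x₀ (extChartAt I x₀ p) (W (extChartAt I x₀ p))

omit [CompleteSpace E] in
theorem chartDeriv_fieldOfChart {x₀ p : M} (hp : p ∈ (extChartAt I x₀).source) (W : E → E) :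
    chartDeriv I x₀ p (fieldOfChart I x₀ W p) = W (extChartAt I x₀ p) := by
  have := chartDeriv_symm (I := I) ((extChartAt I x₀).map_source hp) (W (extChartAt I x₀ p))
  rwa [(extChartAt I x₀).left_inv hp] at this

omit [CompleteSpace E] in
theorem contMDiffAt_fieldOfChart {x₀ p : M} (hp : p ∈ (extChartAt I x₀).source) {W : E → E}
    (hW : ContDiffAt ℝ ∞ W (extChartAt I x₀ p)) :
    ContMDiffAt I I.tangent ∞ (fun x => (⟨x, fieldOfChart I x₀ W x⟩ : TangentBundle I M)) p := by
  have : IsManifold I 1 M := IsManifold.of_le (n := ∞) (by simp)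
  set φ := extChartAt I x₀
  have hφ : ContMDiffOn 𝓘(ℝ, E) I ∞ φ.symm φ.target := contMDiffOn_extChartAt_symm x₀
  have ho : IsOpen φ.target := isOpen_extChartAt_target x₀
  have hT := hφ.contMDiffOn_tangentMapWithin (m := ∞) (by simp) ho.uniqueMDiffOn
  have hT' := hT.contMDiffAt (x := ⟨φ p, W (φ p)⟩)
    ((ho.preimage (FiberBundle.continuous_proj E (TangentSpace 𝓘(ℝ, E) : E → Type _))).mem_nhds
      (φ.map_source hp))
  have hW' : ContMDiffAt 𝓘(ℝ, E) 𝓘(ℝ, E).tangent ∞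
      (fun u => (⟨u, W u⟩ : TangentBundle 𝓘(ℝ, E) E)) (φ p) := by
    have := contMDiffWithinAt_vectorSpace_iff_contDiffWithinAt (s := Set.univ) (V := W)
      (x := φ p) (n := ∞) (𝕜 := ℝ)
    rw [contDiffWithinAt_univ, contMDiffWithinAt_univ] at this
    exact this.2 hW
  have hφp : ContMDiffAt I 𝓘(ℝ, E) ∞ φ p :=
    contMDiffAt_extChartAt' (by simpa [φ] using hp)
  have h₁ := hW'.comp p hφp
  have h₂ := ContMDiffAt.comp_of_eq (x := p) hT' h₁ rfl
  refine h₂.congr_of_eventuallyEq ?_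
  filter_upwards [(isOpen_extChartAt_source x₀).mem_nhds hp] with y hy
  have h := mfderivWithin_of_isOpen (I := 𝓘(ℝ, E)) (I' := I) (f := φ.symm) ho (φ.map_source hy)
  have aux : ∀ {a b : M} (_ : a = b) (e e' : E) (_ : e = e'),
      (⟨a, e⟩ : TangentBundle I M) = ⟨b, e'⟩ := by
    rintro a _ rfl e _ rfl
    rfl
  exact aux (φ.left_inv hy).symm _ _ (congrArg (fun L : E →L[ℝ] E => L (W (φ y))) h).symm

end ChartFields

/-! ### Foliations in charts. -/

section FoliationChart

open scoped Topology
open VectorField Filter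

variable {X : SmoothMfd.{u}} (D : Foliation X)

/-- A foliation, read in an extended chart. -/
noncomputable def Foliation.inChart (x₀ : X) (w : X.E) : Submodule ℝ X.E :=
  (D.fiberE ((extChartAt X.I x₀).symm w)).map
    (chartDeriv X.I x₀ ((extChartAt X.I x₀).symm w) : X.E →ₗ[ℝ] X.E)

theorem Foliation.chartDeriv_mem_inChart {x₀ p : X} (hp : p ∈ (extChartAt X.I x₀).source)
    {e : X.E} : chartDeriv X.I x₀ p e ∈ D.inChart x₀ (extChartAt X.I x₀ p) ↔ e ∈ D.fiberE p := by
  unfold Foliation.inChart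
  rw [(extChartAt X.I x₀).left_inv hp]
  constructor
  · rintro ⟨e', he', h⟩
    rwa [← chartDeriv_injective hp h]
  · exact fun h => ⟨e, h, rfl⟩

theorem Foliation.exists_frame_inChart (x₀ : X) : ∃ W : Fin D.rank → X.E → X.E,
    ∀ᶠ w in 𝓝 (extChartAt X.I x₀ x₀), (∀ i, ContDiffAt ℝ ∞ (W i) w) ∧
      D.inChart x₀ w = Submodule.span ℝ (Set.range fun i => W i w) := by
  obtain ⟨U, hU, hx, V, hV, hs⟩ := D.smooth x₀
  refine ⟨fun i => chartField X.I (V i) x₀, ?_⟩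
  have hc : ContinuousAt (extChartAt X.I x₀).symm (extChartAt X.I x₀ x₀) :=
    continuousAt_extChartAt_symm (I := X.I) x₀
  have h0 : (extChartAt X.I x₀).symm (extChartAt X.I x₀ x₀) = x₀ := extChartAt_to_inv (I := X.I) x₀
  have ht := hc.tendsto
  rw [h0] at ht
  filter_upwards [ht.eventually (hU.mem_nhds hx), extChartAt_target_mem_nhds (I := X.I) x₀]
    with w hw hwt
  constructor
  · intro i
    have := contDiffAt_chartField ((extChartAt X.I x₀).map_target hwt)
      ((hV i).contMDiffAt (hU.mem_nhds hw))
    rwa [(extChartAt X.I x₀).right_inv hwt] at this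
  · unfold Foliation.inChart
    refine (congrArg (Submodule.map _) (hs _ hw)).trans ?_
    refine (Submodule.map_span _ _).trans ?_
    exact congrArg _ (Set.range_comp _ _).symm

/-- Involutivity is stated on the manifold, so the fields are moved there by `fieldOfChart`. The
chart relates them to the given fields and hence relates the brackets. -/
theorem Foliation.lieBracket_mem_inChart {x₀ : X} {w : X.E}
    (hw : w ∈ (extChartAt X.I x₀).target) {V W : X.E → X.E}
    (hV : ∀ᶠ w' in 𝓝 w, ContDiffAt ℝ ∞ V w' ∧ V w' ∈ D.inChart x₀ w')
    (hW : ∀ᶠ w' in 𝓝 w, ContDiffAt ℝ ∞ W w' ∧ W w' ∈ D.inChart x₀ w') :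
    lieBracket ℝ V W w ∈ D.inChart x₀ w := by
  set φ := extChartAt X.I x₀
  obtain ⟨O, hO, hOo, hwO⟩ := eventually_nhds_iff.1
    ((hV.and hW).and ((isOpen_extChartAt_target (I := X.I) x₀).mem_nhds hw))
  let p := φ.symm w
  let U : Set X := φ.source ∩ φ ⁻¹' O
  have hUo : IsOpen U := (continuousOn_extChartAt (I := X.I) x₀).isOpen_inter_preimage
    (isOpen_extChartAt_source x₀) hOo
  have hφp : φ p = w := φ.right_inv hw
  have hpU : p ∈ U := ⟨φ.map_target hw, by change φ p ∈ O; rwa [hφp]⟩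
  have hsm : ∀ {Z : X.E → X.E}, (∀ w' ∈ O, ContDiffAt ℝ ∞ Z w') →
      X.SmoothFieldOn (fieldOfChart X.I x₀ Z) U := fun hZ q hq =>
    (contMDiffAt_fieldOfChart hq.1 (hZ _ hq.2)).contMDiffWithinAt
  have hmem : ∀ {Z : X.E → X.E}, (∀ w' ∈ O, Z w' ∈ D.inChart x₀ w') →
      ∀ q ∈ U, fieldOfChart X.I x₀ Z q ∈ D.fiber q := fun {Z} hZ q hq => by
    refine (D.chartDeriv_mem_inChart hq.1).1 ?_
    rw [chartDeriv_fieldOfChart hq.1]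
    exact hZ _ hq.2
  have hV₁ := hsm (fun w' h => (hO w' h).1.1.1)
  have hW₁ := hsm (fun w' h => (hO w' h).1.2.1)
  have key := D.involutive U _ _ hUo hV₁ hW₁ (hmem fun w' h => (hO w' h).1.1.2)
    (hmem fun w' h => (hO w' h).1.2.2) p hpU
  have hrel : ∀ Z : X.E → X.E, ∀ᶠ q in 𝓝 p, mfderiv X.I 𝓘(ℝ, X.E) φ q
      (fieldOfChart X.I x₀ Z q) = Z (φ q) := fun Z => by
    filter_upwards [hUo.mem_nhds hpU] with q hq
    exact chartDeriv_fieldOfChart hq.1 Z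
  have hmd : ∀ {Z : X.E → X.E}, ContDiffAt ℝ ∞ Z w → MDifferentiableAt 𝓘(ℝ, X.E)
      𝓘(ℝ, X.E).tangent (fun u => (⟨u, Z u⟩ : TangentBundle 𝓘(ℝ, X.E) X.E)) (φ p) := by
    intro Z hZ
    rw [hφp]
    have := contMDiffWithinAt_vectorSpace_iff_contDiffWithinAt (s := Set.univ) (V := Z)
      (x := w) (n := ∞) (𝕜 := ℝ)
    rw [contDiffWithinAt_univ, contMDiffWithinAt_univ] at this
    exact (this.2 hZ).mdifferentiableAt (by simp)
  have hφc : ContMDiffAt X.I 𝓘(ℝ, X.E) ∞ φ p :=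
    contMDiffAt_extChartAt' (by simpa [φ] using hpU.1)
  have hb := mlieBracket_of_related (I := X.I) (I' := 𝓘(ℝ, X.E)) (f := φ) (x₀ := p)
    (hφc.of_le (by norm_cast))
    (hV₁.mdifferentiableAt hUo hpU) (hW₁.mdifferentiableAt hUo hpU)
    (hmd (hO w hwO).1.1.1) (hmd (hO w hwO).1.2.1) (hrel V) (hrel W)
  have h₁ := (D.chartDeriv_mem_inChart hpU.1).2 key
  rw [← hφp]
  refine (congrArg (· ∈ D.inChart x₀ (φ p)) ?_).mpr h₁
  refine Eq.trans ?_ hb.symm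
  exact (mlieBracket_eq_lieBracket V W (φ p)).symm

end FoliationChart

/-! ### Maps in charts. -/

section InCharts

open scoped Topology
open Filter

variable {E H M E' H' M' : Type*} [NormedAddCommGroup E] [NormedSpace ℝ E]
  [TopologicalSpace H] {I : ModelWithCorners ℝ E H} [I.Boundaryless] [TopologicalSpace M]
  [ChartedSpace H M] [IsManifold I ∞ M]
  [NormedAddCommGroup E'] [NormedSpace ℝ E']
  [TopologicalSpace H'] {I' : ModelWithCorners ℝ E' H'} [TopologicalSpace M']
  [ChartedSpace H' M'] [IsManifold I' ∞ M']

theorem contDiffAt_inCharts {f : M → M'} {x₀ p : M} {y₀ : M'}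
    (hp : p ∈ (extChartAt I x₀).source) (hfp : f p ∈ (extChartAt I' y₀).source)
    (hf : ContMDiffAt I I' ∞ f p) :
    ContDiffAt ℝ ∞ (extChartAt I' y₀ ∘ f ∘ (extChartAt I x₀).symm) (extChartAt I x₀ p) := by
  have h₁ := contMDiffAt_extChartAt_symm (I := I) ((extChartAt I x₀).map_source hp)
  have h₂ : ContMDiffAt I' 𝓘(ℝ, E') ∞ (extChartAt I' y₀) (f p) :=
    contMDiffAt_extChartAt' (by simpa using hfp)
  exact contMDiffAt_iff_contDiffAt.1 ((h₂.comp p hf).comp_of_eq h₁ ((extChartAt I x₀).left_inv hp))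

theorem fderiv_inCharts {f : M → M'} {x₀ p : M} {y₀ : M'}
    (hp : p ∈ (extChartAt I x₀).source) (hfp : f p ∈ (extChartAt I' y₀).source)
    (hf : ContMDiffAt I I' ∞ f p) (e : E) :
    fderiv ℝ (extChartAt I' y₀ ∘ f ∘ (extChartAt I x₀).symm) (extChartAt I x₀ p)
      (chartDeriv I x₀ p e) = chartDeriv I' y₀ (f p) (mfderiv I I' f p e) := by
  have : IsManifold I 1 M := IsManifold.of_le (n := ∞) (by simp)
  have : IsManifold I' 1 M' := IsManifold.of_le (n := ∞) (by simp)
  set F := extChartAt I' y₀ ∘ f ∘ (extChartAt I x₀).symm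
  have hF : MDifferentiableAt 𝓘(ℝ, E) 𝓘(ℝ, E') F (extChartAt I x₀ p) :=
    ((contDiffAt_inCharts hp hfp hf).differentiableAt (by simp)).mdifferentiableAt
  have h : (F ∘ extChartAt I x₀ : M → E') =ᶠ[𝓝 p] extChartAt I' y₀ ∘ f := by
    filter_upwards [(isOpen_extChartAt_source (I := I) x₀).mem_nhds hp] with y hy
    exact congrArg (fun z => extChartAt I' y₀ (f z)) ((extChartAt I x₀).left_inv hy)
  have d₁ : MDifferentiableAt I 𝓘(ℝ, E) (extChartAt I x₀) p :=
    mdifferentiableAt_extChartAt (by simpa using hp)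
  have d₂ : MDifferentiableAt I' 𝓘(ℝ, E') (extChartAt I' y₀) (f p) :=
    mdifferentiableAt_extChartAt (by simpa using hfp)
  have e₁ := mfderiv_comp_apply p hF d₁ e
  have e₂ := mfderiv_comp_apply p d₂ (hf.mdifferentiableAt (by simp)) e
  have e₃ := congrArg (fun L : E →L[ℝ] E' => L e) (h.mfderiv_eq (I := I) (I' := 𝓘(ℝ, E')))
  rw [mfderiv_eq_fderiv] at e₁
  exact e₁.symm.trans (e₃.trans e₂)

end InCharts

/-! ### Horizontal lifts as an integrable equation. -/

namespace FMn

section HorizontalLift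

open scoped Topology
open VectorField Filter

variable {X : FMn.{u}} {B : SmoothMfd.{u}} (q : X ⟶ full B)

/-- The underlying map of a morphism to `(B, TB)`. -/
def proj : X → B := q.toFun

theorem contMDiff_proj : ContMDiff X.mfd.I B.I ∞ (proj q) := q.smooth

theorem map_fiber_full (x : X) (v : B.E) :
    ∃ e ∈ X.fol.fiber x, mfderiv X.mfd.I B.I (proj q) x e = v := by
  have : v ∈ (full B).fol.fiberE (proj q x) := trivial
  exact (q.map_fiber x).ge this

/-- The map to the base, read in charts. -/
noncomputable def baseInCharts (x₀ : X) : X.mfd.E → B.E :=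
  extChartAt B.I (proj q x₀) ∘ proj q ∘ (extChartAt X.mfd.I x₀).symm

/-- Frames give linear maps that depend smoothly on the point. -/
theorem exists_frameMap (x₀ : X) : ∃ Φ : X.mfd.E → (Fin X.fol.rank → ℝ) →L[ℝ] X.mfd.E,
    ∀ᶠ w in 𝓝 (extChartAt X.mfd.I x₀ x₀), ContDiffAt ℝ ∞ Φ w ∧
      ∀ e, e ∈ X.fol.inChart x₀ w ↔ ∃ c, Φ w c = e := by
  obtain ⟨W, hW⟩ := X.fol.exists_frame_inChart x₀
  refine ⟨fun w => ∑ i, (ContinuousLinearMap.proj (R := ℝ) (φ := fun _ : Fin X.fol.rank => ℝ)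
    i).smulRight (W i w), ?_⟩
  filter_upwards [hW] with w hw
  constructor
  · refine ContDiffAt.sum fun i _ => ?_
    exact (ContinuousLinearMap.smulRightL ℝ (Fin X.fol.rank → ℝ) X.mfd.E
      (ContinuousLinearMap.proj i)).contDiff.contDiffAt.comp w (hw.1 i)
  · intro e
    rw [hw.2, Submodule.mem_span_range_iff_exists_fun]
    simp

/-- Horizontal lifts of tangent vectors of the base, in charts. -/
theorem exists_lift_inChart (hr : X.fol.rank = B.dim) (x₀ : X) :
    ∃ A : X.mfd.E → B.E →L[ℝ] X.mfd.E, ∀ᶠ w in 𝓝 (extChartAt X.mfd.I x₀ x₀),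
      ContDiffAt ℝ ∞ A w ∧ (∀ v, A w v ∈ X.fol.inChart x₀ w) ∧
      (∀ v, fderiv ℝ (baseInCharts q x₀) w (A w v) = v) ∧
      ∀ e ∈ X.fol.inChart x₀ w, A w (fderiv ℝ (baseInCharts q x₀) w e) = e := by
  obtain ⟨Φ, hΦ⟩ := exists_frameMap x₀
  let N := fun w => fderiv ℝ (baseInCharts q x₀) w ∘L Φ w
  have hx₀ := mem_extChartAt_source (I := X.mfd.I) x₀
  have hqx₀ := mem_extChartAt_source (I := B.I) (proj q x₀)
  have hq : ContDiffAt ℝ ∞ (baseInCharts q x₀) (extChartAt X.mfd.I x₀ x₀) :=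
    contDiffAt_inCharts hx₀ hqx₀ (contMDiff_proj q).contMDiffAt
  have hsurj : Function.Surjective (N (extChartAt X.mfd.I x₀ x₀)) := by
    intro v
    obtain ⟨e, he, hev⟩ := map_fiber_full q x₀ (chartSymmDeriv B.I (proj q x₀)
      (extChartAt B.I (proj q x₀) (proj q x₀)) v)
    obtain ⟨c, hc⟩ := (hΦ.self_of_nhds.2 _).1 ((X.fol.chartDeriv_mem_inChart hx₀).2 he)
    refine ⟨c, ?_⟩
    have h₁ := fderiv_inCharts hx₀ hqx₀ (contMDiff_proj q).contMDiffAt e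
    have h₂ := chartDeriv_symm (I := B.I) (mem_extChartAt_target (I := B.I) (proj q x₀)) v
    rw [extChartAt_to_inv] at h₂
    change fderiv ℝ (baseInCharts q x₀) _ (Φ _ c) = v
    rw [hc]
    refine Eq.trans h₁ (Eq.trans ?_ h₂)
    exact congrArg _ hev
  -- The differential of a morphism maps the distribution onto the tangent space of the base; as the
  -- ranks agree, it is bijective on the distribution.
  have hfin : Module.finrank ℝ (Fin X.fol.rank → ℝ) = Module.finrank ℝ B.E := by
    simpa [SmoothMfd.dim] using hr
  have hbij : Function.Bijective (N (extChartAt X.mfd.I x₀ x₀)) :=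
    ⟨(LinearMap.injective_iff_surjective_of_finrank_eq_finrank hfin (f :=
      (N (extChartAt X.mfd.I x₀ x₀) : _ →ₗ[ℝ] _))).2 hsurj, hsurj⟩
  let e := (LinearEquiv.ofBijective
    (N (extChartAt X.mfd.I x₀ x₀) : (Fin X.fol.rank → ℝ) →ₗ[ℝ] B.E) hbij).toContinuousLinearEquiv
  have he : (e : _ →L[ℝ] _) = N (extChartAt X.mfd.I x₀ x₀) := by
    ext; rfl
  have hNs : ∀ᶠ w in 𝓝 (extChartAt X.mfd.I x₀ x₀), ContDiffAt ℝ ∞ N w := by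
    obtain ⟨U, hU, hqU⟩ : ∃ U ∈ 𝓝 (extChartAt X.mfd.I x₀ x₀),
        ∀ w ∈ U, ContDiffAt ℝ ∞ (baseInCharts q x₀) w := by
      have hc : ContinuousAt (extChartAt X.mfd.I x₀).symm (extChartAt X.mfd.I x₀ x₀) :=
        continuousAt_extChartAt_symm (I := X.mfd.I) x₀
      have ht := hc.tendsto
      rw [extChartAt_to_inv] at ht
      refine ⟨_, inter_mem (extChartAt_target_mem_nhds (I := X.mfd.I) x₀)
        (ht ((contMDiff_proj q).continuous.continuousAt.preimage_mem_nhds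
          (extChartAt_source_mem_nhds (I := B.I) (proj q x₀)))), fun w hw => ?_⟩
      have := contDiffAt_inCharts (I := X.mfd.I) (I' := B.I) (y₀ := proj q x₀)
        ((extChartAt X.mfd.I x₀).map_target hw.1) hw.2 (contMDiff_proj q).contMDiffAt
      rwa [(extChartAt X.mfd.I x₀).right_inv hw.1] at this
    filter_upwards [hΦ, hU] with w h₁ h₂
    exact ((hqU w h₂).fderiv_right (m := ∞) (by simp)).clm_comp h₁.1
  have hinv : ∀ᶠ w in 𝓝 (extChartAt X.mfd.I x₀ x₀), ∃ e' : (Fin X.fol.rank → ℝ) ≃L[ℝ] B.E,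
      (e' : _ →L[ℝ] _) = N w := by
    have := e.nhds
    rw [he] at this
    exact hNs.self_of_nhds.continuousAt.tendsto this
  -- `N w` is the differential of the projection in frame coordinates, so this is its inverse on the
  -- distribution. Invertibility is an open condition and inversion is smooth.
  refine ⟨fun w => Φ w ∘L (N w).inverse, ?_⟩
  filter_upwards [hΦ, hNs, hinv] with w hw hN ⟨e', he'⟩
  have hN' : (N w).inverse = e'.symm := by
    rw [← he', ContinuousLinearMap.inverse_equiv]
  refine ⟨?_, fun v => (hw.2 _).2 ⟨_, rfl⟩, fun v => ?_, fun y hy => ?_⟩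
  · have h₁ : ContDiffAt ℝ ∞ ContinuousLinearMap.inverse (N w) := by
      rw [← he']
      exact contDiffAt_map_inverse e'
    exact hw.1.clm_comp (h₁.comp w hN)
  · change N w ((N w).inverse v) = v
    rw [hN', ← he']
    exact e'.apply_symm_apply v
  · obtain ⟨c, rfl⟩ := (hw.2 y).1 hy
    change Φ w ((N w).inverse (N w c)) = Φ w c
    rw [hN', ← he']
    exact congrArg _ (e'.symm_apply_apply c)

/-- The equation for horizontal lifts is integrable. -/
theorem integrableAt_of_lift {x₀ : X} {A : X.mfd.E → B.E →L[ℝ] X.mfd.E} {w : X.mfd.E}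
    (hw : w ∈ (extChartAt X.mfd.I x₀).target)
    (hqw : proj q ((extChartAt X.mfd.I x₀).symm w) ∈ (extChartAt B.I (proj q x₀)).source)
    (hA : ∀ᶠ w in 𝓝 w,
      ContDiffAt ℝ ∞ A w ∧ (∀ v, A w v ∈ X.fol.inChart x₀ w) ∧
      (∀ v, fderiv ℝ (baseInCharts q x₀) w (A w v) = v) ∧
      ∀ e ∈ X.fol.inChart x₀ w, A w (fderiv ℝ (baseInCharts q x₀) w e) = e) (b : B.E) :
    IntegrableAt (fun z : B.E × X.mfd.E => A z.2) (b, w) := by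
  intro v v'
  have hAd : DifferentiableAt ℝ A w := hA.self_of_nhds.1.differentiableAt (by simp)
  have hs : ∀ v, ∀ᶠ w' in 𝓝 w, ContDiffAt ℝ ∞ (fun w => A w v) w' ∧
      A w' v ∈ X.fol.inChart x₀ w' := fun v => by
    filter_upwards [hA] with w' h
    exact ⟨h.1.clm_apply contDiffAt_const, h.2.1 v⟩
  have hq : ContDiffAt ℝ ∞ (baseInCharts q x₀) w := by
    have := contDiffAt_inCharts (I := X.mfd.I) (I' := B.I) (y₀ := proj q x₀)
      ((extChartAt X.mfd.I x₀).map_target hw) hqw (contMDiff_proj q).contMDiffAt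
    rwa [(extChartAt X.mfd.I x₀).right_inv hw] at this
  -- The bracket of two lifts of constant fields is horizontal by involutivity, and it projects to
  -- the bracket of constant fields, which is zero. A horizontal vector that projects to zero
  -- vanishes, and this is the integrability condition.
  have h₁ : lieBracket ℝ (fun w => A w v) (fun w => A w v') w ∈ X.fol.inChart x₀ w :=
    X.fol.lieBracket_mem_inChart hw (hs v) (hs v')
  have h₂ : fderiv ℝ (baseInCharts q x₀) w
      (lieBracket ℝ (fun w => A w v) (fun w => A w v') w) = 0 := by
    rw [lieBracket_of_related (V' := fun _ => v) (W' := fun _ => v') (hq.of_le (by norm_cast))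
      ((hs v).self_of_nhds.1.differentiableAt (by simp))
      ((hs v').self_of_nhds.1.differentiableAt (by simp)) (by fun_prop) (by fun_prop)
      (hA.mono fun w' h => h.2.2.1 v) (hA.mono fun w' h => h.2.2.1 v')]
    simp [lieBracket_eq]
  have h₃ := hA.self_of_nhds.2.2.2 _ h₁
  rw [h₂, map_zero, lieBracket_eq] at h₃
  have h₄ : ∀ v e, fderiv ℝ (fun w => A w v) w e = fderiv ℝ A w e v := fun v e => by
    rw [fderiv_clm_apply hAd (differentiableAt_const v)]
    simp
  simp only [h₄] at h₃
  have h₅ : fderiv ℝ (fun z : B.E × X.mfd.E => A z.2) (b, w) =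
      fderiv ℝ A w ∘L ContinuousLinearMap.snd ℝ _ _ :=
    (HasFDerivAt.comp (f := Prod.snd) (b, w) hAd.hasFDerivAt hasFDerivAt_snd).fderiv
  rw [h₅]
  exact sub_eq_zero.1 h₃.symm

end HorizontalLift

end FMn

/-! ### Local horizontal sections and their uniqueness. -/

namespace FMn

section HorizontalSections

open scoped Topology
open Filter

variable {X : FMn.{u}} {B : SmoothMfd.{u}} (q : X ⟶ full B)

/-- `s` is near `b` a smooth section of the projection, and horizontal at `b`. -/
structure HorizontalAt (s : B → X) (b : B) : Prop where
  contMDiffAt : ContMDiffAt B.I X.mfd.I ∞ s b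
  proj_eq : proj q (s b) = b
  mem_fiber : ∀ v : B.E, mfderiv B.I X.mfd.I s b v ∈ X.fol.fiber (s b)

variable {q}

theorem HorizontalAt.congr {s s' : B → X} {b : B} (h : HorizontalAt q s b) (e : s' =ᶠ[𝓝 b] s) :
    HorizontalAt q s' b := by
  have hb := e.self_of_nhds
  refine ⟨h.contMDiffAt.congr_of_eventuallyEq e, by rw [hb, h.proj_eq], fun v => ?_⟩
  have h₁ := congrArg (fun L : B.E →L[ℝ] X.mfd.E => L v)
    (e.mfderiv_eq (I := B.I) (I' := X.mfd.I))
  have h₂ : mfderiv B.I X.mfd.I s b v ∈ X.fol.fiberE (s b) := h.mem_fiber v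
  rw [← hb] at h₂
  exact (congrArg (· ∈ X.fol.fiberE (s' b)) h₁).mpr h₂

/-- The differential of a section takes values in the distribution and projects to the identity. The
horizontal lift is the only map with both properties, so horizontal sections solve `∂_b f = A f`. -/
theorem HorizontalAt.hasFDerivAt {s : B → X} {b : B} {x₀ : X} (h : HorizontalAt q s b)
    (hev : ∀ᶠ b' in 𝓝 b, proj q (s b') = b')
    (hs : s b ∈ (extChartAt X.mfd.I x₀).source) (hb : b ∈ (extChartAt B.I (proj q x₀)).source)
    {A : X.mfd.E → B.E →L[ℝ] X.mfd.E}
    (hA : ∀ e ∈ X.fol.inChart x₀ (extChartAt X.mfd.I x₀ (s b)),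
      A (extChartAt X.mfd.I x₀ (s b))
        (fderiv ℝ (baseInCharts q x₀) (extChartAt X.mfd.I x₀ (s b)) e) = e) :
    HasFDerivAt (extChartAt X.mfd.I x₀ ∘ s ∘ (extChartAt B.I (proj q x₀)).symm)
      (A (extChartAt X.mfd.I x₀ (s b))) (extChartAt B.I (proj q x₀) b) := by
  set φ := extChartAt X.mfd.I x₀
  set ψ := extChartAt B.I (proj q x₀)
  have hψb : ψ.symm (ψ b) = b := ψ.left_inv hb
  have hg : DifferentiableAt ℝ (φ ∘ s ∘ ψ.symm) (ψ b) :=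
    (contDiffAt_inCharts hb hs h.contMDiffAt).differentiableAt (by simp)
  have hq : DifferentiableAt ℝ (baseInCharts q x₀) (φ (s b)) :=
    (contDiffAt_inCharts hs (by rwa [h.proj_eq]) (contMDiff_proj q).contMDiffAt).differentiableAt
      (by simp)
  have hgb : (φ ∘ s ∘ ψ.symm) (ψ b) = φ (s b) := congrArg (fun z => φ (s z)) hψb
  have hid : baseInCharts q x₀ ∘ (φ ∘ s ∘ ψ.symm) =ᶠ[𝓝 (ψ b)] id := by
    have hc : ContinuousAt ψ.symm (ψ b) :=
      (contMDiffAt_extChartAt_symm (I := B.I) (ψ.map_source hb)).continuousAt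
    have ht := hc.tendsto
    rw [hψb] at ht
    filter_upwards [ht.eventually (hev.and (h.contMDiffAt.continuousAt.eventually
        ((isOpen_extChartAt_source (I := X.mfd.I) x₀).mem_nhds hs))),
      (isOpen_extChartAt_target (I := B.I) (proj q x₀)).mem_nhds (ψ.map_source hb)] with v hv hv'
    have h₁ : φ.symm (φ (s (ψ.symm v))) = s (ψ.symm v) := φ.left_inv hv.2
    change ψ (proj q (φ.symm (φ (s (ψ.symm v))))) = v
    rw [h₁, hv.1]
    exact ψ.right_inv hv'
  have hcomp : ∀ e, fderiv ℝ (baseInCharts q x₀) (φ (s b))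
      (fderiv ℝ (φ ∘ s ∘ ψ.symm) (ψ b) e) = e := fun e => by
    have h₁ := fderiv_comp (ψ b) (by rwa [hgb]) hg (g := baseInCharts q x₀)
    rw [hid.fderiv_eq, fderiv_id, hgb] at h₁
    exact (congrArg (fun L : B.E →L[ℝ] B.E => L e) h₁).symm
  have hmem : ∀ e, fderiv ℝ (φ ∘ s ∘ ψ.symm) (ψ b) e ∈ X.fol.inChart x₀ (φ (s b)) := fun e => by
    have h₁ := chartDeriv_symm (I := B.I) (ψ.map_source hb) e
    rw [hψb] at h₁
    rw [← h₁, fderiv_inCharts hb hs h.contMDiffAt]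
    exact (X.fol.chartDeriv_mem_inChart hs).2 (h.mem_fiber _)
  convert! hg.hasFDerivAt using 1
  ext e
  have := hA _ (hmem e)
  rwa [hcomp] at this

theorem HorizontalAt.hasFDerivAt_eventually {s : B → X} {x₀ : X} {b : B}
    (h : ∀ᶠ b' in 𝓝 b, HorizontalAt q s b') (hs : s b = x₀)
    {A : X.mfd.E → B.E →L[ℝ] X.mfd.E}
    (hA : ∀ᶠ w in 𝓝 (extChartAt X.mfd.I x₀ x₀), ∀ e ∈ X.fol.inChart x₀ w,
      A w (fderiv ℝ (baseInCharts q x₀) w e) = e) :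
    ∀ᶠ v in 𝓝 (extChartAt B.I (proj q x₀) b),
      HasFDerivAt (extChartAt X.mfd.I x₀ ∘ s ∘ (extChartAt B.I (proj q x₀)).symm)
        (A ((extChartAt X.mfd.I x₀ ∘ s ∘ (extChartAt B.I (proj q x₀)).symm) v)) v := by
  set φ := extChartAt X.mfd.I x₀
  set ψ := extChartAt B.I (proj q x₀)
  have hb : b ∈ ψ.source := by
    have := h.self_of_nhds.proj_eq
    rw [hs] at this
    exact this ▸ mem_extChartAt_source (I := B.I) (proj q x₀)
  have hφ : ∀ᶠ b' in 𝓝 b, s b' ∈ φ.source := by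
    refine h.self_of_nhds.contMDiffAt.continuousAt.eventually ?_
    rw [hs]
    exact extChartAt_source_mem_nhds x₀
  have hφA : ∀ᶠ b' in 𝓝 b, ∀ e ∈ X.fol.inChart x₀ (φ (s b')),
      A (φ (s b')) (fderiv ℝ (baseInCharts q x₀) (φ (s b')) e) = e := by
    have hc : ContinuousAt (fun b' => φ (s b')) b :=
      ContinuousAt.comp_of_eq (continuousAt_extChartAt x₀)
        h.self_of_nhds.contMDiffAt.continuousAt hs
    have ht : Tendsto (fun b' => φ (s b')) (𝓝 b) (𝓝 (φ (s b))) := hc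
    rw [hs] at ht
    exact ht.eventually hA
  have hc : ContinuousAt ψ.symm (ψ b) :=
    (contMDiffAt_extChartAt_symm (I := B.I) (ψ.map_source hb)).continuousAt
  have ht := hc.tendsto
  rw [ψ.left_inv hb] at ht
  filter_upwards [ht.eventually (h.eventually_nhds.and (hφ.and hφA)),
    (isOpen_extChartAt_target (I := B.I) (proj q x₀)).mem_nhds (ψ.map_source hb)] with v hv hv'
  obtain ⟨h₁, h₂, h₃⟩ := hv
  have := h₁.self_of_nhds.hasFDerivAt (h₁.mono fun b' h => h.proj_eq) h₂ (ψ.map_target hv') h₃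
  rwa [ψ.right_inv hv'] at this

/-- Local uniqueness of horizontal sections. -/
theorem HorizontalAt.eventuallyEq (hr : X.fol.rank = B.dim) {s₁ s₂ : B → X} {b : B}
    (h₁ : ∀ᶠ b' in 𝓝 b, HorizontalAt q s₁ b') (h₂ : ∀ᶠ b' in 𝓝 b, HorizontalAt q s₂ b')
    (h : s₁ b = s₂ b) : s₁ =ᶠ[𝓝 b] s₂ := by
  obtain ⟨A, hA⟩ := exists_lift_inChart q hr (s₁ b)
  set φ := extChartAt X.mfd.I (s₁ b)
  set ψ := extChartAt B.I (proj q (s₁ b))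
  have hb : b ∈ ψ.source := by
    have := h₁.self_of_nhds.proj_eq
    exact this.symm ▸ mem_extChartAt_source (I := B.I) _
  have hψb : ψ.symm (ψ b) = b := ψ.left_inv hb
  have hA' := hA.mono fun w h => h.2.2.2
  have e := eventually_eq_of_transport (A := fun z : B.E × X.mfd.E => A z.2) (a₀ := ψ b)
    (g₁ := φ ∘ s₁ ∘ ψ.symm) (g₂ := φ ∘ s₂ ∘ ψ.symm) (by
      refine ContDiffAt.comp (f := Prod.snd) (g := A) _ ?_ contDiffAt_snd
      refine (congrArg (ContDiffAt ℝ 1 A) ?_).mpr (hA.self_of_nhds.1.of_le (by simp))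
      exact congrArg (fun z => φ (s₁ z)) hψb)
    (HorizontalAt.hasFDerivAt_eventually h₁ rfl hA')
    (HorizontalAt.hasFDerivAt_eventually h₂ h.symm hA')
    (by simp only [Function.comp_apply, hψb, h])
  have hs₁ := h₁.self_of_nhds.contMDiffAt.continuousAt.eventually
    (extChartAt_source_mem_nhds (I := X.mfd.I) (s₁ b))
  have hs₂ : ∀ᶠ b' in 𝓝 b, s₂ b' ∈ φ.source := by
    refine h₂.self_of_nhds.contMDiffAt.continuousAt.eventually ?_
    rw [← h]
    exact extChartAt_source_mem_nhds (s₁ b)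
  have hψc : ContinuousAt ψ b := continuousAt_extChartAt' (by simpa [ψ] using hb)
  filter_upwards [hψc.eventually e, hs₁, hs₂,
    (isOpen_extChartAt_source (I := B.I) (proj q (s₁ b))).mem_nhds hb] with b' h₃ h₄ h₅ h₆
  simp only [Function.comp_apply, ψ.left_inv h₆] at h₃
  exact φ.injOn h₄ h₅ h₃

/-- A local solution stays in the graph of a submersion if it starts there. -/
theorem eventually_eq_of_lift {V F : Type u} [NormedAddCommGroup V] [NormedSpace ℝ V]
    [NormedAddCommGroup F] [NormedSpace ℝ F] {A : F → V →L[ℝ] F} {r : F → V} {z₀ : V × F}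
    {f : (V × F) × V → F} (hf : ContinuousAt f (z₀, z₀.1))
    (hd : ∀ᶠ p in 𝓝 (z₀, z₀.1), HasFDerivAt (fun b => f (p.1, b)) (A (f p)) p.2)
    (h0 : ∀ᶠ z in 𝓝 z₀, f (z, z.1) = z.2)
    (hr : ∀ᶠ w in 𝓝 z₀.2, DifferentiableAt ℝ r w ∧ ∀ v, fderiv ℝ r w (A w v) = v) :
    ∀ᶠ p in 𝓝 (z₀, z₀.1), r p.1.2 = p.1.1 → r (f p) = p.2 := by
  have ht : Tendsto f (𝓝 (z₀, z₀.1)) (𝓝 z₀.2) := by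
    have := hf.tendsto
    rwa [h0.self_of_nhds] at this
  have h0' : ∀ᶠ p : (V × F) × V in 𝓝 (z₀, z₀.1), f (p.1, p.1.1) = p.1.2 :=
    (continuousAt_fst (p := (z₀, z₀.1))).eventually h0
  obtain ⟨ε, hε, H⟩ := Metric.eventually_nhds_iff_ball.1 ((hd.and (ht.eventually hr)).and h0')
  filter_upwards [Metric.ball_mem_nhds _ hε] with p hp hrp
  have hp' := hp
  rw [← ball_prod_same] at hp
  have hmem : ∀ b ∈ Metric.ball z₀.1 ε, (p.1, b) ∈ Metric.ball (z₀, z₀.1) ε := fun b hb => by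
    rw [← ball_prod_same]
    exact ⟨hp.1, hb⟩
  -- As `A` lifts the identity through `r`, the difference between `r ∘ f` and the identity has zero
  -- derivative on a convex set; it vanishes at the starting point.
  have hder : ∀ b ∈ Metric.ball z₀.1 ε, HasFDerivAt (fun b => r (f (p.1, b)) - b)
      (0 : V →L[ℝ] V) b := fun b hb => by
    obtain ⟨⟨h₁, h₂, h₃⟩, -⟩ := H _ (hmem b hb)
    have h₄ := (HasFDerivAt.comp (f := fun b => f (p.1, b)) b h₂.hasFDerivAt h₁).sub
      (hasFDerivAt_id b)
    convert! h₄ using 1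
    ext v
    exact (sub_eq_zero.2 (h₃ v)).symm
  have hp1 : p.1.1 ∈ Metric.ball z₀.1 ε := by
    have := hp.1
    rw [← ball_prod_same] at this
    exact this.1
  have hc := (convex_ball z₀.1 ε).is_const_of_fderivWithin_eq_zero (𝕜 := ℝ)
    (f := fun b => r (f (p.1, b)) - b)
    (fun b hb => (hder b hb).differentiableAt.differentiableWithinAt)
    (fun b hb => by
      rw [fderivWithin_of_isOpen Metric.isOpen_ball hb, (hder b hb).fderiv]) hp.2 hp1
  have h₅ : r (f (p.1, p.2)) - p.2 = r (f (p.1, p.1.1)) - p.1.1 := hc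
  rw [(H p hp').2, hrp, sub_self, sub_eq_zero] at h₅
  exact h₅

variable (q) in
/-- Local parallel transport, smooth in the initial point. -/
theorem exists_localTransport (hr : X.fol.rank = B.dim) (x₀ : X) :
    ∃ τ : X × B → X, (∀ᶠ p in 𝓝 (x₀, proj q x₀),
      ContMDiffAt (X.mfd.I.prod B.I) X.mfd.I ∞ τ p ∧ HorizontalAt q (fun b => τ (p.1, b)) p.2) ∧
      ∀ᶠ x in 𝓝 x₀, τ (x, proj q x) = x := by
  obtain ⟨A, hA⟩ := exists_lift_inChart q hr x₀
  set φ := extChartAt X.mfd.I x₀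
  set ψ := extChartAt B.I (proj q x₀)
  set z₀ : B.E × X.mfd.E := (ψ (proj q x₀), φ x₀)
  have hsrc : ∀ᶠ w in 𝓝 (φ x₀), w ∈ φ.target ∧ proj q (φ.symm w) ∈ ψ.source := by
    have hc : ContinuousAt φ.symm (φ x₀) := continuousAt_extChartAt_symm (I := X.mfd.I) x₀
    have ht := hc.tendsto
    rw [extChartAt_to_inv] at ht
    exact Filter.Eventually.and (extChartAt_target_mem_nhds (I := X.mfd.I) x₀)
      (ht ((contMDiff_proj q).continuous.continuousAt.preimage_mem_nhds
        (extChartAt_source_mem_nhds (I := B.I) (proj q x₀))))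
  have hz₂ : Tendsto (Prod.snd : B.E × X.mfd.E → X.mfd.E) (𝓝 z₀) (𝓝 (φ x₀)) :=
    continuousAt_snd (p := z₀)
  have hr' : ∀ᶠ w in 𝓝 (φ x₀), DifferentiableAt ℝ (baseInCharts q x₀) w ∧
      ∀ v, fderiv ℝ (baseInCharts q x₀) w (A w v) = v := by
    filter_upwards [hA, hsrc] with w hw hw'
    have := contDiffAt_inCharts (I := X.mfd.I) (I' := B.I) (y₀ := proj q x₀)
      (φ.map_target hw'.1) hw'.2 (contMDiff_proj q).contMDiffAt
    rw [φ.right_inv hw'.1] at this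
    exact ⟨this.differentiableAt (by simp), hw.2.2.1⟩
  obtain ⟨f, hf₁, hf₂, hf₃⟩ := exists_local_transport (A := fun z : B.E × X.mfd.E => A z.2)
    (z₀ := z₀) (by
      filter_upwards [hz₂.eventually hA] with z hz
      exact ContDiffAt.comp (f := Prod.snd) (g := A) z hz.1 contDiffAt_snd) (by
      filter_upwards [hz₂.eventually (hA.eventually_nhds.and hsrc)] with z hz
      exact integrableAt_of_lift q hz.2.1 hz.2.2 hz.1 z.1)
  have hf₄ := eventually_eq_of_lift hf₁.self_of_nhds.continuousAt hf₂ hf₃ hr'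
  have hft : Tendsto f (𝓝 (z₀, z₀.1)) (𝓝 (φ x₀)) := by
    have := hf₁.self_of_nhds.continuousAt.tendsto
    rwa [hf₃.self_of_nhds] at this
  -- The initial data determined by a point of the total space, and the end point, in charts.
  let κ : X × B → (B.E × X.mfd.E) × B.E := fun p => ((ψ (proj q p.1), φ p.1), ψ p.2)
  have hψ : ∀ {b : B}, b ∈ ψ.source → ContMDiffAt B.I 𝓘(ℝ, B.E) ∞ ψ b := fun h =>
    contMDiffAt_extChartAt' (by simpa [ψ] using h)
  have hφ : ∀ {x : X}, x ∈ φ.source → ContMDiffAt X.mfd.I 𝓘(ℝ, X.mfd.E) ∞ φ x := fun h =>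
    contMDiffAt_extChartAt' (by simpa [φ] using h)
  have hκ : ∀ p : X × B, p.1 ∈ φ.source → proj q p.1 ∈ ψ.source → p.2 ∈ ψ.source →
      ContMDiffAt (X.mfd.I.prod B.I) 𝓘(ℝ, (B.E × X.mfd.E) × B.E) ∞ κ p := by
    intro p h₁ h₂ h₃
    have e₁ : ContMDiffAt (X.mfd.I.prod B.I) 𝓘(ℝ, B.E) ∞ (fun p : X × B => ψ (proj q p.1)) p :=
      ContMDiffAt.comp (f := fun p : X × B => proj q p.1) p (hψ h₂)
        ((contMDiff_proj q).contMDiffAt.comp p contMDiffAt_fst)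
    have e₂ : ContMDiffAt (X.mfd.I.prod B.I) 𝓘(ℝ, X.mfd.E) ∞ (fun p : X × B => φ p.1) p :=
      ContMDiffAt.comp (f := fun p : X × B => p.1) p (hφ h₁) contMDiffAt_fst
    have e₃ : ContMDiffAt (X.mfd.I.prod B.I) 𝓘(ℝ, B.E) ∞ (fun p : X × B => ψ p.2) p :=
      ContMDiffAt.comp (f := fun p : X × B => p.2) p (hψ h₃) contMDiffAt_snd
    exact (e₁.prodMk_space e₂).prodMk_space e₃
  have hx₀ : x₀ ∈ φ.source := mem_extChartAt_source x₀
  have hqx₀ : proj q x₀ ∈ ψ.source := mem_extChartAt_source (proj q x₀)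
  have hκt : Tendsto κ (𝓝 (x₀, proj q x₀)) (𝓝 (z₀, z₀.1)) :=
    (hκ (x₀, proj q x₀) hx₀ hqx₀ hqx₀).continuousAt
  have hev₁ : ∀ᶠ p : X × B in 𝓝 (x₀, proj q x₀), p.1 ∈ φ.source ∧ proj q p.1 ∈ ψ.source := by
    have : ∀ᶠ x in 𝓝 x₀, x ∈ φ.source ∧ proj q x ∈ ψ.source :=
      Filter.Eventually.and (extChartAt_source_mem_nhds (I := X.mfd.I) x₀)
        ((contMDiff_proj q).continuous.continuousAt.preimage_mem_nhds
          (extChartAt_source_mem_nhds (I := B.I) (proj q x₀)))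
    exact (continuousAt_fst (p := (x₀, proj q x₀))).eventually this
  have hev₂ : ∀ᶠ p : X × B in 𝓝 (x₀, proj q x₀), p.2 ∈ ψ.source :=
    (continuousAt_snd (p := (x₀, proj q x₀))).eventually
      (extChartAt_source_mem_nhds (I := B.I) (proj q x₀))
  refine ⟨fun p => φ.symm (f (κ p)), ?_, ?_⟩
  · filter_upwards [hev₁, hev₂, hκt.eventually (hf₁.and (hf₂.eventually_nhds.and
      (hf₄.and (hft.eventually (hsrc.and hA)))))] with p hp₁ hp₂ hp₃
    obtain ⟨h₁, h₂, h₄, h₅, h₆⟩ := hp₃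
    have hsm : ContMDiffAt (X.mfd.I.prod B.I) X.mfd.I ∞ (fun p => φ.symm (f (κ p))) p :=
      (contMDiffAt_extChartAt_symm h₅.1).comp p
        (ContMDiffAt.comp p h₁.contMDiffAt (hκ p hp₁.1 hp₁.2 hp₂))
    have hsl : ContMDiffAt B.I X.mfd.I ∞ (fun b => φ.symm (f (κ (p.1, b)))) p.2 :=
      ContMDiffAt.comp (f := fun b : B => (p.1, b)) p.2 hsm
        (contMDiffAt_const.prodMk contMDiffAt_id)
    have hqp : proj q (φ.symm (f (κ p))) = p.2 := by
      refine ψ.injOn h₅.2 hp₂ (h₄ ?_)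
      change ψ (proj q (φ.symm (φ p.1))) = _
      rw [φ.left_inv hp₁.1]
    refine ⟨hsm, hsl, hqp, fun v => ?_⟩
    have hmt : φ.symm (f (κ p)) ∈ φ.source := φ.map_target h₅.1
    refine (X.fol.chartDeriv_mem_inChart hmt).1 ?_
    have e₁ := fderiv_inCharts (I := B.I) (I' := X.mfd.I) (f := fun b => φ.symm (f (κ (p.1, b))))
      (x₀ := proj q x₀) (y₀ := x₀) (p := p.2) hp₂ hmt hsl v
    have e₂ : (φ ∘ (fun b => φ.symm (f (κ (p.1, b)))) ∘ ψ.symm) =ᶠ[𝓝 (ψ p.2)]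
        fun b => f ((κ p).1, b) := by
      have hc : ContinuousAt (fun b => f ((κ p).1, b)) (ψ p.2) :=
        ContinuousAt.comp (f := fun b => ((κ p).1, b)) h₁.continuousAt
          (continuousAt_const.prodMk continuousAt_id)
      filter_upwards [hc.eventually ((isOpen_extChartAt_target (I := X.mfd.I) x₀).mem_nhds h₅.1),
        (isOpen_extChartAt_target (I := B.I) (proj q x₀)).mem_nhds (ψ.map_source hp₂)] with b h h'
      have h₇ : ψ (ψ.symm b) = b := ψ.right_inv h'
      change φ (φ.symm (f ((κ p).1, ψ (ψ.symm b)))) = _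
      rw [h₇]
      exact φ.right_inv h
    have e₃ := h₂.self_of_nhds.congr_of_eventuallyEq e₂
    rw [e₃.fderiv] at e₁
    refine (congrArg (· ∈ X.fol.inChart x₀ (φ (φ.symm (f (κ p))))) e₁).mp ?_
    rw [φ.right_inv h₅.1]
    exact h₆.2.1 _
  · have hκ' : Tendsto (fun x : X => (ψ (proj q x), φ x)) (𝓝 x₀) (𝓝 z₀) :=
      (((hψ hqx₀).continuousAt.comp (contMDiff_proj q).continuous.continuousAt).prodMk
        (hφ hx₀).continuousAt)
    filter_upwards [hκ'.eventually hf₃, extChartAt_source_mem_nhds (I := X.mfd.I) x₀] with x h₁ h₂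
    change φ.symm (f ((ψ (proj q x), φ x), ψ (proj q x))) = x
    exact (congrArg φ.symm h₁).trans (φ.left_inv h₂)

end HorizontalSections

end FMn

/-! ### Monodromy for systems of local sections. -/

section Monodromy

open scoped Topology
open Filter

variable {B : Type*} [TopologicalSpace B] {Y : Type*}

/-- A class of local sections of a map, stable under restriction and with unique
continuation. -/
structure SectionSystem (q : Y → B) (S : Set B → (B → Y) → Prop) : Prop where
  isOpen : ∀ {U s}, S U s → IsOpen U
  mono : ∀ {U V s}, S U s → V ⊆ U → IsOpen V → S V s
  proj : ∀ {U s}, S U s → ∀ b ∈ U, q (s b) = b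
  unique : ∀ {U s t}, _root_.IsPreconnected U → S U s → S U t → ∀ b ∈ U, s b = t b →
    ∀ b' ∈ U, s b' = t b'

namespace SectionSystem

variable {q : Y → B} {S : Set B → (B → Y) → Prop}

/-- The topology on the total space for which the local sections are open maps. -/
@[reducible] def leafTopology (S : Set B → (B → Y) → Prop) : TopologicalSpace Y where
  IsOpen W := ∀ U s, S U s → ∀ b ∈ U, s b ∈ W → s ⁻¹' W ∈ 𝓝 b
  isOpen_univ _ _ _ _ _ _ := by simp
  isOpen_inter W W' h h' U s hs b hb hW := inter_mem (h U s hs b hb hW.1) (h' U s hs b hb hW.2)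
  isOpen_sUnion T hT U s hs b hb hW := by
    obtain ⟨W, hWT, hW⟩ := hW
    exact mem_of_superset (hT W hWT U s hs b hb hW) fun x hx => ⟨W, hWT, hx⟩

variable (h : SectionSystem q S)

include h

theorem continuous_proj : @Continuous _ _ (leafTopology S) _ q := by
  let _ := leafTopology S
  refine continuous_def.2 fun O hO U s hs b hb hW => ?_
  filter_upwards [(h.isOpen hs).mem_nhds hb,
    hO.mem_nhds (show b ∈ O by rw [← h.proj hs b hb]; exact hW)] with b' h₁ h₂
  change q (s b') ∈ O
  rwa [h.proj hs b' h₁]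

omit h in
theorem continuousAt_section {U : Set B} {s : B → Y} (hs : S U s) {b : B} (hb : b ∈ U) :
    @ContinuousAt _ _ _ (leafTopology S) s b := by
  let _ := leafTopology S
  intro W hW
  obtain ⟨W', hW', ho, hb'⟩ := mem_nhds_iff.1 hW
  exact mem_of_superset (ho U s hs b hb hb') fun x hx => hW' hx

/-- The component of `b` in `U ∩ U'` is open and connected, so unique continuation applies to it. -/
theorem eventuallyEq [LocallyConnectedSpace B] {U U' : Set B} {s t : B → Y} (hs : S U s)
    (ht : S U' t) {b : B} (hb : b ∈ U) (hb' : b ∈ U') (e : s b = t b) : s =ᶠ[𝓝 b] t := by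
  have ho : IsOpen (U ∩ U') := (h.isOpen hs).inter (h.isOpen ht)
  have hc := ho.connectedComponentIn (x := b)
  have hsub := connectedComponentIn_subset (U ∩ U') b
  have hmem : b ∈ connectedComponentIn (U ∩ U') b := mem_connectedComponentIn ⟨hb, hb'⟩
  filter_upwards [hc.mem_nhds hmem] with b' hb''
  exact h.unique isPreconnected_connectedComponentIn
    (h.mono hs (hsub.trans Set.inter_subset_left) hc)
    (h.mono ht (hsub.trans Set.inter_subset_right) hc) b hmem e b' hb''

theorem isOpen_image [LocallyConnectedSpace B] {U : Set B} {s : B → Y} (hs : S U s) :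
    IsOpen[leafTopology S] (s '' U) := by
  rintro U' t ht b hb ⟨b', hb', e⟩
  have hbb : b' = b := by rw [← h.proj hs b' hb', e, h.proj ht b hb]
  subst hbb
  filter_upwards [h.eventuallyEq hs ht hb' hb e, (h.isOpen hs).mem_nhds hb'] with x hx hx'
  exact ⟨x, hx', hx⟩

/-- Over a connected `U` above which each point lies on a section over all of `U`, the images of
these sections are disjoint or equal. They are the sheets, indexed by the fiber over `b`. -/
theorem isCoveringMap [LocallyConnectedSpace B]
    (hext : ∀ b, ∃ U, IsOpen U ∧ _root_.IsPreconnected U ∧ b ∈ U ∧ ∀ y, q y ∈ U →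
      ∃ s, S U s ∧ s (q y) = y) : @IsCoveringMap _ _ (leafTopology S) _ q := by
  let _ := leafTopology S
  intro b
  obtain ⟨U, hUo, hUc, hb, hU⟩ := hext b
  choose s hs hsy using hU
  let _ : TopologicalSpace {y // q y = b} := ⊥
  have : DiscreteTopology {y // q y = b} := ⟨rfl⟩
  have hq := h.continuous_proj
  have hsb : ∀ i : {y // q y = b}, q i.1 ∈ U := fun i => by rw [i.2]; exact hb
  have huniq : ∀ {y y' : Y} (hy : q y ∈ U) (hy' : q y' ∈ U) {b'}, b' ∈ U →
      s y hy b' = s y' hy' b' → ∀ b'' ∈ U, s y hy b'' = s y' hy' b'' := fun hy hy' _ hb' e =>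
    h.unique hUc (hs _ hy) (hs _ hy') _ hb' e
  refine IsEvenlyCovered.to_isEvenlyCovered_preimage (I := {y // q y = b}) ⟨inferInstance, U, hb,
    hUo, hUo.preimage hq, ⟨⟨fun y => (⟨q y.1, y.2⟩, ⟨s y.1 y.2 b, h.proj (hs _ _) b hb⟩),
      fun p => ⟨s p.2.1 (hsb p.2) p.1.1, by
        rw [Set.mem_preimage, h.proj (hs _ _) _ p.1.2]; exact p.1.2⟩, ?_, ?_⟩, ?_, ?_⟩, ?_⟩
  · rintro ⟨y, hy⟩
    have hy' : q (s y hy b) ∈ U := by rw [h.proj (hs _ _) b hb]; exact hb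
    have e : s (s y hy b) hy' b = s y hy b := by
      have := hsy (s y hy b) hy'
      rwa [h.proj (hs y hy) b hb] at this
    exact Subtype.ext ((huniq hy' hy hb e (q y) hy).trans (hsy y hy))
  · rintro ⟨⟨b', hb'⟩, i, hi⟩
    subst hi
    have hq' : q (s i hb b') = b' := h.proj (hs i hb) b' hb'
    have hy' : q (s i hb b') ∈ U := by rwa [hq']
    have e : s (s i hb b') hy' b' = s i hb b' := by
      have := hsy (s i hb b') hy'
      rwa [hq'] at this
    exact Prod.ext (Subtype.ext hq')
      (Subtype.ext ((huniq hy' hb hb' e (q i) hb).trans (hsy i hb)))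
  · refine Continuous.prodMk ((hq.comp continuous_subtype_val).subtype_mk _) ?_
    refine continuous_iff_continuousAt.2 fun y => ?_
    refine ContinuousAt.congr (f := fun _ => ⟨s y.1 y.2 b, h.proj (hs _ _) b hb⟩)
      continuousAt_const ?_
    have hn : s y.1 y.2 '' U ∈ 𝓝 y.1 :=
      (h.isOpen_image (hs _ _)).mem_nhds ⟨q y.1, y.2, hsy _ _⟩
    filter_upwards [continuousAt_subtype_val.preimage_mem_nhds hn] with y' hy'
    obtain ⟨b', hb', e⟩ := hy'
    have hq' : q y'.1 = b' := by rw [← e, h.proj (hs _ _) b' hb']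
    have e' : s y.1 y.2 b' = s y'.1 y'.2 b' := by
      have := hsy y'.1 y'.2
      rw [hq'] at this
      rw [e, this]
    exact Subtype.ext (huniq y.2 y'.2 hb' e' b hb)
  · refine Continuous.subtype_mk ?_ _
    refine continuous_prod_of_discrete_right.2 fun i => ?_
    refine continuous_iff_continuousAt.2 fun b' => ?_
    exact ContinuousAt.comp (f := Subtype.val) (continuousAt_section (hs i.1 (hsb i)) b'.2)
      continuousAt_subtype_val
  · intro y
    rfl

/-- Monodromy: over a simply connected base, local sections extend to global sections. -/
theorem exists_global [SimplyConnectedSpace B] [LocallyPathConnectedSpace B]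
    (hext : ∀ b, ∃ U, IsOpen U ∧ _root_.IsPreconnected U ∧ b ∈ U ∧ ∀ y, q y ∈ U →
      ∃ s, S U s ∧ s (q y) = y) (y : Y) :
    ∃ s : B → Y, s (q y) = y ∧ ∀ b, ∃ U t, b ∈ U ∧ S U t ∧ ∀ b' ∈ U, s b' = t b' := by
  let _ := leafTopology S
  -- A global section is a lift of the identity of the simply connected base to the covering.
  obtain ⟨s, ⟨hs, hqs⟩, -⟩ := (h.isCoveringMap hext).existsUnique_continuousMap_lifts
    (ContinuousMap.id B) (q y) y rfl
  refine ⟨s, hs, fun b => ?_⟩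
  have hq : ∀ b, q (s b) = b := fun b => congrFun hqs b
  obtain ⟨U, hUo, -, hb, hU⟩ := hext b
  obtain ⟨t, ht, htb⟩ := hU (s b) (by rwa [hq])
  rw [hq] at htb
  have ho : IsOpen (s ⁻¹' (t '' U)) := (h.isOpen_image ht).preimage s.continuous
  refine ⟨U ∩ s ⁻¹' (t '' U), t, ⟨hb, b, hb, htb⟩, h.mono ht Set.inter_subset_left (hUo.inter ho),
    ?_⟩
  rintro b' ⟨-, b'', hb'', e⟩
  have : b'' = b' := by rw [← h.proj ht b'' hb'', e, hq]
  rw [← e, this]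

end SectionSystem

end Monodromy

/-! ### Morphisms over the base. -/

namespace FMn

section OverHoms

open scoped Topology
open Filter TopologicalSpace

variable {X : FMn.{u}} {B : SmoothMfd.{u}} {q : X ⟶ full B}

/-- On the fibers of a foliation of the rank of the base, the differential of the projection is
injective. -/
theorem mfderiv_proj_injOn (hr : X.fol.rank = B.dim) (x : X) {v w : X.mfd.E}
    (hv : v ∈ X.fol.fiberE x) (hw : w ∈ X.fol.fiberE x)
    (h : (mfderiv X.mfd.I B.I (proj q) x : X.mfd.E →L[ℝ] B.E) v =
      (mfderiv X.mfd.I B.I (proj q) x : X.mfd.E →L[ℝ] B.E) w) : v = w := by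
  let L : X.mfd.E →L[ℝ] B.E := mfderiv X.mfd.I B.I (proj q) x
  let L' : X.fol.fiberE x →ₗ[ℝ] B.E := (L : X.mfd.E →ₗ[ℝ] B.E) ∘ₗ (X.fol.fiberE x).subtype
  have hs : Function.Surjective L' := fun v => by
    obtain ⟨e, he, hev⟩ := map_fiber_full q x v
    exact ⟨⟨e, he⟩, hev⟩
  have hi : Function.Injective L' :=
    (LinearMap.injective_iff_surjective_of_finrank_eq_finrank
      ((X.fol.finrank_fiberE x).trans hr)).2 hs
  exact congrArg Subtype.val (@hi ⟨v, hv⟩ ⟨w, hw⟩ h)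

/-- Horizontal maps over `B` are morphisms. -/
noncomputable def overHom {W : OverFull B} (hr : W.left.fol.rank = B.dim) (Z : OverFull B)
    (f : Z.left → W.left)
    (hf : ContMDiff Z.left.mfd.I W.left.mfd.I ∞ f) (hq : ∀ z, proj W.hom (f z) = proj Z.hom z)
    (hD : ∀ z, ∀ v ∈ Z.left.fol.fiberE z,
      (mfderiv Z.left.mfd.I W.left.mfd.I f z : Z.left.mfd.E →L[ℝ] W.left.mfd.E) v ∈
        W.left.fol.fiberE (f z)) :
    Z ⟶ W :=
  Over.homMk
    { toFun := f
      smooth := hf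
      map_fiber := fun z => by
        apply le_antisymm
        · rintro _ ⟨v, hv, rfl⟩
          exact hD z v hv
        · intro w hw
          -- Surjectivity onto the distribution is automatic: `w` and the image of a horizontal lift
          -- of its projection are horizontal vectors with the same projection.
          obtain ⟨v, hv, hvw⟩ := map_fiber_full Z.hom z
            ((mfderiv W.left.mfd.I B.I (proj W.hom) (f z) : W.left.mfd.E →L[ℝ] B.E) w)
          refine ⟨v, hv, mfderiv_proj_injOn (q := W.hom) hr (f z) (hD z v hv) hw ?_⟩
          rw [← hvw]
          have h₁ := mfderiv_comp_apply z
            ((contMDiff_proj W.hom).mdifferentiableAt (by simp) (x := f z))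
            (hf.mdifferentiableAt (by simp) (x := z)) v
          have h₂ : proj W.hom ∘ f = proj Z.hom := funext hq
          rw [h₂] at h₁
          exact h₁.symm }
    (FMn.hom_ext hq)

/-- A point of the source of a morphism over `B`, mapped to the target. -/
noncomputable def overApply {Z W : OverFull B} (f : Z ⟶ W) (z : Z.left) : W.left := f.left.toFun z

theorem proj_overApply {Z W : OverFull B} (f : Z ⟶ W) (z : Z.left) :
    proj W.hom (overApply f z) = proj Z.hom z :=
  congrArg (fun k : Z.left ⟶ full B => k.toFun z) (Over.w f)

theorem over_hom_ext {Z W : OverFull B} {f g : Z ⟶ W} (h : ∀ z, overApply f z = overApply g z) :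
    f = g := Over.OverMorphism.ext (FMn.hom_ext h)

theorem contMDiff_overApply {Z W : OverFull B} (f : Z ⟶ W) :
    ContMDiff Z.left.mfd.I W.left.mfd.I ∞ (overApply f) := f.left.smooth

theorem mfderiv_overApply_mem {Z W : OverFull B} (f : Z ⟶ W) (z : Z.left) (v : Z.left.mfd.E)
    (hv : v ∈ Z.left.fol.fiberE z) :
    (mfderiv Z.left.mfd.I W.left.mfd.I (overApply f) z : Z.left.mfd.E →L[ℝ] W.left.mfd.E) v ∈
      W.left.fol.fiberE (overApply f z) :=
  mfderiv_mem f.left z hv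

/-! ### Open subsets of the base -/

theorem mfderiv_subtypeVal_bijective (M : SmoothMfd.{u}) (U : Opens M) (x : U) :
    Function.Bijective (mfderiv M.I M.I (Subtype.val : U → M) x : M.E →L[ℝ] M.E) := by
  classical
  -- A local inverse of the inclusion near `x`; its value outside `U` is immaterial.
  let r : M → U := fun y => if h : y ∈ U then ⟨y, h⟩ else x
  have hr : r ∘ (Subtype.val : U → M) = id := funext fun y => dif_pos y.2
  have hr' : (Subtype.val : U → M) ∘ r =ᶠ[𝓝 x.1] id := by
    filter_upwards [U.isOpen.mem_nhds x.2] with y hy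
    exact congrArg Subtype.val (dif_pos hy)
  have hv : MDifferentiableAt M.I M.I (Subtype.val : U → M) x :=
    (contMDiff_subtype_val (n := ∞)).mdifferentiableAt (by simp)
  have hrd : MDifferentiableAt M.I M.I r x.1 := by
    have : ContMDiffAt M.I M.I ∞ r x.1 := by
      rw [← contMDiffAt_subtype_iff]
      have h : ContMDiffAt M.I M.I ∞ (r ∘ (Subtype.val : U → M)) x := by
        rw [hr]
        exact contMDiffAt_id
      exact h
    exact this.mdifferentiableAt (by simp)
  have hrx : r x.1 = x := congrFun hr x
  have h₁ : ∀ v : M.E, (mfderiv M.I M.I r x.1 : M.E →L[ℝ] M.E)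
      ((mfderiv M.I M.I (Subtype.val : U → M) x : M.E →L[ℝ] M.E) v) = v := fun v => by
    have h := mfderiv_comp_apply x hrd hv v
    rw [hr, mfderiv_id] at h
    exact h.symm
  have h₂ : ∀ v : M.E, (mfderiv M.I M.I (Subtype.val : U → M) x : M.E →L[ℝ] M.E)
      ((mfderiv M.I M.I r x.1 : M.E →L[ℝ] M.E) v) = v := fun v => by
    have h := mfderiv_comp_apply_of_eq (y := x) x.1 hv hrd hrx v
    have h₃ := congrArg (fun L : M.E →L[ℝ] M.E => L v)
      (hr'.mfderiv_eq (I := M.I) (I' := M.I))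
    have h₄ := congrArg (fun L : M.E →L[ℝ] M.E => L v) (mfderiv_id (I := M.I) (x := x.1))
    exact h.symm.trans (h₃.trans h₄)
  exact ⟨Function.LeftInverse.injective h₁, Function.RightInverse.surjective h₂⟩

variable (B) in
/-- The inclusion of an open subset of the base. -/
noncomputable def opensIncl (U : Opens B) : full (B.opens U) ⟶ full B where
  toFun := Subtype.val
  smooth := (contMDiff_subtype_val : ContMDiff B.I B.I ∞ (Subtype.val : U → B))
  map_fiber x := by
    refine top_unique fun v _ => ?_
    obtain ⟨w, hw⟩ := (mfderiv_subtypeVal_bijective B U x).2 v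
    exact ⟨w, trivial, hw⟩

variable (B) in
/-- An open subset of the base, as an object over the base. -/
@[reducible] noncomputable def secObj (U : Opens B) : OverFull B := Over.mk (opensIncl B U)

/-- Horizontal sections over an open set are morphisms. -/
noncomputable def secHom {W : OverFull B} (hr : W.left.fol.rank = B.dim) {U : Opens B}
    {s : B → W.left}
    (hs : ∀ b ∈ U, HorizontalAt W.hom s b) : secObj B U ⟶ W :=
  have h₁ : ContMDiff B.I W.left.mfd.I ∞ (fun b : U => s b) := fun b =>
    contMDiffAt_subtype_iff.2 (hs b.1 b.2).contMDiffAt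
  have h₂ : ∀ (b : U) (v : B.E),
      (mfderiv B.I W.left.mfd.I (fun b : U => s b) b : B.E →L[ℝ] W.left.mfd.E) v ∈
      W.left.fol.fiberE (s b) := fun b v => by
    have h := mfderiv_comp_apply b ((hs b.1 b.2).contMDiffAt.mdifferentiableAt (by simp))
      ((contMDiff_subtype_val (n := ∞) (I := B.I) (U := U)).mdifferentiableAt (by simp)) v
    exact (congrArg (· ∈ W.left.fol.fiberE (s b)) h).mpr ((hs b.1 b.2).mem_fiber _)
  overHom hr (secObj B U) (fun b : U => s b) h₁ (fun b : U => (hs b.1 b.2).proj_eq)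
    (fun b v _ => h₂ b v)

/-- Morphisms from an open set are horizontal sections. -/
theorem horizontalAt_of_secHom {W : OverFull B} {U : Opens B} (f : secObj B U ⟶ W) {s : B → W.left}
    (hs : ∀ b : U, s b = overApply f b) {b : B} (hb : b ∈ U) : HorizontalAt W.hom s b := by
  have hsf : s ∘ (Subtype.val : U → B) = overApply f := funext hs
  have hc : ContMDiffAt B.I W.left.mfd.I ∞ s b := by
    refine contMDiffAt_subtype_iff (x := (⟨b, hb⟩ : U)).1 ?_
    have h : ContMDiffAt B.I W.left.mfd.I ∞ (s ∘ (Subtype.val : U → B)) ⟨b, hb⟩ := by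
      rw [hsf]
      exact (contMDiff_overApply f).contMDiffAt
    exact h
  refine ⟨hc, ?_, fun v => ?_⟩
  · exact (congrArg (proj W.hom) (hs ⟨b, hb⟩)).trans (proj_overApply f ⟨b, hb⟩)
  · obtain ⟨w, rfl⟩ := (mfderiv_subtypeVal_bijective B U ⟨b, hb⟩).2 v
    have h := mfderiv_comp_apply (⟨b, hb⟩ : U) (hc.mdifferentiableAt (by simp))
      ((contMDiff_subtype_val (n := ∞) (I := B.I) (U := U)).mdifferentiableAt (by simp)) w
    rw [hsf] at h
    have h₁ := mfderiv_overApply_mem f ⟨b, hb⟩ w trivial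
    change _ ∈ W.left.fol.fiberE (s b)
    rw [hs ⟨b, hb⟩]
    exact (congrArg (· ∈ W.left.fol.fiberE (overApply f ⟨b, hb⟩)) h).mp h₁

/-- Restriction to a smaller open subset. -/
noncomputable def secRes {U V : Opens B} (h : V ≤ U) : secObj B V ⟶ secObj B U :=
  have h' : ContMDiff B.I B.I ∞ (Opens.inclusion h : V → U) := contMDiff_inclusion h
  overHom (W := secObj B U) rfl (secObj B V) (Opens.inclusion h : V → U) h'
    (fun _ => rfl) (fun _ _ _ => trivial)

/-- Unique continuation of horizontal sections. -/
theorem HorizontalAt.eqOn (hr : X.fol.rank = B.dim) {U : Set B} (hU : IsOpen U)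
    (hUc : _root_.IsPreconnected U) {s t : B → X} (hs : ∀ b ∈ U, HorizontalAt q s b)
    (ht : ∀ b ∈ U, HorizontalAt q t b) {b₀ : B} (hb₀ : b₀ ∈ U) (h₀ : s b₀ = t b₀) :
    ∀ b ∈ U, s b = t b := by
  intro b hb
  have key : ∀ x ∈ U, ∀ᶠ y in 𝓝[U] x, (s x = t x ↔ s y = t y) := fun x hx => by
    by_cases h : s x = t x
    · have := HorizontalAt.eventuallyEq hr (eventually_of_mem (hU.mem_nhds hx) hs)
        (eventually_of_mem (hU.mem_nhds hx) ht) h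
      filter_upwards [mem_nhdsWithin_of_mem_nhds this] with y hy
      exact ⟨fun _ => hy, fun _ => h⟩
    · have := ((hs x hx).contMDiffAt.continuousAt.prodMk
        (ht x hx).contMDiffAt.continuousAt).eventually
        (isClosed_diagonal.isOpen_compl.mem_nhds (x := (s x, t x)) h)
      filter_upwards [mem_nhdsWithin_of_mem_nhds this] with y hy
      exact ⟨fun h' => absurd h' h, fun h' => absurd h' hy⟩
  exact (hUc.induction₂ (fun x y => (s x = t x ↔ s y = t y)) key
    (fun x y z _ _ _ h₁ h₂ => h₁.trans h₂) (fun x y _ _ h => h.symm) hb₀ hb).1 h₀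

end OverHoms

end FMn

/-! ### Local horizontal sections as morphisms. -/

namespace FMn

section LocalSections

open scoped Topology
open Filter TopologicalSpace

variable {B : SmoothMfd.{u}}

/-- Every point lies on a horizontal section over a small open set. -/
theorem exists_secHom {W : OverFull B} (hr : W.left.fol.rank = B.dim) (x : W.left) :
    ∃ (U : Opens B) (hb : proj W.hom x ∈ U) (a : secObj B U ⟶ W),
      overApply a ⟨proj W.hom x, hb⟩ = x := by
  obtain ⟨τ, hτ, hτ'⟩ := exists_localTransport W.hom hr x
  have hc : ContinuousAt (fun b : B => (x, b)) (proj W.hom x) := by fun_prop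
  obtain ⟨U, hU, hUo, hb⟩ := eventually_nhds_iff.1 (hc.eventually hτ)
  exact ⟨⟨U, hUo⟩, hb, secHom hr (s := fun b => τ (x, b)) fun b hb => (hU b hb).2,
    hτ'.self_of_nhds⟩

/-- Sections that agree at a point agree on a neighborhood. -/
theorem exists_secRes_eq {W : OverFull B} (hr : W.left.fol.rank = B.dim) {U U' : Opens B}
    (a : secObj B U ⟶ W) (a' : secObj B U' ⟶ W) {b : B} (hb : b ∈ U) (hb' : b ∈ U')
    (h : overApply a ⟨b, hb⟩ = overApply a' ⟨b, hb'⟩) :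
    ∃ (V : Opens B) (hU : V ≤ U) (hU' : V ≤ U'), b ∈ V ∧ secRes hU ≫ a = secRes hU' ≫ a' := by
  classical
  -- Horizontality is a condition on maps from all of `B`, so morphisms from open sets are extended
  -- arbitrarily.
  let ext : ∀ {U : Opens B}, (secObj B U ⟶ W) → B → W.left := fun {U} a c =>
    if hc : c ∈ U then overApply a ⟨c, hc⟩ else overApply a' ⟨b, hb'⟩
  have hext : ∀ {U : Opens B} (a : secObj B U ⟶ W) (c : U), ext a c = overApply a c :=
    fun a c => dif_pos c.2
  have hor : ∀ {U : Opens B} (a : secObj B U ⟶ W) {c : B}, c ∈ U → HorizontalAt W.hom (ext a) c :=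
    fun a c hc => horizontalAt_of_secHom a (hext a) hc
  have heq := HorizontalAt.eventuallyEq (q := W.hom) hr (s₁ := ext a) (s₂ := ext a')
    (eventually_of_mem (U.isOpen.mem_nhds hb) fun c hc => hor a hc)
    (eventually_of_mem (U'.isOpen.mem_nhds hb') fun c hc => hor a' hc)
    ((hext a ⟨b, hb⟩).trans (h.trans (hext a' ⟨b, hb'⟩).symm))
  obtain ⟨V, hV, hVo, hbV⟩ := eventually_nhds_iff.1
    (heq.and (Filter.Eventually.and (U.isOpen.mem_nhds hb) (U'.isOpen.mem_nhds hb')))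
  refine ⟨⟨V, hVo⟩, fun c hc => (hV c hc).2.1, fun c hc => (hV c hc).2.2, hbV,
    over_hom_ext fun c => ?_⟩
  have h₁ := (hV c.1 c.2).1
  exact (hext a ⟨c.1, (hV c.1 c.2).2.1⟩).symm.trans
    (h₁.trans (hext a' ⟨c.1, (hV c.1 c.2).2.2⟩))

end LocalSections

/-! ### The pointwise group structure of a group bundle. -/

section PointwiseGroup

open scoped Topology
open Filter TopologicalSpace

variable {B : SmoothMfd.{u}} (G : GroupObject (OverFull B))

/-- The unit section. -/
noncomputable def unitPt (b : B) : G.X.left :=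
  overApply (G.oneElem (Over.mk (𝟙 (full B)))) b

theorem overApply_oneElem {Z : OverFull B} (z : Z.left) :
    overApply (G.oneElem Z) z = unitPt G (proj Z.hom z) := by
  have h := G.comp_oneElem (Over.homMk Z.hom : Z ⟶ Over.mk (𝟙 (full B)))
  rw [← h]
  rfl

theorem horizontalAt_unitPt (b : B) : HorizontalAt G.X.hom (unitPt G) b :=
  horizontalAt_of_secHom (G.oneElem (secObj B ⊤)) (fun b =>
    (overApply_oneElem G (Z := secObj B ⊤) b).symm)
    (Opens.mem_top b)

theorem proj_unitPt (b : B) : proj G.X.hom (unitPt G b) = b := (horizontalAt_unitPt G b).proj_eq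

/-- The unit section is a morphism from `(B, TB)`, so its differential maps the tangent space of `B`
onto the distribution; it is injective because the projection inverts it. -/
theorem groupObject_rank [Nonempty B] : G.X.left.fol.rank = B.dim := by
  obtain ⟨b⟩ := ‹Nonempty B›
  let f : full B ⟶ G.X.left := (G.oneElem (Over.mk (𝟙 (full B)))).left
  let L : B.E →L[ℝ] G.X.left.mfd.E := mfderiv B.I G.X.left.mfd.I (unitPt G) b
  have hL : (⊤ : Submodule ℝ B.E).map (L : B.E →ₗ[ℝ] G.X.left.mfd.E) =
    G.X.left.fol.fiberE (unitPt G b) := f.map_fiber b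
  have hi : Function.Injective L := by
    have h : proj G.X.hom ∘ unitPt G = id := funext (proj_unitPt G)
    refine Function.LeftInverse.injective
      (g := (mfderiv G.X.left.mfd.I B.I (proj G.X.hom) (unitPt G b) : _ →L[ℝ] B.E)) fun v => ?_
    have h₁ := mfderiv_comp_apply b
      ((contMDiff_proj G.X.hom).mdifferentiableAt (by simp) (x := unitPt G b))
      ((horizontalAt_unitPt G b).contMDiffAt.mdifferentiableAt (by simp)) v
    rw [h, mfderiv_id] at h₁
    exact h₁.symm
  rw [← G.X.left.fol.finrank_fiberE (unitPt G b), ← hL]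
  refine (LinearEquiv.finrank_eq (Submodule.equivMapOfInjective (L : B.E →ₗ[ℝ] G.X.left.mfd.E)
    hi ⊤).symm).trans ?_
  exact finrank_top ℝ B.E

/-- `z` is the product of `x` and `y`, computed with local sections. -/
def IsMulPt (x y z : G.X.left) : Prop :=
  ∃ (U : Opens B) (b : U) (a a' : secObj B U ⟶ G.X),
    overApply a b = x ∧ overApply a' b = y ∧ overApply (G.mulElem a a') b = z

open Classical in
/-- The product of two points of a group bundle with connection. -/
noncomputable def mulPt (x y : G.X.left) : G.X.left :=
  -- The default value occurs only for points over different points of the base.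
  if h : ∃ z, IsMulPt G x y z then h.choose else x

/-- The inverse of a point of a group bundle with connection. -/
noncomputable def invPt (x : G.X.left) : G.X.left := overApply G.inv x

variable [Nonempty B]

/-- The square of `G` is given only by its universal property, which is tested on morphisms, not
points. Local horizontal sections are morphisms; two through the same point agree nearby, and
products commute with restriction, so the value at a point is well defined. -/
theorem IsMulPt.unique {x y z z' : G.X.left} (h : IsMulPt G x y z) (h' : IsMulPt G x y z') :
    z = z' := by
  obtain ⟨U, b, a₁, a₂, hx, hy, hz⟩ := h
  obtain ⟨U', b', a₁', a₂', hx', hy', hz'⟩ := h'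
  have hr := groupObject_rank G
  have hb : b.1 = b'.1 := by
    have h₁ := proj_overApply a₁ b
    have h₂ := proj_overApply a₁' b'
    rw [hx] at h₁
    rw [hx'] at h₂
    exact h₁.symm.trans h₂
  obtain ⟨b, hbU⟩ := b
  obtain ⟨b', hbU'⟩ := b'
  obtain rfl : b = b' := hb
  obtain ⟨V, hV, hV', hbV, e⟩ := exists_secRes_eq hr a₁ a₁' hbU hbU' (hx.trans hx'.symm)
  obtain ⟨V₂, hV₂, hV₂', hbV₂, e₂⟩ := exists_secRes_eq hr a₂ a₂' hbU hbU' (hy.trans hy'.symm)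
  have e₃ : secRes (inf_le_left.trans hV : V ⊓ V₂ ≤ U) ≫ G.mulElem a₁ a₂ =
      secRes (inf_le_left.trans hV' : V ⊓ V₂ ≤ U') ≫ G.mulElem a₁' a₂' := by
    rw [G.comp_mulElem, G.comp_mulElem]
    have h₁ : secRes (inf_le_left.trans hV : V ⊓ V₂ ≤ U) ≫ a₁ =
        secRes (inf_le_left.trans hV' : V ⊓ V₂ ≤ U') ≫ a₁' :=
      congrArg (fun k => secRes (inf_le_left : V ⊓ V₂ ≤ V) ≫ k) e
    have h₂ : secRes (inf_le_left.trans hV : V ⊓ V₂ ≤ U) ≫ a₂ =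
        secRes (inf_le_left.trans hV' : V ⊓ V₂ ≤ U') ≫ a₂' :=
      congrArg (fun k => secRes (inf_le_right : V ⊓ V₂ ≤ V₂) ≫ k) e₂
    rw [h₁, h₂]
  have e₄ := congrArg (fun k => overApply k (⟨b, hbV, hbV₂⟩ : (V ⊓ V₂ : Opens B))) e₃
  exact hz.symm.trans (e₄.trans hz')

theorem overApply_mulElem_sec {U : Opens B} (a a' : secObj B U ⟶ G.X) (b : U) :
    overApply (G.mulElem a a') b = mulPt G (overApply a b) (overApply a' b) := by
  have h : ∃ z, IsMulPt G (overApply a b) (overApply a' b) z := ⟨_, U, b, a, a', rfl, rfl, rfl⟩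
  unfold mulPt
  rw [dif_pos h]
  exact IsMulPt.unique G ⟨U, b, a, a', rfl, rfl, rfl⟩ h.choose_spec

/-- Products of elements are computed pointwise, at points that lie on horizontal sections. -/
theorem overApply_mulElem {Z : OverFull B} (a a' : Z ⟶ G.X) {U : Opens B} (ρ : secObj B U ⟶ Z)
    (b : U) : overApply (G.mulElem a a') (overApply ρ b) =
      mulPt G (overApply a (overApply ρ b)) (overApply a' (overApply ρ b)) := by
  have h := overApply_mulElem_sec G (ρ ≫ a) (ρ ≫ a') b
  rw [← G.comp_mulElem] at h
  exact h

/-- Three points over the same point of the base lie on sections over a common open set. -/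
theorem exists_secHom₃ {x y z : G.X.left} (hxy : proj G.X.hom x = proj G.X.hom y)
    (hyz : proj G.X.hom y = proj G.X.hom z) : ∃ (U : Opens B) (b : U) (a₁ a₂ a₃ : secObj B U ⟶ G.X),
      overApply a₁ b = x ∧ overApply a₂ b = y ∧ overApply a₃ b = z := by
  have hr := groupObject_rank G
  obtain ⟨U₁, h₁, a₁, e₁⟩ := exists_secHom hr x
  obtain ⟨U₂, h₂, a₂, e₂⟩ := exists_secHom hr y
  obtain ⟨U₃, h₃, a₃, e₃⟩ := exists_secHom hr z
  have aux : ∀ {U : Opens B} (a : secObj B U ⟶ G.X) (b b' : U), b.1 = b'.1 →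
      overApply a b = overApply a b' := fun a b b' h => congrArg _ (Subtype.ext h)
  refine ⟨U₁ ⊓ U₂ ⊓ U₃, ⟨proj G.X.hom y, ⟨hxy ▸ h₁, h₂⟩, hyz ▸ h₃⟩,
    secRes (inf_le_left.trans inf_le_left) ≫ a₁, secRes (inf_le_left.trans inf_le_right) ≫ a₂,
    secRes inf_le_right ≫ a₃, ?_, ?_, ?_⟩
  · exact (aux a₁ _ _ hxy.symm).trans e₁
  · exact e₂
  · exact (aux a₃ _ _ hyz).trans e₃

variable {G}

theorem proj_mulPt {x y : G.X.left} (h : proj G.X.hom x = proj G.X.hom y) :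
    proj G.X.hom (mulPt G x y) = proj G.X.hom x := by
  obtain ⟨U, b, a₁, a₂, -, rfl, rfl, -⟩ := exists_secHom₃ G h rfl
  rw [← overApply_mulElem_sec]
  exact (proj_overApply (G.mulElem a₁ a₂) b).trans (proj_overApply a₁ b).symm

omit [Nonempty B] in
theorem proj_invPt (x : G.X.left) : proj G.X.hom (invPt G x) = proj G.X.hom x :=
  proj_overApply G.inv x

theorem mulPt_assoc {x y z : G.X.left} (hxy : proj G.X.hom x = proj G.X.hom y)
    (hyz : proj G.X.hom y = proj G.X.hom z) :
    mulPt G (mulPt G x y) z = mulPt G x (mulPt G y z) := by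
  obtain ⟨U, b, a₁, a₂, a₃, rfl, rfl, rfl⟩ := exists_secHom₃ G hxy hyz
  simp only [← overApply_mulElem_sec]
  exact congrArg (fun k => overApply k b) (G.mul_assoc a₁ a₂ a₃)

theorem unitPt_mulPt {b : B} {x : G.X.left} (h : proj G.X.hom x = b) :
    mulPt G (unitPt G b) x = x := by
  obtain ⟨U, c, a, -, -, rfl, -, -⟩ := exists_secHom₃ G (rfl : proj G.X.hom x = _) rfl
  have hb : unitPt G b = overApply (G.oneElem (secObj B U)) c := by
    rw [← h]
    refine Eq.trans ?_ (overApply_oneElem G (Z := secObj B U) c).symm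
    exact congrArg (unitPt G) (proj_overApply a c)
  rw [hb, ← overApply_mulElem_sec]
  exact congrArg (fun k => overApply k c) (G.one_mul a)

theorem invPt_mulPt (x : G.X.left) : mulPt G (invPt G x) x = unitPt G (proj G.X.hom x) := by
  obtain ⟨U, c, a, -, -, rfl, -, -⟩ := exists_secHom₃ G (rfl : proj G.X.hom x = _) rfl
  have h := overApply_mulElem_sec G (a ≫ G.inv) a c
  refine h.symm.trans ?_
  refine (congrArg (fun k => overApply k c) (G.inv_mul a)).trans ?_
  refine (overApply_oneElem G (Z := secObj B U) c).trans ?_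
  exact congrArg (unitPt G) (proj_overApply a c).symm

theorem mulPt_invPt (x : G.X.left) : mulPt G x (invPt G x) = unitPt G (proj G.X.hom x) := by
  obtain ⟨U, c, a, -, -, rfl, -, -⟩ := exists_secHom₃ G (rfl : proj G.X.hom x = _) rfl
  have h := overApply_mulElem_sec G a (a ≫ G.inv) c
  refine h.symm.trans ?_
  refine (congrArg (fun k => overApply k c) (G.mul_inv a)).trans ?_
  refine (overApply_oneElem G (Z := secObj B U) c).trans ?_
  exact congrArg (unitPt G) (proj_overApply a c).symm

theorem horizontalAt_mulPt {s t : B → G.X.left} {U : Set B} (hU : IsOpen U)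
    (hs : ∀ b ∈ U, HorizontalAt G.X.hom s b) (ht : ∀ b ∈ U, HorizontalAt G.X.hom t b) :
    ∀ b ∈ U, HorizontalAt G.X.hom (fun b => mulPt G (s b) (t b)) b := by
  have hr := groupObject_rank G
  intro b hb
  let U' : Opens B := ⟨U, hU⟩
  let a : secObj B U' ⟶ G.X := secHom hr hs
  let a' : secObj B U' ⟶ G.X := secHom hr ht
  exact horizontalAt_of_secHom (G.mulElem a a') (fun b => (overApply_mulElem_sec G a a' b).symm) hb

theorem horizontalAt_invPt {s : B → G.X.left} {U : Set B} (hU : IsOpen U)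
    (hs : ∀ b ∈ U, HorizontalAt G.X.hom s b) :
    ∀ b ∈ U, HorizontalAt G.X.hom (fun b => invPt G (s b)) b := by
  have hr := groupObject_rank G
  intro b hb
  let U' : Opens B := ⟨U, hU⟩
  exact horizontalAt_of_secHom (U := U') (secHom hr hs ≫ G.inv) (fun b => rfl) hb

/-! ### Families -/

variable (B) in
/-- The trivial family over an open subset of the base, as an object over the base. -/
@[reducible] noncomputable def famObj (N : SmoothMfd.{u}) (U : Opens B) : OverFull B :=
  Over.mk ((binProduct (zero N) (full (B.opens U)) rfl).snd ≫ opensIncl B U)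

/-- The slice of a trivial family at a parameter. -/
noncomputable def famSlice (N : SmoothMfd.{u}) (U : Opens B) (n : N) :
    secObj B U ⟶ famObj B N U :=
  Over.homMk ((binProduct (zero N) (full (B.opens U)) rfl).lift
    { toFun := fun _ => n
      smooth := contMDiff_const
      map_fiber := fun b => by
        rw [mfderiv_const]
        exact Submodule.map_zero _ }
    (𝟙 _)) (by
      change _ ≫ (_ ≫ opensIncl B U) = opensIncl B U
      rw [← Category.assoc, BinProduct.lift_snd]
      exact Category.id_comp (opensIncl B U))

/-- Smooth families of horizontal sections are morphisms. -/
noncomputable def famHom {W : OverFull B} (hr : W.left.fol.rank = B.dim) (N : SmoothMfd.{u})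
    (U : Opens B) (σ : N → B → W.left)
    (hσ : ContMDiff (N.I.prod B.I) W.left.mfd.I ∞ (fun p : N × U => σ p.1 p.2))
    (hh : ∀ n, ∀ b ∈ U, HorizontalAt W.hom (σ n) b) : famObj B N U ⟶ W :=
  have h₂ : ∀ (p : N × U) (v : B.E), (mfderiv (N.I.prod B.I) W.left.mfd.I
      (fun p : N × U => σ p.1 p.2) p : N.E × B.E →L[ℝ] W.left.mfd.E) (0, v) ∈
      W.left.fol.fiberE (σ p.1 p.2) := fun p v => by
    have hsl : ContMDiff B.I (N.I.prod B.I) ∞ (fun b : U => ((p.1, b) : N × U)) :=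
      contMDiff_const.prodMk contMDiff_id
    have h := mfderiv_comp_apply p.2 (hσ.mdifferentiableAt (by simp) (x := p))
      (hsl.mdifferentiableAt (by simp) (x := p.2)) v
    have h' : mfderiv B.I (N.I.prod B.I) (fun b : U => ((p.1, b) : N × U)) p.2 v =
      ((0, v) : N.E × B.E) := mfderiv_slice N (B.opens U) p.1 p.2 v
    have h₃ := mfderiv_overApply_mem (secHom hr (hh p.1)) p.2 v trivial
    have h₄ := h.trans (congrArg (mfderiv (N.I.prod B.I) W.left.mfd.I
      (fun p : N × U => σ p.1 p.2) p : N.E × B.E →L[ℝ] W.left.mfd.E) h')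
    exact (congrArg (· ∈ W.left.fol.fiberE (σ p.1 p.2)) h₄).mp h₃
  overHom hr (famObj B N U) (fun p : N × U => σ p.1 p.2) hσ
    (fun p : N × U => (hh p.1 p.2 p.2.2).proj_eq) (by
      rintro p _ ⟨v, -, rfl⟩
      exact h₂ p v)

/-- Smooth families of horizontal sections are morphisms from `N × U` with distribution `0 × TU`.
Their product is again a morphism, hence smooth, and on each slice it is the pointwise product. -/
theorem contMDiff_mulPt_family (N : SmoothMfd.{u}) (U : Opens B) {σ σ' : N → B → G.X.left}
    (hσ : ContMDiff (N.I.prod B.I) G.X.left.mfd.I ∞ (fun p : N × U => σ p.1 p.2))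
    (hh : ∀ n, ∀ b ∈ U, HorizontalAt G.X.hom (σ n) b)
    (hσ' : ContMDiff (N.I.prod B.I) G.X.left.mfd.I ∞ (fun p : N × U => σ' p.1 p.2))
    (hh' : ∀ n, ∀ b ∈ U, HorizontalAt G.X.hom (σ' n) b) :
    ContMDiff (N.I.prod B.I) G.X.left.mfd.I ∞
      (fun p : N × U => mulPt G (σ p.1 p.2) (σ' p.1 p.2)) := by
  have hr := groupObject_rank G
  have h : ContMDiff (N.I.prod B.I) G.X.left.mfd.I ∞ (fun p : N × U =>
      overApply (G.mulElem (famHom hr N U σ hσ hh) (famHom hr N U σ' hσ' hh')) p) :=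
    contMDiff_overApply (G.mulElem (famHom hr N U σ hσ hh) (famHom hr N U σ' hσ' hh'))
  have e : (fun p : N × U => mulPt G (σ p.1 p.2) (σ' p.1 p.2)) = fun p : N × U =>
      overApply (G.mulElem (famHom hr N U σ hσ hh) (famHom hr N U σ' hσ' hh')) p :=
    funext fun p => (overApply_mulElem G (famHom hr N U σ hσ hh) (famHom hr N U σ' hσ' hh')
      (famSlice N U p.1) p.2).symm
  rw [e]
  exact h

end PointwiseGroup

end FMn

theorem SmoothMfd.locallyPathConnectedSpace (M : SmoothMfd.{u}) :
    LocallyPathConnectedSpace M := by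
  have h : LocallyPathConnectedSpace M.H :=
    M.I.toHomeomorph.isOpenEmbedding.locallyPathConnectedSpace
  exact ChartedSpace.locallyPathConnectedSpace M.H M

/-! ### Monodromy for horizontal sections. -/

namespace FMn

section GlobalSections

open scoped Topology
open Filter TopologicalSpace

/-- Monodromy for horizontal sections over an open subset of the base that is parametrized by a
simply connected space. -/
theorem exists_horizontal_of_local {X : FMn.{u}} {B : SmoothMfd.{u}} {q : X ⟶ full B}
    (hr : X.fol.rank = B.dim) {A : Type*} [TopologicalSpace A] [SimplyConnectedSpace A]
    [LocallyPathConnectedSpace A] {χ : A → B} (hχ : Topology.IsOpenEmbedding χ) {P : Set X}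
    (hP : ∀ x ∈ P, proj q x ∈ Set.range χ)
    (hext : ∀ a, ∃ U : Set B, IsOpen U ∧ _root_.IsPreconnected U ∧ χ a ∈ U ∧ U ⊆ Set.range χ ∧
      ∀ x ∈ P, proj q x ∈ U → ∃ s : B → X, (∀ b ∈ U, HorizontalAt q s b ∧ s b ∈ P) ∧
        s (proj q x) = x) {x : X} (hx : x ∈ P) :
    ∃ s : B → X, (∀ b ∈ Set.range χ, HorizontalAt q s b) ∧ s (proj q x) = x := by
  classical
  choose! r hr' using hP
  let q' : P → A := fun y => r y.1
  have hq' : ∀ y : P, χ (q' y) = proj q y.1 := fun y => hr' y.1 y.2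
  -- Horizontal sections that stay in `P`, pulled back along the parametrization.
  let S : Set A → (A → P) → Prop := fun V s => IsOpen V ∧ ∃ s₀ : B → X,
    (∀ a ∈ V, HorizontalAt q s₀ (χ a)) ∧ ∀ a ∈ V, (s a).1 = s₀ (χ a)
  have hS : SectionSystem q' S :=
    { isOpen := fun h => h.1
      mono := fun h hV ho => by
        obtain ⟨s₀, h₁, h₂⟩ := h.2
        exact ⟨ho, s₀, fun a ha => h₁ a (hV ha), fun a ha => h₂ a (hV ha)⟩
      proj := fun {U s} h b hb => by
        obtain ⟨s₀, h₁, h₂⟩ := h.2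
        apply hχ.injective
        rw [hq', h₂ b hb, (h₁ b hb).proj_eq]
      unique := fun {U s t} hU hs ht b hb e b' hb' => by
        obtain ⟨s₀, h₁, h₂⟩ := hs.2
        obtain ⟨t₀, h₃, h₄⟩ := ht.2
        have := HorizontalAt.eqOn hr (hχ.isOpenMap U hs.1) (hU.image χ hχ.continuous.continuousOn)
          (s := s₀) (t := t₀) (by rintro _ ⟨a, ha, rfl⟩; exact h₁ a ha)
          (by rintro _ ⟨a, ha, rfl⟩; exact h₃ a ha) (Set.mem_image_of_mem χ hb)
          (by rw [← h₂ b hb, ← h₄ b hb, e]) (χ b') (Set.mem_image_of_mem χ hb')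
        apply Subtype.ext
        rw [h₂ b' hb', h₄ b' hb', this] }
  obtain ⟨s, hs, hloc⟩ := hS.exists_global (fun a => by
    obtain ⟨U, hUo, hUc, haU, hUr, hU⟩ := hext a
    refine ⟨χ ⁻¹' U, hUo.preimage hχ.continuous, ?_, haU, fun y hy => ?_⟩
    · rw [← hχ.toIsInducing.isPreconnected_image, Set.image_preimage_eq_inter_range,
        Set.inter_eq_left.2 hUr]
      exact hUc
    · have hyU : proj q y.1 ∈ U := by rw [← hq']; exact hy
      obtain ⟨s₀, h₁, h₂⟩ := hU y.1 y.2 hyU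
      refine ⟨fun a => if h : χ a ∈ U then ⟨s₀ (χ a), (h₁ _ h).2⟩ else y,
        ⟨hUo.preimage hχ.continuous, s₀, fun a ha => (h₁ _ ha).1, fun a ha => ?_⟩, ?_⟩
      · exact congrArg Subtype.val (dif_pos (show χ a ∈ U from ha))
      · refine (dif_pos (show χ (q' y) ∈ U from hy)).trans (Subtype.ext ?_)
        change s₀ (χ (q' y)) = y.1
        rw [hq', h₂]) ⟨x, hx⟩
  have hA : Nonempty A := ⟨q' ⟨x, hx⟩⟩
  have hinv : ∀ a, Function.invFun χ (χ a) = a := Function.leftInverse_invFun hχ.injective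
  refine ⟨fun b => (s (Function.invFun χ b)).1, ?_, ?_⟩
  · rintro _ ⟨a, rfl⟩
    obtain ⟨V, t, haV, ⟨hVo, t₀, h₁, h₂⟩, h₃⟩ := hloc a
    refine (h₁ a haV).congr ?_
    filter_upwards [(hχ.isOpenMap V hVo).mem_nhds (Set.mem_image_of_mem χ haV)]
    rintro _ ⟨a', ha', rfl⟩
    rw [hinv, h₃ a' ha', h₂ a' ha']
  · change (s (Function.invFun χ (proj q x))).1 = x
    rw [← hq' ⟨x, hx⟩, hinv, hs]

/-- Each neighborhood contains a neighborhood that is parametrized by a simply connected space. -/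
theorem exists_simplyConnected_chart (B : SmoothMfd.{u}) {b : B} {O : Set B} (hO : O ∈ 𝓝 b) :
    ∃ (A : Type u) (_ : TopologicalSpace A) (_ : SimplyConnectedSpace A)
      (_ : LocallyPathConnectedSpace A) (χ : A → B), Topology.IsOpenEmbedding χ ∧ b ∈ Set.range χ ∧
        Set.range χ ⊆ O := by
  set ψ := extChartAt B.I b
  have hc : ContinuousAt ψ.symm (ψ b) := continuousAt_extChartAt_symm (I := B.I) b
  have hO' : O ∈ 𝓝 (ψ.symm (ψ b)) := by rwa [extChartAt_to_inv]
  obtain ⟨ε, hε, hball⟩ := Metric.mem_nhds_iff.1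
    (inter_mem (extChartAt_target_mem_nhds (I := B.I) b) (hc.preimage_mem_nhds hO'))
  have hcb : ContractibleSpace (Metric.ball (ψ b) ε) :=
    Metric.contractibleSpace_ball hε
  have hl : LocallyPathConnectedSpace (Metric.ball (ψ b) ε) :=
    (convex_ball (ψ b) ε).locallyPathConnectedSpace
  refine ⟨Metric.ball (ψ b) ε, inferInstance, inferInstance, hl, fun v => ψ.symm v.1, ?_, ?_, ?_⟩
  · refine Topology.IsOpenEmbedding.of_continuous_injective_isOpenMap ?_ ?_ ?_
    · exact ((continuousOn_extChartAt_symm (I := B.I) b).mono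
        (fun v hv => (hball hv).1)).domRestrict
    · exact fun v w h => Subtype.ext (ψ.symm.injOn (hball v.2).1 (hball w.2).1 h)
    · intro V hV
      have hV' : IsOpen (Subtype.val '' V) := Metric.isOpen_ball.isOpenMap_subtype_val V hV
      have : (fun v : Metric.ball (ψ b) ε => ψ.symm v.1) '' V =
          ψ.source ∩ ψ ⁻¹' (Subtype.val '' V) := by
        ext c
        constructor
        · rintro ⟨v, hv, rfl⟩
          refine ⟨ψ.map_target (hball v.2).1, v, hv, (ψ.right_inv (hball v.2).1).symm⟩
        · rintro ⟨hc, v, hv, e⟩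
          refine ⟨v, hv, ?_⟩
          change ψ.symm v.1 = c
          rw [e, ψ.left_inv hc]
      rw [this]
      exact (continuousOn_extChartAt (I := B.I) b).isOpen_inter_preimage
        (isOpen_extChartAt_source b) hV'
  · exact ⟨⟨ψ b, Metric.mem_ball_self hε⟩, extChartAt_to_inv (I := B.I) b⟩
  · rintro _ ⟨v, rfl⟩
    exact (hball v.2).2

end GlobalSections

end FMn

/-! ### Extension of sections by means of the group structure. -/

namespace FMn

section GlobalSections

open scoped Topology
open Filter TopologicalSpace

/-- The point `x` lies on a horizontal section over `U`. -/
def OnSection {X : FMn.{u}} {B : SmoothMfd.{u}} (q : X ⟶ full B) (U : Set B) (x : X) : Prop :=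
  ∃ s : B → X, (∀ b ∈ U, HorizontalAt q s b) ∧ s (proj q x) = x

theorem OnSection.mono {X : FMn.{u}} {B : SmoothMfd.{u}} {q : X ⟶ full B} {U V : Set B} {x : X}
    (h : OnSection q U x) (hV : V ⊆ U) : OnSection q V x :=
  let ⟨s, hs, hx⟩ := h
  ⟨s, fun b hb => hs b (hV hb), hx⟩

variable {B : SmoothMfd.{u}} [Nonempty B] {G : GroupObject (OverFull B)}

variable (G) in
/-- A neighborhood of a unit is covered by sections over a common open set. -/
theorem exists_unit_nhd (b₀ : B) : ∃ (U : Set B) (W : Set G.X.left), IsOpen U ∧ IsOpen W ∧ b₀ ∈ U ∧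
    (∀ b ∈ U, unitPt G b ∈ W) ∧ ∀ w ∈ W, OnSection G.X.hom U w := by
  have hr := groupObject_rank G
  have hc := ((horizontalAt_unitPt G b₀).contMDiffAt).continuousAt
  obtain ⟨τ, hτ, hτ'⟩ := exists_localTransport G.X.hom hr (unitPt G b₀)
  rw [proj_unitPt, nhds_prod_eq] at hτ
  obtain ⟨P₁, h₁, P₂, h₂, H⟩ := eventually_prod_iff.1 hτ
  obtain ⟨W, hW, hWo, hW₀⟩ := eventually_nhds_iff.1 (h₁.and hτ')
  obtain ⟨U, hU, hUo, hb⟩ := eventually_nhds_iff.1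
    (h₂.and (hc.eventually (hWo.mem_nhds hW₀)))
  refine ⟨U, W, hUo, hWo, hb, fun b hb => (hU b hb).2, fun w hw => ?_⟩
  exact ⟨fun b => τ (w, b), fun b hb => (H (hW w hw).1 (hU b hb).1).2, (hW w hw).2⟩

/-- If `σ` extends `s₁` over `U`, and `t` extends `s₁⁻¹ s₂` over `U`, then `σ t` is horizontal over
`U` and agrees with `s₂` at `b₁`, hence on the connected set `V`. -/
theorem OnSection.transfer {U V : Set B} {W : Set G.X.left} (hU : IsOpen U)
    (hW : ∀ w ∈ W, OnSection G.X.hom U w) (hV : IsOpen V) (hVc : _root_.IsPreconnected V)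
    (hVU : V ⊆ U) {s₁ s₂ : B → G.X.left} (h₁ : ∀ b ∈ V, HorizontalAt G.X.hom s₁ b)
    (h₂ : ∀ b ∈ V, HorizontalAt G.X.hom s₂ b) {b₁ : B} (hb₁ : b₁ ∈ V)
    (hd : mulPt G (invPt G (s₁ b₁)) (s₂ b₁) ∈ W) {b b' : B} (hb : b ∈ V) (hb' : b' ∈ V)
    (h : OnSection G.X.hom U (s₁ b)) : OnSection G.X.hom U (s₂ b') := by
  have hr := groupObject_rank G
  obtain ⟨σ, hσ, hσb⟩ := h
  rw [(h₁ b hb).proj_eq] at hσb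
  have hσ₁ := HorizontalAt.eqOn hr hV hVc (fun b hb => hσ b (hVU hb)) h₁ hb hσb b₁ hb₁
  obtain ⟨t, ht, htb⟩ := hW _ hd
  have hp₁ := (h₁ b₁ hb₁).proj_eq
  have hp₂ := (h₂ b₁ hb₁).proj_eq
  have hpi : proj G.X.hom (invPt G (s₁ b₁)) = b₁ := (proj_invPt _).trans hp₁
  rw [(proj_mulPt (hpi.trans hp₂.symm)).trans hpi] at htb
  have hm := horizontalAt_mulPt hU hσ ht
  have e : mulPt G (σ b₁) (t b₁) = s₂ b₁ := by
    rw [hσ₁, htb, ← mulPt_assoc (hp₁.trans hpi.symm) (hpi.trans hp₂.symm), mulPt_invPt, hp₁,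
      unitPt_mulPt hp₂]
  refine ⟨_, hm, ?_⟩
  rw [(h₂ b' hb').proj_eq]
  exact HorizontalAt.eqOn hr hV hVc (fun b hb => hm b (hVU hb)) h₂ hb₁ e b' hb'

/-- Smooth families of horizontal sections can be multiplied. -/
theorem contMDiff_mulPt_slice {N : SmoothMfd.{u}} {U : Set B} (hU : IsOpen U)
    {σ σ' : N → B → G.X.left}
    (hσ : ∀ n, ∀ b ∈ U, ContMDiffAt (N.I.prod B.I) G.X.left.mfd.I ∞
      (fun p : N × B => σ p.1 p.2) (n, b))
    (hh : ∀ n, ∀ b ∈ U, HorizontalAt G.X.hom (σ n) b)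
    (hσ' : ∀ n, ∀ b ∈ U, ContMDiffAt (N.I.prod B.I) G.X.left.mfd.I ∞
      (fun p : N × B => σ' p.1 p.2) (n, b))
    (hh' : ∀ n, ∀ b ∈ U, HorizontalAt G.X.hom (σ' n) b) {b₀ : B} (hb₀ : b₀ ∈ U) :
    ContMDiff N.I G.X.left.mfd.I ∞ (fun n => mulPt G (σ n b₀) (σ' n b₀)) := by
  let U' : Opens B := ⟨U, hU⟩
  have hi : ContMDiff (N.I.prod B.I) (N.I.prod B.I) ∞ (fun p : N × U' => ((p.1, p.2.1) : N × B)) :=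
    contMDiff_fst.prodMk
      ((contMDiff_subtype_val (n := ∞) (I := B.I) (U := U')).comp contMDiff_snd)
  have h := contMDiff_mulPt_family (G := G) N U'
    (fun p => ContMDiffAt.comp (f := fun p : N × U' => ((p.1, p.2.1) : N × B)) p
      (hσ p.1 p.2.1 p.2.2) hi.contMDiffAt) hh
    (fun p => ContMDiffAt.comp (f := fun p : N × U' => ((p.1, p.2.1) : N × B)) p
      (hσ' p.1 p.2.1 p.2.2) hi.contMDiffAt) hh'
  have hs : ContMDiff N.I (N.I.prod B.I) ∞ (fun n : N => ((n, ⟨b₀, hb₀⟩) : N × U')) :=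
    contMDiff_id.prodMk contMDiff_const
  exact h.comp hs

/-- Local parallel transport is defined only for initial points in an open set `O`; the family is
restricted to the open submanifold `O`. -/
theorem continuousAt_mulPt_slice {N : SmoothMfd.{u}} {O : Set N} (hO : IsOpen O) {U : Set B}
    (hU : IsOpen U) {σ σ' : N → B → G.X.left}
    (hσ : ∀ n ∈ O, ∀ b ∈ U, ContMDiffAt (N.I.prod B.I) G.X.left.mfd.I ∞
      (fun p : N × B => σ p.1 p.2) (n, b))
    (hh : ∀ n ∈ O, ∀ b ∈ U, HorizontalAt G.X.hom (σ n) b)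
    (hσ' : ∀ n ∈ O, ∀ b ∈ U, ContMDiffAt (N.I.prod B.I) G.X.left.mfd.I ∞
      (fun p : N × B => σ' p.1 p.2) (n, b))
    (hh' : ∀ n ∈ O, ∀ b ∈ U, HorizontalAt G.X.hom (σ' n) b) {n₀ : N} (hn₀ : n₀ ∈ O) {b₀ : B}
    (hb₀ : b₀ ∈ U) : ContinuousAt (fun n => mulPt G (σ n b₀) (σ' n b₀)) n₀ := by
  obtain ⟨N', j, hj, hjO, hjr⟩ : ∃ (N' : SmoothMfd.{u}) (j : N' → N),
      ContMDiff N'.I N.I ∞ j ∧ Topology.IsOpenEmbedding j ∧ Set.range j = O :=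
    ⟨N.opens ⟨O, hO⟩, Subtype.val,
      (contMDiff_subtype_val (n := ∞) (I := N.I) (U := (⟨O, hO⟩ : Opens N))),
      hO.isOpenEmbedding_subtypeVal, Subtype.range_coe⟩
  subst hjr
  obtain ⟨n₁, rfl⟩ := hn₀
  have hi : ContMDiff (N'.I.prod B.I) (N.I.prod B.I) ∞
      (fun p : N' × B => ((j p.1, p.2) : N × B)) := (hj.comp contMDiff_fst).prodMk contMDiff_snd
  have h := contMDiff_mulPt_slice (G := G) hU (σ := fun n => σ (j n)) (σ' := fun n => σ' (j n))
    (fun n b hb => ContMDiffAt.comp (f := fun p : N' × B => ((j p.1, p.2) : N × B)) (n, b)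
      (hσ (j n) ⟨n, rfl⟩ b hb) hi.contMDiffAt) (fun n => hh (j n) ⟨n, rfl⟩)
    (fun n b hb => ContMDiffAt.comp (f := fun p : N' × B => ((j p.1, p.2) : N × B)) (n, b)
      (hσ' (j n) ⟨n, rfl⟩ b hb) hi.contMDiffAt) (fun n => hh' (j n) ⟨n, rfl⟩) hb₀
  exact hjO.continuousAt_iff.1 h.continuous.continuousAt

/-- The sections `s` through `x` and `s'` through a nearby `x'` have a common domain `V`. At the
projection of `x` the products `s⁻¹ s'` and `s'⁻¹ s` depend continuously on `x'` and are the unit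
for `x' = x`, so both lie in `W` and `OnSection.transfer` works in both directions. -/
theorem OnSection.eventually_iff {U : Set B} {W : Set G.X.left} (hU : IsOpen U) (hWo : IsOpen W)
    (hUW : ∀ b ∈ U, unitPt G b ∈ W) (hW : ∀ w ∈ W, OnSection G.X.hom U w) {x : G.X.left}
    (hx : proj G.X.hom x ∈ U) :
    ∀ᶠ x' in 𝓝 x, (OnSection G.X.hom U x ↔ OnSection G.X.hom U x') := by
  have hr := groupObject_rank G
  have hlc : LocallyPathConnectedSpace B := B.locallyPathConnectedSpace
  obtain ⟨τ, hτ, hτ'⟩ := exists_localTransport G.X.hom hr x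
  rw [nhds_prod_eq] at hτ
  obtain ⟨P₁, h₁, P₂, h₂, H⟩ := eventually_prod_iff.1 hτ
  obtain ⟨V, hVs, hVo, hxV, hVc⟩ := locallyConnectedSpace_iff_subsets_isOpen_isConnected.1
    inferInstance (proj G.X.hom x) _ (inter_mem h₂ (hU.mem_nhds hx))
  have hq := (contMDiff_proj G.X.hom).continuous
  obtain ⟨O, hO, hOo, hxO⟩ := eventually_nhds_iff.1 (Filter.Eventually.and (h₁.and hτ')
    (hq.continuousAt.preimage_mem_nhds (hVo.mem_nhds hxV)))
  have hsm : ∀ n ∈ O, ∀ b ∈ V, ContMDiffAt (G.X.left.mfd.I.prod B.I) G.X.left.mfd.I ∞ τ (n, b) :=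
    fun n hn b hb => (H (hO n hn).1.1 (hVs hb).1).1
  have hho : ∀ n ∈ O, ∀ b ∈ V, HorizontalAt G.X.hom (fun b => τ (n, b)) b :=
    fun n hn b hb => (H (hO n hn).1.1 (hVs hb).1).2
  have hsx : ∀ n ∈ O, ∀ b ∈ V, ContMDiffAt (G.X.left.mfd.I.prod B.I) G.X.left.mfd.I ∞
      (fun p : G.X.left × B => τ (x, p.2)) (n, b) := fun n hn b hb =>
    ContMDiffAt.comp (f := fun p : G.X.left × B => (x, p.2)) (n, b) (hsm x hxO b hb)
      (contMDiffAt_const.prodMk contMDiffAt_snd)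
  have hinv : ∀ {σ : G.X.left → B → G.X.left}, (∀ n ∈ O, ∀ b ∈ V,
      ContMDiffAt (G.X.left.mfd.I.prod B.I) G.X.left.mfd.I ∞
        (fun p : G.X.left × B => σ p.1 p.2) (n, b)) → ∀ n ∈ O, ∀ b ∈ V,
      ContMDiffAt (G.X.left.mfd.I.prod B.I) G.X.left.mfd.I ∞
        (fun p : G.X.left × B => invPt G (σ p.1 p.2)) (n, b) := fun {σ} h n hn b hb =>
    ContMDiffAt.comp (f := fun p : G.X.left × B => σ p.1 p.2) (n, b)
      (contMDiff_overApply G.inv).contMDiffAt (h n hn b hb)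
  have hval : mulPt G (invPt G (τ (x, proj G.X.hom x))) (τ (x, proj G.X.hom x)) ∈ W := by
    rw [invPt_mulPt]
    refine hUW _ ?_
    rwa [(hho x hxO _ hxV).proj_eq]
  have c₁ := continuousAt_mulPt_slice hOo hVo (σ := fun _ b => invPt G (τ (x, b)))
    (σ' := fun n b => τ (n, b)) (hinv (σ := fun _ b => τ (x, b)) hsx)
    (fun n hn => horizontalAt_invPt hVo (hho x hxO)) hsm hho hxO hxV
  have c₂ := continuousAt_mulPt_slice hOo hVo (σ := fun n b => invPt G (τ (n, b)))
    (σ' := fun _ b => τ (x, b)) (hinv (σ := fun n b => τ (n, b)) hsm)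
    (fun n hn => horizontalAt_invPt hVo (hho n hn)) hsx (fun n hn => hho x hxO) hxO hxV
  filter_upwards [hOo.mem_nhds hxO, c₁.eventually (hWo.mem_nhds hval),
    c₂.eventually (hWo.mem_nhds hval)] with x' hx' h₃ h₄
  have hVU : V ⊆ U := fun b hb => (hVs hb).2
  have e₁ : τ (x, proj G.X.hom x) = x := (hO x hxO).1.2
  have e₂ : τ (x', proj G.X.hom x') = x' := (hO x' hx').1.2
  constructor
  · intro h
    have := OnSection.transfer hU hW hVo hVc.isPreconnected hVU (hho x hxO) (hho x' hx') hxV h₃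
      hxV (hO x' hx').2 (by rw [e₁]; exact h)
    rwa [e₂] at this
  · intro h
    have := OnSection.transfer hU hW hVo hVc.isPreconnected hVU (hho x' hx') (hho x hxO) hxV h₄
      (hO x' hx').2 hxV (by rw [e₂]; exact h)
    rwa [e₁] at this

theorem OnSection.of_preconnected {U : Set B} {W : Set G.X.left} (hU : IsOpen U) (hWo : IsOpen W)
    (hUW : ∀ b ∈ U, unitPt G b ∈ W) (hW : ∀ w ∈ W, OnSection G.X.hom U w) {C : Set G.X.left}
    (hC : _root_.IsPreconnected C) (hCU : ∀ x ∈ C, proj G.X.hom x ∈ U) {x y : G.X.left}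
    (hx : x ∈ C) (hy : y ∈ C) (h : OnSection G.X.hom U x) : OnSection G.X.hom U y :=
  (hC.induction₂ (fun x y => OnSection G.X.hom U x ↔ OnSection G.X.hom U y)
    (fun x hx => mem_nhdsWithin_of_mem_nhds
      (OnSection.eventually_iff hU hWo hUW hW (hCU x hx)))
    (fun _ _ _ _ _ _ h₁ h₂ => h₁.trans h₂) (fun _ _ _ _ h => h.symm) hx hy).1 h

end GlobalSections

end FMn

/-! ### Global horizontal sections. -/

namespace FMn

section GlobalExtension

open scoped Topology
open Filter TopologicalSpace

variable {B : SmoothMfd.{u}} [Nonempty B] {G : GroupObject (OverFull B)}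

/-- Uniform local extension of horizontal sections in a component of the typical fiber. -/
theorem exists_section_component {F : Type u} [TopologicalSpace F]
    (e : Bundle.Trivialization F (proj G.X.hom)) {b : B} {O : Set B} (hO : IsOpen O) (hb : b ∈ O)
    (hOe : O ⊆ e.baseSet) (f : F) :
    ∃ U : Set B, IsOpen U ∧ _root_.IsPreconnected U ∧ b ∈ U ∧ U ⊆ O ∧
      ∀ x, proj G.X.hom x ∈ U → (e x).2 ∈ connectedComponent f → ∃ s : B → G.X.left,
        (∀ b ∈ U, HorizontalAt G.X.hom s b ∧ (e (s b)).2 ∈ connectedComponent f) ∧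
          s (proj G.X.hom x) = x := by
  have hr := groupObject_rank G
  have hlc : LocallyPathConnectedSpace B := B.locallyPathConnectedSpace
  obtain ⟨U₀, W, hU₀, hW, hbU₀, hUW, hWU⟩ := exists_unit_nhd G b
  set x₀ := e.toOpenPartialHomeomorph.symm (b, f) with hx₀
  have hpx₀ : proj G.X.hom x₀ = b := e.proj_symm_apply' (hOe hb)
  obtain ⟨τ, hτ, hτ'⟩ := exists_localTransport G.X.hom hr x₀
  rw [hpx₀] at hτ
  have hc : ContinuousAt (fun b : B => (x₀, b)) b := by fun_prop
  obtain ⟨U, hUs, hUo, hbU, hUc⟩ := locallyConnectedSpace_iff_subsets_isOpen_isConnected.1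
    inferInstance b _ (inter_mem (hc.eventually hτ) (inter_mem (hU₀.mem_nhds hbU₀)
      (hO.mem_nhds hb)))
  have hUO : U ⊆ O := fun b hb => (hUs hb).2.2
  have hUU₀ : U ⊆ U₀ := fun b hb => (hUs hb).2.1
  refine ⟨U, hUo, hUc.isPreconnected, hbU, hUO, fun x hx hxf => ?_⟩
  -- This set is connected and contains `x` as well as `x₀`, which lies on a section over `U` by
  -- local transport. Hence `U` serves all points of the component at once.
  let C : Set G.X.left := e.toOpenPartialHomeomorph.symm '' (U ×ˢ connectedComponent f)
  have hCs : U ×ˢ connectedComponent f ⊆ e.target := fun p hp => by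
    rw [e.mem_target]
    exact hOe (hUO hp.1)
  have hC : _root_.IsPreconnected C :=
    (hUc.isPreconnected.prod isPreconnected_connectedComponent).image _
      (e.continuousOn_invFun.mono hCs)
  have hCU : ∀ x ∈ C, proj G.X.hom x ∈ U := by
    rintro _ ⟨p, hp, rfl⟩
    rw [e.proj_symm_apply (hCs hp)]
    exact hp.1
  have hxe : x ∈ e.source := e.mem_source.2 (hOe (hUO hx))
  have hex : e x = (proj G.X.hom x, (e x).2) := Prod.ext (e.coe_fst hxe) rfl
  have hxC : x ∈ C := ⟨e x, by rw [hex]; exact ⟨hx, hxf⟩, e.left_inv hxe⟩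
  obtain ⟨s, hs, hsx⟩ := OnSection.of_preconnected hUo hW (fun b hb => hUW b (hUU₀ hb))
    (fun w hw => (hWU w hw).mono hUU₀) hC hCU
    (x := x₀) ⟨(b, f), ⟨hbU, mem_connectedComponent⟩, rfl⟩ hxC
    ⟨fun b => τ (x₀, b), fun b hb => (hUs hb).1.2, hτ'.self_of_nhds⟩
  refine ⟨s, fun b' hb' => ⟨hs b' hb', ?_⟩, hsx⟩
  -- The fiber coordinate of a section over the connected set `U` cannot leave its component.
  have hcont : ContinuousOn (fun b => (e (s b)).2) U := fun b hb =>
    (continuousAt_snd.comp (ContinuousAt.comp (e.continuousAt (e.mem_source.2 (by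
      rw [(hs b hb).proj_eq]; exact hOe (hUO hb))))
        (hs b hb).contMDiffAt.continuousAt)).continuousWithinAt
  have him := (hUc.isPreconnected.image _ hcont).subset_connectedComponent
    (x := (e x).2) ⟨_, hx, congrArg (fun y => (e y).2) hsx⟩
  rw [← connectedComponent_eq hxf] at him
  exact him ⟨b', hb', rfl⟩

/-- Over a simply connected base, each point of a group bundle with connection lies on a global
horizontal section. -/
theorem exists_global_section [SimplyConnectedSpace B] (hG : IsGroupBundle G) (x : G.X.left) :
    ∃ s : B → G.X.left, (∀ b, HorizontalAt G.X.hom s b) ∧ s (proj G.X.hom x) = x := by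
  have hr := groupObject_rank G
  have hlc : LocallyPathConnectedSpace B := B.locallyPathConnectedSpace
  -- Monodromy is used twice. The domains of `exists_section_component` depend on the component of
  -- the typical fiber, so the inner use works in one component and extends its sections over a
  -- simply connected chart. That chart no longer depends on the component, as the outer use over
  -- `B` requires.
  obtain ⟨s, hs, hsx⟩ := exists_horizontal_of_local (q := G.X.hom) hr (χ := (id : B → B))
    Topology.IsOpenEmbedding.id (P := Set.univ) (fun x _ => ⟨_, rfl⟩) (fun b => by
      obtain ⟨F, e', hb, -, -⟩ := hG b
      let e : Bundle.Trivialization F (proj G.X.hom) := e'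
      obtain ⟨A, _, _, _, χ, hχ, hbχ, hχe⟩ := exists_simplyConnected_chart B
        (e.open_baseSet.mem_nhds hb)
      refine ⟨Set.range χ, hχ.isOpen_range, isPreconnected_range hχ.continuous, hbχ,
        fun b _ => ⟨b, rfl⟩, fun x _ hx => ?_⟩
      obtain ⟨s, hs, hsx⟩ := exists_horizontal_of_local (q := G.X.hom) hr hχ
        (P := {y | proj G.X.hom y ∈ Set.range χ ∧ (e y).2 ∈ connectedComponent (e x).2})
        (fun y hy => hy.1) (fun a => by
          obtain ⟨U, hUo, hUc, haU, hUχ, H⟩ := exists_section_component e hχ.isOpen_range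
            (Set.mem_range_self a) hχe (e x).2
          refine ⟨U, hUo, hUc, haU, hUχ, fun y hy hyU => ?_⟩
          obtain ⟨s, hs, hsy⟩ := H y hyU hy.2
          exact ⟨s, fun b hb => ⟨(hs b hb).1, by rw [(hs b hb).1.proj_eq]; exact hUχ hb,
            (hs b hb).2⟩, hsy⟩) (x := x) ⟨hx, mem_connectedComponent⟩
      exact ⟨s, fun b hb => ⟨hs b hb, trivial⟩, hsx⟩) (Set.mem_univ x)
  exact ⟨s, fun b => hs b ⟨b, rfl⟩, hsx⟩

end GlobalExtension

end FMn

/-! ### Global parallel transport and flat trivialization. -/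

namespace FMn

section Transport

open scoped Topology
open Filter TopologicalSpace

variable {X : FMn.{u}} {B : SmoothMfd.{u}} {q : X ⟶ full B}

/-- Global parallel transport depends smoothly on the initial point and the end point. -/
theorem contMDiff_transport [ConnectedSpace B] (hr : X.fol.rank = B.dim) {T : X → B → X}
    (hT : ∀ x b, HorizontalAt q (T x) b) (hTx : ∀ x, T x (proj q x) = x) :
    ContMDiff (X.mfd.I.prod B.I) X.mfd.I ∞ (fun p : X × B => T p.1 p.2) := by
  have hlc : LocallyPathConnectedSpace B := B.locallyPathConnectedSpace
  let T' : X × B → X := fun p => T p.1 p.2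
  -- For fixed `x`, smoothness near `(x, b)` holds at `b = q x` and is locally constant in `b`,
  -- hence holds on all of the connected base.
  let S : X → B → Prop := fun x b =>
    ∀ᶠ p in 𝓝 (x, b), ContMDiffAt (X.mfd.I.prod B.I) X.mfd.I ∞ T' p
  have huniq : ∀ {V : Set B} (_ : IsOpen V) (_ : _root_.IsPreconnected V) {s t : B → X}
      (_ : ∀ b ∈ V, HorizontalAt q s b) (_ : ∀ b ∈ V, HorizontalAt q t b) {b₁}, b₁ ∈ V →
      s b₁ = t b₁ → ∀ b ∈ V, s b = t b := fun hV hVc _ _ hs ht _ hb h =>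
    HorizontalAt.eqOn hr hV hVc hs ht hb h
  have box : ∀ x b, ∃ (O : Set X) (V : Set B) (τ : X × B → X), IsOpen O ∧ IsOpen V ∧
      _root_.IsPreconnected V ∧ T x b ∈ O ∧ b ∈ V ∧ (∀ y ∈ O, τ (y, proj q y) = y) ∧
      ∀ y ∈ O, ∀ c ∈ V, ContMDiffAt (X.mfd.I.prod B.I) X.mfd.I ∞ τ (y, c) ∧
        HorizontalAt q (fun c => τ (y, c)) c := by
    intro x b
    obtain ⟨τ, hτ, hτ'⟩ := exists_localTransport q hr (T x b)
    rw [(hT x b).proj_eq, nhds_prod_eq] at hτ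
    obtain ⟨P₁, h₁, P₂, h₂, H⟩ := eventually_prod_iff.1 hτ
    obtain ⟨V, hVs, hVo, hbV, hVc⟩ := locallyConnectedSpace_iff_subsets_isOpen_isConnected.1
      inferInstance b _ h₂
    obtain ⟨O, hO, hOo, hxO⟩ := eventually_nhds_iff.1 (h₁.and hτ')
    exact ⟨O, V, τ, hOo, hVo, hVc.isPreconnected, hxO, hbV, fun y hy => (hO y hy).2,
      fun y hy c hc => H (hO y hy).1 (hVs hc)⟩
  -- Transport from `x` to `c` factors as transport from `x` to `b` followed by local transport from
  -- `b` to `c`.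
  have prop : ∀ {x : X} {O : Set X} {V : Set B} {τ : X × B → X} (_ : IsOpen O) (_ : IsOpen V)
      (_ : _root_.IsPreconnected V) (_ : ∀ y ∈ O, τ (y, proj q y) = y)
      (_ : ∀ y ∈ O, ∀ c ∈ V, ContMDiffAt (X.mfd.I.prod B.I) X.mfd.I ∞ τ (y, c) ∧
        HorizontalAt q (fun c => τ (y, c)) c) {b c : B}, b ∈ V → c ∈ V → T x b ∈ O → S x b →
        S x c := by
    intro x O V τ hO hV hVc hτ hτ' b c hb hc hbO hS
    have hsl : ∀ᶠ x' in 𝓝 x, ContMDiffAt X.mfd.I X.mfd.I ∞ (fun x => T x b) x' := by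
      have hcx : ContinuousAt (fun x' : X => (x', b)) x := by fun_prop
      filter_upwards [hcx.eventually hS] with x' hx'
      exact ContMDiffAt.comp (f := fun x' : X => (x', b)) x' hx'
        (contMDiffAt_id.prodMk contMDiffAt_const)
    have hev : ∀ᶠ p : X × B in 𝓝 (x, c), (ContMDiffAt X.mfd.I X.mfd.I ∞ (fun x => T x b) p.1 ∧
        T p.1 b ∈ O) ∧ p.2 ∈ V := by
      have h₁ := hsl.and (hsl.self_of_nhds.continuousAt.eventually (hO.mem_nhds hbO))
      exact ((continuousAt_fst (p := (x, c))).eventually h₁).and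
        ((continuousAt_snd (p := (x, c))).eventually (hV.mem_nhds hc))
    filter_upwards [hev.eventually_nhds] with p hp
    have hp₀ := hp.self_of_nhds
    have e : T' =ᶠ[𝓝 p] fun p => τ (T p.1 b, p.2) := by
      filter_upwards [hp] with p' hp'
      refine huniq hV hVc (fun c _ => hT p'.1 c) (fun c hc => (hτ' _ hp'.1.2 c hc).2) hb ?_
        p'.2 hp'.2
      have := hτ _ hp'.1.2
      rw [(hT p'.1 b).proj_eq] at this
      exact this.symm
    refine ContMDiffAt.congr_of_eventuallyEq ?_ e
    have h₁ : ContMDiffAt (X.mfd.I.prod B.I) X.mfd.I ∞ (fun p : X × B => T p.1 b) p :=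
      ContMDiffAt.comp (f := fun p : X × B => p.1) (g := fun x => T x b) p hp₀.1.1 contMDiffAt_fst
    exact ContMDiffAt.comp (f := fun p : X × B => (T p.1 b, p.2)) p
      (hτ' _ hp₀.1.2 p.2 hp₀.2).1 (h₁.prodMk contMDiffAt_snd)
  have base : ∀ x, S x (proj q x) := by
    intro x
    obtain ⟨O, V, τ, hO, hV, hVc, hxO, hbV, hτ, hτ'⟩ := box x (proj q x)
    rw [hTx] at hxO
    have hev : ∀ᶠ p : X × B in 𝓝 (x, proj q x), (p.1 ∈ O ∧ proj q p.1 ∈ V) ∧ p.2 ∈ V := by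
      have h₁ : ∀ᶠ x' in 𝓝 x, x' ∈ O ∧ proj q x' ∈ V := Filter.Eventually.and (hO.mem_nhds hxO)
        ((contMDiff_proj q).continuous.continuousAt.preimage_mem_nhds (hV.mem_nhds hbV))
      exact ((continuousAt_fst (p := (x, proj q x))).eventually h₁).and
        ((continuousAt_snd (p := (x, proj q x))).eventually (hV.mem_nhds hbV))
    filter_upwards [hev.eventually_nhds] with p hp
    have hp₀ := hp.self_of_nhds
    refine ContMDiffAt.congr_of_eventuallyEq (hτ' _ hp₀.1.1 _ hp₀.2).1 ?_
    filter_upwards [hp] with p' hp'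
    exact huniq hV hVc (fun c _ => hT p'.1 c) (fun c hc => (hτ' _ hp'.1.1 c hc).2) hp'.1.2
      ((hTx _).trans (hτ _ hp'.1.1).symm) p'.2 hp'.2
  intro p
  refine Eventually.self_of_nhds (p := fun p => ContMDiffAt (X.mfd.I.prod B.I) X.mfd.I ∞ T' p)
    (?_ : S p.1 p.2)
  refine (isPreconnected_univ.induction₂ (fun b c => S p.1 b ↔ S p.1 c) (fun b _ => ?_)
    (fun _ _ _ _ _ _ h₁ h₂ => h₁.trans h₂) (fun _ _ _ _ h => h.symm)
    (Set.mem_univ (proj q p.1)) (Set.mem_univ p.2)).1 (base p.1)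
  obtain ⟨O, V, τ, hO, hV, hVc, hxO, hbV, hτ, hτ'⟩ := box p.1 b
  rw [nhdsWithin_univ]
  filter_upwards [hV.mem_nhds hbV,
    (hT p.1 b).contMDiffAt.continuousAt.preimage_mem_nhds (hO.mem_nhds hxO)] with c hc hcO
  exact ⟨prop hO hV hVc hτ hτ' hbV hc hxO, prop hO hV hVc hτ hτ' hc hbV hcO⟩

/-- A group bundle with connection over a simply connected base is, as a bundle with connection,
a product. -/
theorem exists_flat_trivialization [SimplyConnectedSpace B] {G : GroupObject (OverFull B)}
    (hG : IsGroupBundle G) : ∃ (F : SmoothMfd.{u}) (ev : F → B → G.X.left) (ρ : G.X.left → F),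
      ContMDiff (F.I.prod B.I) G.X.left.mfd.I ∞ (fun p : F × B => ev p.1 p.2) ∧
      ContMDiff G.X.left.mfd.I F.I ∞ ρ ∧ (∀ f b, HorizontalAt G.X.hom (ev f) b) ∧
      (∀ f b, ρ (ev f b) = f) ∧ ∀ x, ev (ρ x) (proj G.X.hom x) = x := by
  obtain ⟨b₀⟩ : Nonempty B := inferInstance
  have : Nonempty B := ⟨b₀⟩
  have hr := groupObject_rank G
  choose T hT hTx using fun x => exists_global_section hG x
  have hTs := contMDiff_transport hr hT hTx
  obtain ⟨F, e', hb, he, hes⟩ := hG b₀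
  let e : Bundle.Trivialization F (proj G.X.hom) := e'
  have huniq : ∀ {s t : B → G.X.left} (_ : ∀ b, HorizontalAt G.X.hom s b)
      (_ : ∀ b, HorizontalAt G.X.hom t b) {b₁}, s b₁ = t b₁ → ∀ b, s b = t b :=
    fun hs ht _ h b => HorizontalAt.eqOn hr isOpen_univ isPreconnected_univ (fun b _ => hs b)
      (fun b _ => ht b) (Set.mem_univ _) h b (Set.mem_univ b)
  -- The typical fiber is placed over `b₀`. The inverse of the trivialization transports a point
  -- back to `b₀` and reads its fiber coordinate there.
  let j : F → G.X.left := fun f => e.toOpenPartialHomeomorph.symm (b₀, f)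
  have hj : ContMDiff F.I G.X.left.mfd.I ∞ j :=
    hes.comp_contMDiff (contMDiff_const.prodMk contMDiff_id) (fun f => e.mem_target.2 hb)
  have hqj : ∀ f, proj G.X.hom (j f) = b₀ := fun f => e.proj_symm_apply' hb
  have hsrc : ∀ x, T x b₀ ∈ e.source := fun x => e.mem_source.2 (by
    rw [(hT x b₀).proj_eq]
    exact hb)
  let ρ : G.X.left → F := fun x => (e (T x b₀)).2
  have hjρ : ∀ x, j (ρ x) = T x b₀ := fun x => by
    have h₁ : e (T x b₀) = (b₀, ρ x) :=
      Prod.ext ((e.coe_fst (hsrc x)).trans (hT x b₀).proj_eq) rfl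
    change e.toOpenPartialHomeomorph.symm (b₀, ρ x) = _
    rw [← h₁]
    exact e.left_inv (hsrc x)
  have hTj : ∀ f, T (j f) b₀ = j f := fun f => by
    have := hTx (j f)
    rwa [hqj] at this
  refine ⟨F, fun f => T (j f), ρ, ?_, ?_, fun f => hT (j f), fun f b => ?_, fun x => ?_⟩
  · have h₁ : ContMDiff (F.I.prod B.I) (G.X.left.mfd.I.prod B.I) ∞
        (fun p : F × B => (j p.1, p.2)) := (hj.comp contMDiff_fst).prodMk contMDiff_snd
    exact hTs.comp h₁
  · have h₁ : ContMDiff G.X.left.mfd.I (G.X.left.mfd.I.prod B.I) ∞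
        (fun x : G.X.left => (x, b₀)) := contMDiff_id.prodMk contMDiff_const
    have h₂ : ContMDiff G.X.left.mfd.I G.X.left.mfd.I ∞ (fun x => T x b₀) := hTs.comp h₁
    have h₃ : ContMDiff G.X.left.mfd.I (B.I.prod F.I) ∞ (fun x => e (T x b₀)) :=
      he.comp_contMDiff h₂ hsrc
    exact contMDiff_snd.comp h₃
  · have h₁ : T (T (j f) b) b₀ = T (j f) b₀ := by
      refine huniq (hT _) (hT _) (b₁ := b) ?_ b₀
      have := hTx (T (j f) b)
      rwa [(hT (j f) b).proj_eq] at this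
    change (e (T (T (j f) b) b₀)).2 = f
    rw [h₁, hTj]
    exact congrArg Prod.snd (e.apply_symm_apply' hb)
  · change T (j (ρ x)) (proj G.X.hom x) = x
    rw [hjρ]
    refine (huniq (hT _) (hT x) (b₁ := b₀) ?_ _).trans (hTx x)
    have := hTx (T x b₀)
    rwa [(hT x b₀).proj_eq] at this

end Transport

end FMn

/-! ### Comparison of multiplications on the universal pair. -/

section UniversalElements

variable {C : Type v} [Category.{w} C] {T : C}

/-- It suffices to compare a product group `F × T` with a group over `T` on the universal pair of
elements. -/
theorem GroupObject.overElem_mulElem_of_universal {F : GroupObject C} {G : GroupObject (Over T)}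
    (P : BinProduct F.X T) (P' : BinProduct F.square.pt T) (φ : Over.mk P.snd ⟶ G.X)
    (h : P.overElem (Z := Over.mk P'.snd) (P'.fst ≫ F.mul) ≫ φ =
      G.mulElem (P.overElem (Z := Over.mk P'.snd) (P'.fst ≫ F.square.fst) ≫ φ)
        (P.overElem (Z := Over.mk P'.snd) (P'.fst ≫ F.square.snd) ≫ φ))
    {Z : Over T} (a b : Z.left ⟶ F.X) : P.overElem (F.mulElem a b) ≫ φ =
      G.mulElem (P.overElem a ≫ φ) (P.overElem b ≫ φ) := by
  let k : Z ⟶ Over.mk P'.snd := P'.overElem (F.square.lift a b)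
  have hk : ∀ {Y : C} (c : F.square.pt ⟶ Y), k.left ≫ P'.fst ≫ c = F.square.lift a b ≫ c := by
    intro Y c
    rw [← Category.assoc]
    exact congrArg (· ≫ c) (P'.lift_fst _ _)
  have h' := congrArg (k ≫ ·) h
  simp only [G.comp_mulElem, ← Category.assoc, P.comp_overElem] at h'
  simp only [Category.assoc, hk, BinProduct.lift_fst, BinProduct.lift_snd] at h'
  exact h'

end UniversalElements

/-! ### The Lie group of horizontal sections and the converse. -/

namespace FMn

section LieGroups

open scoped Topology
open Filter TopologicalSpace

/-- Smooth maps to a manifold foliated by its points are morphisms if the source is foliated by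
its points. -/
noncomputable def homOfRankZero {M N : FMn.{u}} (hM : M.fol.rank = 0) (hN : N.fol.rank = 0)
    (f : M → N) (hf : ContMDiff M.mfd.I N.mfd.I ∞ f) : M ⟶ N where
  toFun := f
  smooth := hf
  map_fiber x := by
    rw [fiber_eq_bot hM, fiber_eq_bot hN]
    exact Submodule.map_bot _

/-- A constant map to a manifold foliated by its points is a morphism. -/
noncomputable def constHom {M N : FMn.{u}} (hN : N.fol.rank = 0) (n : N) : M ⟶ N where
  toFun _ := n
  smooth := contMDiff_const
  map_fiber x := by
    rw [fiber_eq_bot hN, mfderiv_const]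
    exact Submodule.map_zero _

/-- A smooth inverse of a morphism is a morphism. -/
noncomputable def invHom {M N : FMn.{u}} (f : M ⟶ N) (g : N → M)
    (hg : ContMDiff N.mfd.I M.mfd.I ∞ g) (h₁ : ∀ x, g (f.toFun x) = x)
    (h₂ : ∀ y, f.toFun (g y) = y) : N ⟶ M where
  toFun := g
  smooth := hg
  map_fiber y := by
    let L : M.mfd.E →L[ℝ] N.mfd.E := mfderiv M.mfd.I N.mfd.I f.toFun (g y)
    let L' : N.mfd.E →L[ℝ] M.mfd.E := mfderiv N.mfd.I M.mfd.I g y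
    have hL : (M.fol.fiberE (g y)).map (L : M.mfd.E →ₗ[ℝ] N.mfd.E) = N.fol.fiberE y :=
      Eq.trans (f.map_fiber (g y)) (congrArg N.fol.fiberE (h₂ y))
    have hLL : ∀ v, L' (L v) = v := fun v => by
      have h := mfderiv_comp_apply_of_eq (y := y) (g y)
        (hg.mdifferentiableAt (by simp)) (mdifferentiableAt f (g y)) (h₂ y) v
      have h₃ : g ∘ f.toFun = id := funext h₁
      rw [h₃, mfderiv_id] at h
      exact h.symm
    change (N.fol.fiberE y).map (L' : N.mfd.E →ₗ[ℝ] M.mfd.E) = M.fol.fiberE (g y)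
    rw [← hL, ← Submodule.map_comp]
    have : (L' : N.mfd.E →ₗ[ℝ] M.mfd.E) ∘ₗ (L : M.mfd.E →ₗ[ℝ] N.mfd.E) = LinearMap.id :=
      LinearMap.ext hLL
    rw [this, Submodule.map_id]

/-- A Lie group, foliated by its points, is a group object. -/
@[reducible] noncomputable def lieGroupObject (F : SmoothMfd.{u}) [Group F]
    (hm : ContMDiff (F.I.prod F.I) F.I ∞ (fun p : F × F => p.1 * p.2))
    (hi : ContMDiff F.I F.I ∞ (fun f : F => f⁻¹)) : GroupObject FMn.{u} where
  X := zero F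
  pt := point
  isTerminal := isTerminalPoint
  square := binProduct (zero F) (zero F) rfl
  one := constHom rfl (1 : F)
  mul := homOfRankZero rfl rfl (fun p : F × F => p.1 * p.2) hm
  inv := homOfRankZero rfl rfl (fun f : F => f⁻¹) hi
  mul_assoc a b c := hom_ext fun z => mul_assoc (G := F) (a.toFun z) (b.toFun z) (c.toFun z)
  one_mul a := hom_ext fun z => one_mul (M := F) (a.toFun z)
  mul_one a := hom_ext fun z => mul_one (M := F) (a.toFun z)
  inv_mul a := hom_ext fun z => inv_mul_cancel (G := F) (a.toFun z)
  mul_inv a := hom_ext fun z => mul_inv_cancel (G := F) (a.toFun z)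

variable {B : SmoothMfd.{u}}

/-- A smooth family of horizontal sections, as a morphism over the base. -/
noncomputable def flatHom {W : OverFull B} (hr : W.left.fol.rank = B.dim) {F : SmoothMfd.{u}}
    {ev : F → B → W.left}
    (hev : ContMDiff (F.I.prod B.I) W.left.mfd.I ∞ (fun p : F × B => ev p.1 p.2))
    (hh : ∀ f b, HorizontalAt W.hom (ev f) b) :
    Over.mk (binProduct (zero F) (full B) rfl).snd ⟶ W :=
  overHom hr (Over.mk (binProduct (zero F) (full B) rfl).snd) (fun p : F × B => ev p.1 p.2) hev
    (fun p : F × B => (hh p.1 p.2).proj_eq) (by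
      have key : ∀ (p : F × B) (v : B.E), (mfderiv (F.I.prod B.I) W.left.mfd.I
          (fun p : F × B => ev p.1 p.2) p : F.E × B.E →L[ℝ] W.left.mfd.E) (0, v) ∈
          W.left.fol.fiberE (ev p.1 p.2) := fun p v => by
        have hsl : ContMDiff B.I (F.I.prod B.I) ∞ (fun b : B => ((p.1, b) : F × B)) :=
          contMDiff_const.prodMk contMDiff_id
        have h := mfderiv_comp_apply p.2 (hev.mdifferentiableAt (by simp) (x := p))
          (hsl.mdifferentiableAt (by simp) (x := p.2)) v
        have h' := h.trans (congrArg (mfderiv (F.I.prod B.I) W.left.mfd.I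
          (fun p : F × B => ev p.1 p.2) p : F.E × B.E →L[ℝ] W.left.mfd.E)
            (mfderiv_slice F B p.1 p.2 v))
        exact (congrArg (· ∈ W.left.fol.fiberE (ev p.1 p.2)) h').mp ((hh p.1 p.2).mem_fiber v)
      rintro p _ ⟨v, -, rfl⟩
      exact key p v)

/-- If the kernel pair of `π` splits over a simply connected base with a group bundle with
connection as splitting group, then it splits with a Lie group as splitting group. -/
theorem splits_of_groupBundle [SimplyConnectedSpace B] {M : FMn.{u}} {π : M ⟶ full B}
    {G : GroupObject (OverFull B)} (hG : IsGroupBundle G)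
    (h : KernelPairSplitsBy (relative π) G) :
    ∃ F : GroupObject FMn.{u}, KernelPairSplitsBy π F := by
  obtain ⟨b₀⟩ : Nonempty B := inferInstance
  have : Nonempty B := ⟨b₀⟩
  have hr := groupObject_rank G
  obtain ⟨F, ev, ρ, hev, hρ, hh, hρev, hevρ⟩ := exists_flat_trivialization hG
  have huniq : ∀ {s t : B → G.X.left} (_ : ∀ b, HorizontalAt G.X.hom s b)
      (_ : ∀ b, HorizontalAt G.X.hom t b), s b₀ = t b₀ → ∀ b, s b = t b :=
    fun hs ht h b => HorizontalAt.eqOn hr isOpen_univ isPreconnected_univ (fun b _ => hs b)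
      (fun b _ => ht b) (Set.mem_univ _) h b (Set.mem_univ b)
  have hflat : ∀ {s : B → G.X.left} (_ : ∀ b, HorizontalAt G.X.hom s b) (b : B),
      ev (ρ (s b₀)) b = s b := fun {s} hs => huniq (hh _) hs (by
    have := hevρ (s b₀)
    rwa [(hs b₀).proj_eq] at this)
  have hp : ∀ f b, proj G.X.hom (ev f b) = b := fun f b => (hh f b).proj_eq
  have hinj : ∀ {f g : F}, ev f b₀ = ev g b₀ → f = g := fun {f g} h => by
    rw [← hρev f b₀, h, hρev]
  -- Defined in the fiber over `b₀`, the product is the right one in every fiber, because a product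
  -- of horizontal sections is horizontal and is determined by its value at `b₀`.
  let m : F → F → F := fun f g => ρ (mulPt G (ev f b₀) (ev g b₀))
  have hm : ∀ f g b, ev (m f g) b = mulPt G (ev f b) (ev g b) := fun f g =>
    hflat (fun b => horizontalAt_mulPt isOpen_univ (fun b _ => hh f b) (fun b _ => hh g b) b
      (Set.mem_univ b))
  have hone : ∀ b, ev (ρ (unitPt G b₀)) b = unitPt G b := hflat (horizontalAt_unitPt G)
  have hinv : ∀ f b, ev (ρ (invPt G (ev f b₀))) b = invPt G (ev f b) := fun f =>
    hflat (fun b => horizontalAt_invPt isOpen_univ (fun b _ => hh f b) b (Set.mem_univ b))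
  let _ : Mul F := ⟨m⟩
  let _ : One F := ⟨ρ (unitPt G b₀)⟩
  let _ : Inv F := ⟨fun f => ρ (invPt G (ev f b₀))⟩
  have hm' : ∀ f g : F, ev (f * g) b₀ = mulPt G (ev f b₀) (ev g b₀) := fun f g => hm f g b₀
  have hone' : ev (1 : F) b₀ = unitPt G b₀ := hone b₀
  have hinv' : ∀ f : F, ev f⁻¹ b₀ = invPt G (ev f b₀) := fun f => hinv f b₀
  let _ : Group F := Group.ofLeftAxioms
    (fun f g k => hinj (by
      rw [hm', hm', hm', hm', mulPt_assoc ((hp _ _).trans (hp _ _).symm)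
        ((hp _ _).trans (hp _ _).symm)]))
    (fun f => hinj (by rw [hm', hone', unitPt_mulPt (hp _ _)]))
    (fun f => hinj (by rw [hm', hinv', hone', invPt_mulPt, hp]))
  have hms : ContMDiff (F.I.prod F.I) F.I ∞ (fun p : F × F => p.1 * p.2) := by
    have h₁ : ContMDiff ((F.I.prod F.I).prod B.I) (F.I.prod B.I) ∞
        (fun p : (F × F) × B => (p.1.1, p.2)) :=
      (contMDiff_fst.comp contMDiff_fst).prodMk contMDiff_snd
    have h₂ : ContMDiff ((F.I.prod F.I).prod B.I) (F.I.prod B.I) ∞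
        (fun p : (F × F) × B => (p.1.2, p.2)) :=
      (contMDiff_snd.comp contMDiff_fst).prodMk contMDiff_snd
    exact hρ.comp (contMDiff_mulPt_slice (G := G) (N := F.prod F) isOpen_univ
      (σ := fun n => ev n.1) (σ' := fun n => ev n.2)
      (fun n b _ => (hev.comp h₁).contMDiffAt (x := (n, b))) (fun n b _ => hh n.1 b)
      (fun n b _ => (hev.comp h₂).contMDiffAt (x := (n, b))) (fun n b _ => hh n.2 b)
      (Set.mem_univ b₀))
  have hsl : ContMDiff F.I (F.I.prod B.I) ∞ (fun f : F => (f, b₀)) :=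
    contMDiff_id.prodMk contMDiff_const
  have his : ContMDiff F.I F.I ∞ (fun f : F => f⁻¹) :=
    hρ.comp ((contMDiff_overApply G.inv).comp (hev.comp hsl))
  let P := binProduct (zero F) (full B) rfl
  let φ : Over.mk P.snd ⟶ G.X := flatHom hr hev hh
  have hsm : ContMDiff G.X.left.mfd.I (F.I.prod B.I) ∞ (fun x => (ρ x, proj G.X.hom x)) :=
    hρ.prodMk (contMDiff_proj G.X.hom)
  let ψ : G.X.left ⟶ P.pt := invHom φ.left (fun x => (ρ x, proj G.X.hom x)) hsm
    (fun p : F × B => Prod.ext (hρev p.1 p.2) (hp p.1 p.2)) hevρ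
  let Φ : Over.mk P.snd ≅ G.X := Over.isoMk
    { hom := φ.left
      inv := ψ
      hom_inv_id := hom_ext fun p : F × B => Prod.ext (hρev p.1 p.2) (hp p.1 p.2)
      inv_hom_id := hom_ext hevρ } (Over.w φ)
  let K := lieGroupObject F hms his
  let P' := binProduct K.square.pt (full B) rfl
  refine ⟨K, KernelPairSplitsBy.of_over h K P Φ (fun a b =>
    GroupObject.overElem_mulElem_of_universal P P' Φ.hom (over_hom_ext ?_) a b)
    (binProduct (zero F) M rfl)⟩
  rintro ⟨⟨f, g⟩, b⟩
  -- Each point of `(F × F) × B` lies on a constant section over `B`, which is horizontal; there the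
  -- abstract product is the pointwise one.
  have hS := overApply_mulElem G
    (P.overElem (Z := Over.mk P'.snd) (P'.fst ≫ K.square.fst) ≫ Φ.hom)
    (P.overElem (Z := Over.mk P'.snd) (P'.fst ≫ K.square.snd) ≫ Φ.hom)
    (P'.overElem (Z := secObj B ⊤) (constHom rfl ((f, g) : F × F))) ⟨b, trivial⟩
  exact (hm f g b).trans hS.symm

end LieGroups

end FMn


theorem mainTheorem10 (B : SmoothMfd.{u}) [SimplyConnectedSpace B] (M : FMn.{u})
    (π : M ⟶ FMn.full B) (hrank : M.fol.rank = B.dim) :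
    (∃ G : GroupObject FMn.{u}, KernelPairSplitsBy π G) ↔
      ∃ G : GroupObject (FMn.OverFull B),
        FMn.IsGroupBundle G ∧ KernelPairSplitsBy (FMn.relative π) G := by
  exact ⟨FMn.exists_groupBundle_of_splits π, fun ⟨_, hG, h⟩ => FMn.splits_of_groupBundle hG h⟩
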